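/- **Notation.** Write $\langle x\rangle=1+|x|$, let $\hat u(\xi,\tau)=\iint u(x,t)e^{-i(x\xi+t\tau)}\,dx\,dt$ denote the space-time Fourier transform on $\mathbb R^2$ (extended to $L^2$ by Plancherel), and for $s,b\in\mathbb R$ set $$\|u\|_{X^{s,b}}=\Big(\iint\langle\tau+|\xi|\xi\rangle^{2b}\langle\xi\rangle^{2s}|\hat u(\xi,\tau)|^2\,d\xi\,d\tau\Big)^{1/2},\qquad \|u\|_{Z^{s,b}}=\Big(\int\Big(\int\langle\tau+|\xi|\xi\rangle^{b}\langle\xi\rangle^{s}|\hat u(\xi,\tau)|\,d\tau\Big)^2d\xi\Big)^{1/2}.$$ Fix $\eta\in C_0^\infty(\mathbb R)$ with $0\le\eta\le1$, $\eta=1$ on $[-1,1]$ and $\operatorname{supp}\eta\subset[-2,2]$. Put $\phi(\xi)=\eta(\xi)-\eta(2\xi)$ and, for $N\in\{2^n:n\ge 0\}$, let $P_N$ be the Fourier multiplier in $x$ with symbol $\phi(\xi/N)$. Let $P_{hi}=\sum_{N\ge2}P_N$ and $P_{lo}=1-P_{hi}$, let $P_\pm$ be the Fourier projections in $x$ onto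 $\{\pm\xi>0\}$, and let $P_{+hi}=P_+P_{hi}$. Set $$\|u\|_{\widetilde Z^{s,b}}=\|P_{lo}u\|_{Z^{s,b}}+\Big(\sum_{N\ge 1}\|P_Nu\|_{Z^{s,b}}^2\Big)^{1/2}.$$ The operators $\partial_x$ and $\partial_x^{-1}$ have symbols $i\xi$ and $(i\xi)^{-1}$. **Proposition.** Let $s\ge0$. There is a constant $C$, depending only on $s$ and $\eta$, such that the following holds for all complex-valued $w,u\in L^2(\mathbb R^2)$ such that * $w\in X^{s,\frac12}$, and the spatial frequencies of $w$ stay away from zero, i.e. for some $\delta>0$, $\hat w(\xi,\tau)=0$ for almost every $(\xi,\tau)$ with $|\xi|<\delta$ (so that $\partial_x^{-1}w$ is well defined); * $u\in L^2_{x,t}\cap L^4_{x,t}\cap X^{-1,1}$. The product $\partial_x^{-1}w\cdot P_-\partial_xu$ is well defined, in the sense that the convolution $(2\pi)^{-2}\,\widehat{\partial_x^{-1}w}*\widehat{P_-\partial_xu}$ giving its Fourier transform converges absolutely at every $(\xi,\tau)\in\mathbb R^2$, and $$\big\|\partial_xP_{+hi}\big(\partial_x^{-1}w\,P_-\partial_xu\big)\big\|_{X^{s,-\frac12}}\le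 C\,\|w\|_{X^{s,\frac12}}\big(\|u\|_{L^2_{x,t}}+\|u\|_{L^4_{x,t}}+\|u\|_{X^{-1,1}}\big),$$ $$\big\|\partial_xP_{+hi}\big(\partial_x^{-1}w\,P_-\partial_xu\big)\big\|_{\widetilde Z^{s,-1}}\le C\,\|w\|_{X^{s,\frac12}}\big(\|u\|_{L^2_{x,t}}+\|u\|_{L^4_{x,t}}+\|u\|_{X^{-1,1}}\big).$$ The constant $C$ does not depend on $\delta$. -/

import Mathlib

open MeasureTheory
open scoped ENNReal NNReal FourierTransform

noncomputable section

namespace BenjaminOno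

/-- The space-time plane `ℝ²`: coordinate `0` is the space variable `x`,
coordinate `1` is the time variable `t`. -/
abbrev SpaceTime : Type := EuclideanSpace ℝ (Fin 2)

/-- Complex valued square integrable functions on space-time. -/
abbrev L2xt : Type := Lp ℂ 2 (volume : Measure SpaceTime)

/-- `⟨x⟩ = 1 + |x|`. -/
def bracket (x : ℝ) : ℝ := 1 + |x|

/-- Space-time Fourier transform of an `L²` function (extended from Schwartz functions by
Plancherel), in the angular normalization
`û(ξ, τ) = ∫∫ u(x, t) e^{-i (x ξ + t τ)} dx dt`. Mathlib's `𝓕` uses the phase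
`e^{-2 π i (x ξ + t τ)}`, hence the rescaling of the frequencies. -/
def spaceTimeFourier (u : L2xt) : ℝ × ℝ → ℂ :=
  fun ζ => (𝓕 u : L2xt) !₂[ζ.1 / (2 * Real.pi), ζ.2 / (2 * Real.pi)]

/-! Below, space-time functions or distributions are handled through their Fourier transforms
`F : ℝ × ℝ → ℂ`, `F (ξ, τ)`, with `ξ` dual to `x` and `τ` dual to `t`. -/

/-- The Fourier transform of `m(D_x) u`, from the symbol `m` and the Fourier transform of `u`. -/
def spaceMultiplier (m : ℝ → ℂ) (F : ℝ × ℝ → ℂ) : ℝ × ℝ → ℂ :=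
  fun ζ => m ζ.1 * F ζ

/-- The integrand of the convolution of `F` and `G` at the frequency `ζ`. -/
def convIntegrand (F G : ℝ × ℝ → ℂ) (ζ : ℝ × ℝ) : ℝ × ℝ → ℂ :=
  fun ζ₁ => F ζ₁ * G (ζ - ζ₁)

/-- The Fourier transform of a product `f g`, as the convolution `(2 π)⁻² (f̂ ∗ ĝ)`. -/
def fourierProduct (F G : ℝ × ℝ → ℂ) : ℝ × ℝ → ℂ :=
  fun ζ => ((2 * Real.pi) ^ 2 : ℂ)⁻¹ * ∫ ζ₁ : ℝ × ℝ, convIntegrand F G ζ ζ₁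

/-- The symbol of `∂_x`. -/
def dxSymbol (ξ : ℝ) : ℂ := Complex.I * ξ

/-- The symbol of `∂_x⁻¹`; used only for functions whose spatial frequencies stay away
from `0`. -/
def dxInvSymbol (ξ : ℝ) : ℂ := (Complex.I * ξ)⁻¹

/-- The symbol of `P_+`. -/
def posSymbol : ℝ → ℂ := Set.indicator (Set.Ioi 0) 1

/-- The symbol of `P_-`. -/
def negSymbol : ℝ → ℂ := Set.indicator (Set.Iio 0) 1

/-- The admissible cutoff functions: `η ∈ C_0^∞(ℝ)`, `0 ≤ η ≤ 1`, `η = 1` on `[-1, 1]` and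
`supp η ⊆ [-2, 2]`. -/
structure IsCutoff (η : ℝ → ℝ) : Prop where
  smooth : ContDiff ℝ (⊤ : ℕ∞) η
  nonneg : ∀ ξ, 0 ≤ η ξ
  le_one : ∀ ξ, η ξ ≤ 1
  eq_one : ∀ ξ ∈ Set.Icc (-1 : ℝ) 1, η ξ = 1
  support_subset : tsupport η ⊆ Set.Icc (-2 : ℝ) 2

/-- `φ_N` for `N = 2 ^ n`: `φ_N(ξ) = φ(ξ / N)` with `φ(ξ) = η(ξ) - η(2 ξ)`. -/
def lpSymbol (η : ℝ → ℝ) (n : ℕ) (ξ : ℝ) : ℂ :=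
  ((η (ξ / 2 ^ n) - η (2 * (ξ / 2 ^ n)) : ℝ) : ℂ)

/-- The symbol of `P_hi = ∑_{N ≥ 2} P_N` (for each `ξ` only finitely many terms are nonzero). -/
def hiSymbol (η : ℝ → ℝ) (ξ : ℝ) : ℂ := ∑' n : ℕ, lpSymbol η (n + 1) ξ

/-- The symbol of `P_lo = 1 - P_hi`. -/
def loSymbol (η : ℝ → ℝ) (ξ : ℝ) : ℂ := 1 - hiSymbol η ξ

/-- The symbol of `P_{+hi} = P_+ P_hi`. -/
def posHiSymbol (η : ℝ → ℝ) (ξ : ℝ) : ℂ := posSymbol ξ * hiSymbol η ξ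

/-- The `X^{s,b}` norm
`(∫∫ ⟨τ + |ξ| ξ⟩^{2b} ⟨ξ⟩^{2s} |û(ξ, τ)|² dξ dτ)^{1/2}` in terms of the Fourier transform
`F = û`. -/
def xNorm (s b : ℝ) (F : ℝ × ℝ → ℂ) : ℝ≥0∞ :=
  (∫⁻ ζ : ℝ × ℝ, ENNReal.ofReal
      (bracket (ζ.2 + |ζ.1| * ζ.1) ^ (2 * b) * bracket ζ.1 ^ (2 * s)) * ‖F ζ‖ₑ ^ 2)
    ^ (1 / 2 : ℝ)

/-- The `Z^{s,b}` norm
`(∫ (∫ ⟨τ + |ξ| ξ⟩^b ⟨ξ⟩^s |û(ξ, τ)| dτ)² dξ)^{1/2}` in terms of the Fourier transform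
`F = û`. -/
def zNorm (s b : ℝ) (F : ℝ × ℝ → ℂ) : ℝ≥0∞ :=
  (∫⁻ ξ : ℝ, (∫⁻ τ : ℝ, ENNReal.ofReal
      (bracket (τ + |ξ| * ξ) ^ b * bracket ξ ^ s) * ‖F (ξ, τ)‖ₑ) ^ 2) ^ (1 / 2 : ℝ)

/-- The `Z̃^{s,b}` norm `‖P_lo u‖_{Z^{s,b}} + (∑_{N ≥ 1} ‖P_N u‖²_{Z^{s,b}})^{1/2}` in terms of
the Fourier transform `F = û`, where `N` ranges over `2 ^ n`, `n ≥ 0`. -/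
def zTildeNorm (η : ℝ → ℝ) (s b : ℝ) (F : ℝ × ℝ → ℂ) : ℝ≥0∞ :=
  zNorm s b (spaceMultiplier (loSymbol η) F) +
    (∑' n : ℕ, zNorm s b (spaceMultiplier (lpSymbol η n) F) ^ 2) ^ (1 / 2 : ℝ)

/-- The Fourier transform of `∂_x⁻¹ w`. -/
def dxInvHat (w : L2xt) : ℝ × ℝ → ℂ :=
  spaceMultiplier dxInvSymbol (spaceTimeFourier w)

/-- The Fourier transform of `P_- ∂_x u`. -/
def negDxHat (u : L2xt) : ℝ × ℝ → ℂ :=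
  spaceMultiplier negSymbol (spaceMultiplier dxSymbol (spaceTimeFourier u))

/-- The Fourier transform of `∂_x P_{+hi} (∂_x⁻¹ w · P_- ∂_x u)`. -/
def bilinearHat (η : ℝ → ℝ) (w u : L2xt) : ℝ × ℝ → ℂ :=
  spaceMultiplier dxSymbol (spaceMultiplier (posHiSymbol η)
    (fourierProduct (dxInvHat w) (negDxHat u)))

end BenjaminOno

end

namespace BenjaminOno

/-! Write ξ, ξ₁, ξ₂ for the space frequencies of the output, of w and of u, and σ, σ₁, σ₂ for the
modulations. The projections force ξ ≥ 1 and ξ₂ < 0, so ξ₁ = ξ + |ξ₂| is positive and dominates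
both. The product carries the symbol ξ|ξ₂|/ξ₁. Since σ = σ₁ + σ₂ - 2ξ|ξ₂|, at least one modulation
is comparable to or larger than ξ|ξ₂| (`bracket_modulation_ge`).

The analytic input is the L⁴ Strichartz estimate for Schrödinger, in the form X^{0,7/16} ⊂ L⁴
(`lintegral_sq_conv_le`). It is available for w and for the output because at positive frequencies
the modulation is τ + ξ². Combined with Hölder and Plancherel it gives ‖h u‖_{L²} ≲ ‖h‖_{X^{0,7/16}}
‖u‖_{L⁴}, and by duality L² · L⁴ → X^{0,-7/16}. Because 7/16 < 1/2, the X^{0,-7/16} norm controls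
both X^{0,-1/2} and Z^{0,-1} at positive frequencies (`outNorm_le_weighted`), so the two target
norms are handled together by `outNorm`.

Localize to ξ ∼ 2^n and |ξ₂| ∼ 2^k, which forces ξ₁ ∼ 2^{max n k}. If σ or σ₁ is large, the
modulation gains 2^{-(n+k)/2}, and the L⁴ estimate or its dual leaves the coefficient 2^{(n+k)/2 -
max n k} = 2^{-|n-k|/2}; the double sum then converges (`outNorm_largePart_le`,
`outNorm_tsum_largePart_le`). If only σ₂ is large, the symbol is at most 2⟨σ₂⟩/⟨ξ₂⟩, the weight of
X^{-1,1}, and the dual Strichartz estimate with u in weighted L² finishes without any decay in k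
(`small_modulation_term_le`, `lintegral_weight_sq_conv_le`). Finally, the Littlewood–Paley pieces
overlap boundedly, so the Z̃ norm is at most three times the Z norm. -/

/-! ### Bracket weights and their integrability. -/

lemma one_le_bracket (x : ℝ) : 1 ≤ bracket x := by
  unfold bracket; linarith [abs_nonneg x]

lemma bracket_pos (x : ℝ) : 0 < bracket x := zero_lt_one.trans_le (one_le_bracket x)

lemma measurable_bracket : Measurable bracket := by unfold bracket; fun_prop

/-- The weight `⟨x⟩ ^ p` with values in `[0, ∞]`. -/
noncomputable def bracketPow (x p : ℝ) : ℝ≥0∞ := ENNReal.ofReal (bracket x ^ p)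

lemma bracketPow_mul (x p q : ℝ) : bracketPow x p * bracketPow x q = bracketPow x (p + q) := by
  unfold bracketPow
  rw [← ENNReal.ofReal_mul (Real.rpow_nonneg (bracket_pos x).le _), Real.rpow_add (bracket_pos x)]

lemma bracketPow_zero (x : ℝ) : bracketPow x 0 = 1 := by simp [bracketPow]

lemma bracketPow_sq (x p : ℝ) : bracketPow x p ^ 2 = bracketPow x (2 * p) := by
  rw [sq, bracketPow_mul, two_mul]

lemma bracketPow_neg_mul_cancel (x p : ℝ) : bracketPow x (-p) * bracketPow x p = 1 := by
  rw [bracketPow_mul, neg_add_cancel, bracketPow_zero]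

lemma bracketPow_ne_top (x p : ℝ) : bracketPow x p ≠ ∞ := ENNReal.ofReal_ne_top

lemma bracketPow_mono (x : ℝ) {p q : ℝ} (h : p ≤ q) : bracketPow x p ≤ bracketPow x q :=
  ENNReal.ofReal_le_ofReal (Real.rpow_le_rpow_of_exponent_le (one_le_bracket x) h)

lemma measurable_bracketPow (p : ℝ) : Measurable fun x => bracketPow x p :=
  ENNReal.measurable_ofReal.comp (measurable_bracket.pow_const p)

@[fun_prop]
lemma Measurable.bracketPow {α : Type*} [MeasurableSpace α] {f : α → ℝ} (hf : Measurable f)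
    (p : ℝ) : Measurable fun a => bracketPow (f a) p :=
  (measurable_bracketPow p).comp hf

lemma sq_lintegral_mul_le {α : Type*} [MeasurableSpace α] {μ : Measure α} {f g : α → ℝ≥0∞}
    (hf : AEMeasurable f μ) (hg : AEMeasurable g μ) :
    (∫⁻ a, f a * g a ∂μ) ^ 2 ≤ (∫⁻ a, f a ^ 2 ∂μ) * ∫⁻ a, g a ^ 2 ∂μ := by
  have h := ENNReal.lintegral_mul_le_Lp_mul_Lq μ Real.HolderConjugate.two_two hf hg
  calc (∫⁻ a, f a * g a ∂μ) ^ 2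
      ≤ ((∫⁻ a, f a ^ (2 : ℝ) ∂μ) ^ (1 / 2 : ℝ) * (∫⁻ a, g a ^ (2 : ℝ) ∂μ) ^ (1 / 2 : ℝ)) ^ 2 := by
        gcongr; exact h
    _ = _ := by
        rw [mul_pow, ← ENNReal.rpow_natCast, ← ENNReal.rpow_natCast, ← ENNReal.rpow_mul,
          ← ENNReal.rpow_mul]
        simp

lemma lintegral_bracketPow_lt_top {p : ℝ} (hp : p < -1) : ∫⁻ x, bracketPow x p < ∞ := by
  have h := integrable_one_add_norm (E := ℝ) (μ := volume) (r := -p) (by simp; linarith)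
  have := h.lintegral_lt_top
  simpa [bracketPow, bracket] using this

lemma lintegral_bracketPow_sq_lt_top {p : ℝ} (hp : p < -1 / 2) :
    ∫⁻ x, bracketPow (2 * x ^ 2) p < ∞ := by
  have h := integrable_rpow_neg_one_add_norm_sq (E := ℝ) (μ := volume) (r := -2 * p)
    (by simp; linarith)
  refine lt_of_le_of_lt (lintegral_mono fun x => ?_) h.lintegral_lt_top
  refine ENNReal.ofReal_le_ofReal ?_
  have : -(-2 * p) / 2 = p := by ring
  rw [this]
  refine Real.rpow_le_rpow_of_nonpos (by positivity) ?_ (by linarith)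
  rw [bracket, abs_of_nonneg (by positivity), Real.norm_eq_abs, sq_abs]
  nlinarith [sq_nonneg x]

/-! ### The bilinear L² estimate for the Schrödinger dispersion relation. -/

/-- The larger of the two brackets is at least half that of t + u. Of its exponent -7/8, the part
-5/8 goes to the sum, and the remaining -1/4 moves to the smaller bracket, which reaches the
integrable exponent -9/8. -/
lemma bracketPow_mul_bracketPow_le (t u : ℝ) :
    bracketPow t (-7 / 8) * bracketPow u (-7 / 8) ≤
      2 * bracketPow (t + u) (-5 / 8) * (bracketPow t (-9 / 8) + bracketPow u (-9 / 8)) := by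
  have key : ∀ t u : ℝ, bracket t ≤ bracket u → bracketPow t (-7 / 8) * bracketPow u (-7 / 8) ≤
      2 * bracketPow (t + u) (-5 / 8) * bracketPow t (-9 / 8) := by
    intro t u h
    have ht := bracket_pos t
    have hu := bracket_pos u
    have h1 : bracket (t + u) ≤ 2 * bracket u := by
      unfold bracket at *; linarith [abs_add_le t u]
    unfold bracketPow
    rw [show (2 : ℝ≥0∞) = ENNReal.ofReal 2 by simp, ← ENNReal.ofReal_mul (by positivity),
      ← ENNReal.ofReal_mul (by norm_num), ← ENNReal.ofReal_mul]
    · refine ENNReal.ofReal_le_ofReal ?_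
      have e1 : bracket u ^ (-7 / 8 : ℝ) = bracket u ^ (-1 / 4 : ℝ) * bracket u ^ (-5 / 8 : ℝ) := by
        rw [← Real.rpow_add hu]; norm_num
      have e2 : bracket t ^ (-9 / 8 : ℝ) = bracket t ^ (-7 / 8 : ℝ) * bracket t ^ (-1 / 4 : ℝ) := by
        rw [← Real.rpow_add ht]; norm_num
      have e3 : bracket u ^ (-1 / 4 : ℝ) ≤ bracket t ^ (-1 / 4 : ℝ) :=
        Real.rpow_le_rpow_of_nonpos ht h (by norm_num)
      have e4 : bracket u ^ (-5 / 8 : ℝ) ≤ 2 * bracket (t + u) ^ (-5 / 8 : ℝ) := by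
        have : (2 * bracket u) ^ (-5 / 8 : ℝ) ≤ bracket (t + u) ^ (-5 / 8 : ℝ) :=
          Real.rpow_le_rpow_of_nonpos (bracket_pos _) h1 (by norm_num)
        rw [Real.mul_rpow (by norm_num) hu.le] at this
        have h2 : (1 / 2 : ℝ) ≤ 2 ^ (-5 / 8 : ℝ) := by
          rw [show (1 / 2 : ℝ) = 2 ^ (-1 : ℝ) by rw [Real.rpow_neg_one]; norm_num]
          exact Real.rpow_le_rpow_of_exponent_le (by norm_num) (by norm_num)
        have h3 : 0 < bracket u ^ (-5 / 8 : ℝ) := Real.rpow_pos_of_pos hu _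
        nlinarith
      rw [e1, e2]
      have p1 : 0 < bracket t ^ (-7 / 8 : ℝ) := Real.rpow_pos_of_pos ht _
      have p2 : 0 < bracket t ^ (-1 / 4 : ℝ) := Real.rpow_pos_of_pos ht _
      have p3 : 0 < bracket u ^ (-5 / 8 : ℝ) := Real.rpow_pos_of_pos hu _
      calc _ ≤ bracket t ^ (-7 / 8 : ℝ) * (bracket t ^ (-1 / 4 : ℝ) *
            (2 * bracket (t + u) ^ (-5 / 8 : ℝ))) := by gcongr
        _ = _ := by ring
    · have := bracket_pos (t + u); positivity
  rcases le_total (bracket t) (bracket u) with h | h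
  · exact (key t u h).trans (by gcongr; exact le_self_add)
  · rw [mul_comm, add_comm t u]
    exact (key u t h).trans (by gcongr; exact le_add_self)

lemma lintegral_bracketPow_mul_sub_le (a : ℝ) :
    ∫⁻ t, bracketPow t (-7 / 8) * bracketPow (a - t) (-7 / 8) ≤
      4 * (∫⁻ t, bracketPow t (-9 / 8)) * bracketPow a (-5 / 8) := by
  calc ∫⁻ t, bracketPow t (-7 / 8) * bracketPow (a - t) (-7 / 8)
      ≤ ∫⁻ t, 2 * bracketPow a (-5 / 8) *
          (bracketPow t (-9 / 8) + bracketPow (a - t) (-9 / 8)) := by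
        refine lintegral_mono fun t => ?_
        have := bracketPow_mul_bracketPow_le t (a - t)
        rwa [add_sub_cancel] at this
    _ = 2 * bracketPow a (-5 / 8) * ((∫⁻ t, bracketPow t (-9 / 8)) + ∫⁻ t, bracketPow t (-9 / 8)) := by
        rw [lintegral_const_mul _ (by fun_prop), lintegral_add_left (by fun_prop),
          lintegral_sub_left_eq_self (fun t => bracketPow t (-9 / 8))]
    _ = _ := by ring

/-- The bound is uniform in A because |A + 2y²| dominates 2(|y| - B)² for a suitable B, and the two
signs of y give two translates of one integrable function. -/
lemma lintegral_bracketPow_add_sq_le (A : ℝ) :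
    ∫⁻ y, bracketPow (A + 2 * y ^ 2) (-5 / 8) ≤ 2 * ∫⁻ y, bracketPow (2 * y ^ 2) (-5 / 8) := by
  -- For A ≤ 0 this is the nonnegative root of A + 2y², so A + 2y² = 2(|y| - B)(|y| + B); for A ≥ 0
  -- it is 0.
  set B := Real.sqrt (max (-A) 0 / 2) with hB
  have hB0 : 0 ≤ B := Real.sqrt_nonneg _
  have hB2 : 2 * B ^ 2 = max (-A) 0 := by
    rw [hB, Real.sq_sqrt (by positivity)]; ring
  have key : ∀ y : ℝ, 2 * (|y| - B) ^ 2 ≤ |A + 2 * y ^ 2| := by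
    intro y
    rcases le_total A 0 with h | h
    · rw [max_eq_left (by linarith)] at hB2
      have : A + 2 * y ^ 2 = 2 * (|y| - B) * (|y| + B) := by rw [← sq_abs y]; nlinarith
      rw [this, abs_mul, abs_mul, abs_of_nonneg (by positivity : 0 ≤ |y| + B), abs_two]
      have h1 : |(|y| - B)| ≤ |y| + B := by
        rw [abs_le]; constructor <;> linarith [abs_nonneg y]
      calc 2 * (|y| - B) ^ 2 = 2 * |(|y| - B)| * |(|y| - B)| := by
            rw [← sq_abs (|y| - B)]; ring
        _ ≤ _ := by gcongr
    · rw [max_eq_right (by linarith)] at hB2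
      have : B = 0 := by nlinarith
      rw [this, sub_zero, sq_abs, abs_of_nonneg (by positivity)]; linarith
  calc ∫⁻ y, bracketPow (A + 2 * y ^ 2) (-5 / 8)
      ≤ ∫⁻ y, (bracketPow (2 * (y - B) ^ 2) (-5 / 8) + bracketPow (2 * (y + B) ^ 2) (-5 / 8)) := by
        refine lintegral_mono fun y => ?_
        have h1 : bracketPow (A + 2 * y ^ 2) (-5 / 8) ≤ bracketPow (2 * (|y| - B) ^ 2) (-5 / 8) := by
          refine ENNReal.ofReal_le_ofReal
            (Real.rpow_le_rpow_of_nonpos (bracket_pos _) ?_ (by norm_num))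
          unfold bracket
          rw [abs_of_nonneg (by positivity : (0 : ℝ) ≤ 2 * (|y| - B) ^ 2)]
          linarith [key y]
        refine h1.trans ?_
        rcases abs_cases y with ⟨h, -⟩ | ⟨h, -⟩
        · rw [h]; exact le_self_add
        · rw [h, show (-y - B) ^ 2 = (y + B) ^ 2 by ring]; exact le_add_self
    _ = _ := by
        rw [lintegral_add_left (by fun_prop),
          lintegral_sub_right_eq_self (fun y => bracketPow (2 * y ^ 2) (-5 / 8)),
          lintegral_add_right_eq_self (fun y => bracketPow (2 * y ^ 2) (-5 / 8)), two_mul]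

/-- The constant in the Schrödinger bilinear estimate `lintegral_sq_conv_le`. -/
noncomputable def schrodingerConst : ℝ≥0∞ :=
  4 * (∫⁻ t, bracketPow t (-9 / 8)) * (2 * ∫⁻ y, bracketPow (2 * y ^ 2) (-5 / 8))

lemma schrodingerConst_ne_top : schrodingerConst ≠ ∞ := by
  have h1 := (lintegral_bracketPow_lt_top (p := -9 / 8) (by norm_num)).ne
  have h2 := (lintegral_bracketPow_sq_lt_top (p := -5 / 8) (by norm_num)).ne
  unfold schrodingerConst
  finiteness

/-- Integrating in time leaves a bracket to the power -5/8 evaluated at τ + x² + (ξ - x)² = τ + ξ²/2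
+ 2(x - ξ/2)². This quadratic growth makes the x-integral converge, since 2 · 5/8 > 1. It is the
curvature that permits an exponent 7/16 below 1/2. -/
lemma lintegral_schrodinger_kernel_le (ζ : ℝ × ℝ) :
    ∫⁻ z : ℝ × ℝ, bracketPow (z.2 + z.1 ^ 2) (-7 / 8) *
      bracketPow ((ζ - z).2 + (ζ - z).1 ^ 2) (-7 / 8) ≤ schrodingerConst := by
  rw [Measure.volume_eq_prod, lintegral_prod _ (by fun_prop)]
  have inner : ∀ x : ℝ, ∫⁻ t : ℝ, bracketPow (t + x ^ 2) (-7 / 8) *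
      bracketPow ((ζ.2 - t) + (ζ.1 - x) ^ 2) (-7 / 8) ≤
      4 * (∫⁻ t, bracketPow t (-9 / 8)) *
        bracketPow (ζ.2 + ζ.1 ^ 2 / 2 + 2 * (x - ζ.1 / 2) ^ 2) (-5 / 8) := by
    intro x
    rw [← lintegral_sub_right_eq_self _ (x ^ 2)]
    refine le_trans (le_of_eq (lintegral_congr fun t => ?_)) (lintegral_bracketPow_mul_sub_le _)
    rw [sub_add_cancel]
    congr 2
    ring
  calc _ ≤ ∫⁻ x, 4 * (∫⁻ t, bracketPow t (-9 / 8)) *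
        bracketPow (ζ.2 + ζ.1 ^ 2 / 2 + 2 * (x - ζ.1 / 2) ^ 2) (-5 / 8) := lintegral_mono inner
    _ ≤ _ := by
      rw [lintegral_const_mul _ (by fun_prop), schrodingerConst,
        lintegral_sub_right_eq_self
          (fun x => bracketPow (ζ.2 + ζ.1 ^ 2 / 2 + 2 * x ^ 2) (-5 / 8))]
      gcongr
      exact lintegral_bracketPow_add_sq_le _

lemma lintegral_conv {f g : ℝ × ℝ → ℝ≥0∞} (hf : Measurable f) (hg : Measurable g) :
    ∫⁻ ζ, ∫⁻ z, f z * g (ζ - z) = (∫⁻ z, f z) * ∫⁻ z, g z := by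
  rw [lintegral_lintegral_swap (by fun_prop)]
  calc _ = ∫⁻ z, f z * ∫⁻ z, g z := by
        refine lintegral_congr fun z => ?_
        rw [lintegral_const_mul _ (by fun_prop), lintegral_sub_right_eq_self g]
    _ = _ := lintegral_mul_const _ hf

/-- The bilinear `L²` form of the `L⁴` Strichartz estimate for the Schrödinger equation. -/
lemma lintegral_sq_conv_le {f g : ℝ × ℝ → ℝ≥0∞} (hf : Measurable f) (hg : Measurable g) :
    ∫⁻ ζ, (∫⁻ z, f z * g (ζ - z)) ^ 2 ≤ schrodingerConst *
      (∫⁻ z, bracketPow (z.2 + z.1 ^ 2) (7 / 8) * f z ^ 2) *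
      ∫⁻ z, bracketPow (z.2 + z.1 ^ 2) (7 / 8) * g z ^ 2 := by
  set σ : ℝ × ℝ → ℝ := fun z => z.2 + z.1 ^ 2 with hσ
  have hσm : Measurable σ := by fun_prop
  have hpt : ∀ ζ : ℝ × ℝ, (∫⁻ z, f z * g (ζ - z)) ^ 2 ≤ schrodingerConst *
      ∫⁻ z, (bracketPow (σ z) (7 / 8) * f z ^ 2) *
        (bracketPow (σ (ζ - z)) (7 / 8) * g (ζ - z) ^ 2) := by
    intro ζ
    calc (∫⁻ z, f z * g (ζ - z)) ^ 2
        -- Insert compensating weights so that Cauchy–Schwarz separates the kernel, bounded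
        -- uniformly in ζ, from the weighted squares.
        = (∫⁻ z, (bracketPow (σ z) (-7 / 16) * bracketPow (σ (ζ - z)) (-7 / 16)) *
            ((bracketPow (σ z) (7 / 16) * f z) *
              (bracketPow (σ (ζ - z)) (7 / 16) * g (ζ - z)))) ^ 2 := by
          congr 1
          refine lintegral_congr fun z => ?_
          have h1 := bracketPow_neg_mul_cancel (σ z) (7 / 16)
          have h2 := bracketPow_neg_mul_cancel (σ (ζ - z)) (7 / 16)
          rw [neg_div']  at h1 h2
          calc f z * g (ζ - z) = (bracketPow (σ z) (-7 / 16) * bracketPow (σ z) (7 / 16)) *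
              (bracketPow (σ (ζ - z)) (-7 / 16) * bracketPow (σ (ζ - z)) (7 / 16)) *
              (f z * g (ζ - z)) := by rw [h1, h2]; ring
            _ = _ := by ring
      _ ≤ _ := by
          refine (sq_lintegral_mul_le (by fun_prop) (by fun_prop)).trans ?_
          simp only [mul_pow, bracketPow_sq]
          norm_num only
          gcongr
          have := lintegral_schrodinger_kernel_le ζ
          norm_num only at this
          exact this
  calc _ ≤ ∫⁻ ζ, schrodingerConst * ∫⁻ z, (bracketPow (σ z) (7 / 8) * f z ^ 2) *
        (bracketPow (σ (ζ - z)) (7 / 8) * g (ζ - z) ^ 2) := lintegral_mono hpt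
    _ = _ := by
      rw [lintegral_const_mul' _ _ schrodingerConst_ne_top, lintegral_conv
        (f := fun z => bracketPow (σ z) (7 / 8) * f z ^ 2)
        (g := fun z => bracketPow (σ z) (7 / 8) * g z ^ 2) (by fun_prop) (by fun_prop), mul_assoc]

/-- Both sides expand to the integral of H(a)H(b)V(c)V(d) over a + c = b + d, up to renaming. On the
physical side this is ‖h v̄‖_{L²} = ‖h v‖_{L²}; it lets the correlation produced by duality be
estimated as a convolution. -/
lemma lintegral_sq_corr_eq {H V : ℝ × ℝ → ℝ≥0∞} (hH : Measurable H) (hV : Measurable V) :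
    ∫⁻ ζ, (∫⁻ z, H (z + ζ) * V z) ^ 2 = ∫⁻ ζ, (∫⁻ z, H z * V (ζ - z)) ^ 2 := by
  have sq_eq : ∀ f : ℝ × ℝ → ℝ≥0∞, Measurable f → (∫⁻ z, f z) ^ 2 = ∫⁻ z, ∫⁻ w, f z * f w := by
    intro f hf
    rw [sq, ← lintegral_mul_const _ hf]
    exact lintegral_congr fun z => (lintegral_const_mul _ hf).symm
  calc ∫⁻ ζ, (∫⁻ z, H (z + ζ) * V z) ^ 2
      = ∫⁻ ζ, ∫⁻ z, ∫⁻ w, H (z + ζ) * V z * (H (w + ζ) * V w) :=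
        lintegral_congr fun ζ => sq_eq _ (by fun_prop)
    _ = ∫⁻ z, ∫⁻ w, ∫⁻ ζ, H (z + ζ) * V z * (H (w + ζ) * V w) := by
        rw [lintegral_lintegral_swap (by fun_prop)]
        exact lintegral_congr fun z => lintegral_lintegral_swap (by fun_prop)
    _ = ∫⁻ z, ∫⁻ w, ∫⁻ a, H a * V z * (H (w + (a - z)) * V w) := by
        refine lintegral_congr fun z => lintegral_congr fun w => ?_
        rw [← lintegral_sub_right_eq_self _ z]
        simp only [add_sub_cancel]
    _ = ∫⁻ a, ∫⁻ w, ∫⁻ z, H a * V z * (H (w + (a - z)) * V w) := by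
        rw [lintegral_lintegral_swap (by fun_prop)]
        calc _ = ∫⁻ w, ∫⁻ a, ∫⁻ z, H a * V z * (H (w + (a - z)) * V w) :=
              lintegral_congr fun w => lintegral_lintegral_swap (by fun_prop)
          _ = _ := lintegral_lintegral_swap (by fun_prop)
    _ = ∫⁻ a, ∫⁻ w, ∫⁻ b, H a * V w * (H b * V (w + a - b)) := by
        refine lintegral_congr fun a => lintegral_congr fun w => ?_
        rw [← lintegral_sub_left_eq_self _ (w + a)]
        refine lintegral_congr fun b => ?_
        rw [show w + (a - (w + a - b)) = b by abel]
        ring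
    _ = ∫⁻ a, ∫⁻ b, ∫⁻ w, H a * V w * (H b * V (w + a - b)) :=
        lintegral_congr fun a => lintegral_lintegral_swap (by fun_prop)
    _ = ∫⁻ a, ∫⁻ b, ∫⁻ ζ, H a * V (ζ - a) * (H b * V (ζ - b)) := by
        refine lintegral_congr fun a => lintegral_congr fun b => ?_
        rw [← lintegral_sub_right_eq_self _ a]
        simp only [sub_add_cancel]
    _ = ∫⁻ ζ, ∫⁻ a, ∫⁻ b, H a * V (ζ - a) * (H b * V (ζ - b)) := by
        rw [lintegral_lintegral_swap (f := fun ζ a => ∫⁻ b, H a * V (ζ - a) * (H b * V (ζ - b)))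
          (by fun_prop)]
        exact lintegral_congr fun a => lintegral_lintegral_swap (by fun_prop)
    _ = _ := lintegral_congr fun ζ => (sq_eq _ (by fun_prop)).symm

/-! ### Duality and the dual bilinear estimate. -/

/-- Duality for weighted `L²` norms, tested on bounded integrable functions only. -/
lemma lintegral_weight_mul_sq_le_of_dual {α : Type*} [MeasurableSpace α] {μ : Measure α}
    [SigmaFinite μ] {G ρ w : α → ℝ≥0∞} (hG : Measurable G) (hρ : Measurable ρ)
    (hρ1 : ∀ a, ρ a ≤ 1) (hρw : ∀ a, w a * ρ a = 1) {A : ℝ≥0∞}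
    (h : ∀ H : α → ℝ≥0∞, Measurable H → (∃ M : ℝ≥0, ∀ a, H a ≤ M) → ∫⁻ a, H a ∂μ ≠ ∞ →
      (∫⁻ a, H a * G a ∂μ) ^ 2 ≤ A * ∫⁻ a, w a * H a ^ 2 ∂μ) :
    ∫⁻ a, ρ a * G a ^ 2 ∂μ ≤ A := by
  -- Truncation in height and support makes the test functions ρ · g n bounded and integrable.
  set g : ℕ → α → ℝ≥0∞ := fun n => (spanningSets μ n).indicator fun a => min (G a) n with hg
  have hgm : ∀ n, Measurable (g n) := fun n =>
    (hG.min measurable_const).indicator (measurableSet_spanningSets μ n)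
  have hgG : ∀ n a, g n a ≤ G a := fun n a =>
    Set.indicator_le' (fun a _ => min_le_left _ _) (fun a _ => zero_le) a
  have hgn : ∀ n a, g n a ≤ (spanningSets μ n).indicator (fun _ => (n : ℝ≥0∞)) a := fun n a =>
    Set.indicator_le_indicator (min_le_right _ _)
  have hgn' : ∀ n a, g n a ≤ n := fun n a =>
    (hgn n a).trans (Set.indicator_le' (fun a _ => le_rfl) (fun a _ => zero_le) a)
  have hfin : ∀ n, ∫⁻ a, ρ a * g n a ∂μ ≠ ∞ := by
    intro n
    refine ne_top_of_le_ne_top (b := (n : ℝ≥0∞) * μ (spanningSets μ n))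
      (ENNReal.mul_ne_top (by simp) (measure_spanningSets_lt_top μ n).ne) ?_
    rw [← lintegral_indicator_const (measurableSet_spanningSets μ n)]
    exact lintegral_mono fun a => (mul_le_of_le_one_left zero_le (hρ1 a)).trans (hgn n a)
  have hbd : ∀ n, ∫⁻ a, ρ a * g n a ^ 2 ∂μ ≤ A := by
    intro n
    set S := ∫⁻ a, ρ a * g n a ^ 2 ∂μ with hS
    have hST : S ≠ ∞ := by
      refine ne_top_of_le_ne_top (b := (n : ℝ≥0∞) * ∫⁻ a, ρ a * g n a ∂μ)
        (ENNReal.mul_ne_top (by simp) (hfin n)) ?_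
      rw [← lintegral_const_mul' _ _ (by simp)]
      refine lintegral_mono fun a => ?_
      calc ρ a * g n a ^ 2 = g n a * (ρ a * g n a) := by ring
        _ ≤ _ := by gcongr; exact hgn' n a
    -- Testing against H = ρ · g n gives S² ≤ A S, because w ρ = 1; the finiteness of S then allows
    -- division by S.
    have h1 : S ^ 2 ≤ A * S := by
      calc S ^ 2 ≤ (∫⁻ a, (ρ a * g n a) * G a ∂μ) ^ 2 := by
            gcongr
            refine lintegral_mono fun a => ?_
            calc ρ a * g n a ^ 2 = ρ a * g n a * g n a := by ring
              _ ≤ _ := by gcongr; exact hgG n a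
        _ ≤ A * ∫⁻ a, w a * (ρ a * g n a) ^ 2 ∂μ :=
            h _ (hρ.mul (hgm n))
              ⟨n, fun a => (mul_le_of_le_one_left zero_le (hρ1 a)).trans (by simpa using hgn' n a)⟩
              (hfin n)
        _ = A * S := by
            congr 1
            refine lintegral_congr fun a => ?_
            calc w a * (ρ a * g n a) ^ 2 = (w a * ρ a) * (ρ a * g n a ^ 2) := by ring
              _ = _ := by rw [hρw, one_mul]
    by_cases h0 : S = 0
    · rw [h0]; exact zero_le
    · rw [sq] at h1
      exact (ENNReal.mul_le_mul_iff_left h0 hST).mp h1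
  have hmono : Monotone fun n a => ρ a * g n a ^ 2 := by
    intro m n hmn a
    have : g m a ≤ g n a := by
      refine (Set.indicator_le_indicator ?_).trans
        (Set.indicator_le_indicator_of_subset (monotone_spanningSets μ hmn) (fun _ => zero_le) a)
      exact min_le_min le_rfl (by exact_mod_cast hmn)
    dsimp only
    gcongr
  have hsup : ∀ a, ρ a * G a ^ 2 = ⨆ n, ρ a * g n a ^ 2 := by
    intro a
    have ht : Filter.Tendsto (fun n => g n a) Filter.atTop (nhds (G a)) := by
      obtain ⟨N, hN⟩ : ∃ N, a ∈ spanningSets μ N := by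
        have := iUnion_spanningSets μ
        exact Set.mem_iUnion.mp (this ▸ Set.mem_univ a)
      have h1 : Filter.Tendsto (fun n : ℕ => min (G a) (n : ℝ≥0∞)) Filter.atTop
          (nhds (min (G a) ∞)) := tendsto_const_nhds.min ENNReal.tendsto_nat_nhds_top
      rw [min_eq_left le_top] at h1
      refine h1.congr' ?_
      filter_upwards [Filter.eventually_ge_atTop N] with n hn
      exact (Set.indicator_of_mem (monotone_spanningSets μ hn hN)
        (fun a => min (G a) (n : ℝ≥0∞))).symm
    have h2 : Filter.Tendsto (fun n => ρ a * g n a ^ 2) Filter.atTop (nhds (ρ a * G a ^ 2)) :=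
      ENNReal.Tendsto.const_mul (ENNReal.Tendsto.pow ht)
        (Or.inr (ne_top_of_le_ne_top ENNReal.one_ne_top (hρ1 a)))
    exact tendsto_nhds_unique h2 (tendsto_atTop_iSup fun m n hmn => hmono hmn a)
  calc ∫⁻ a, ρ a * G a ^ 2 ∂μ = ∫⁻ a, ⨆ n, ρ a * g n a ^ 2 ∂μ := lintegral_congr hsup
    _ = ⨆ n, ∫⁻ a, ρ a * g n a ^ 2 ∂μ :=
        lintegral_iSup (fun n => hρ.mul ((hgm n).pow_const 2)) hmono
    _ ≤ A := iSup_le hbd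

lemma bracketPow_le_one (x : ℝ) {p : ℝ} (hp : p ≤ 0) : bracketPow x p ≤ 1 := by
  rw [← bracketPow_zero x]; exact bracketPow_mono x hp

/-- The dual form of `lintegral_sq_conv_le`. -/
lemma lintegral_weight_sq_conv_le {V U : ℝ × ℝ → ℝ≥0∞} (hV : Measurable V) (hU : Measurable U) :
    ∫⁻ ζ, bracketPow (ζ.2 + ζ.1 ^ 2) (-7 / 8) * (∫⁻ z, V z * U (ζ - z)) ^ 2 ≤
      schrodingerConst * (∫⁻ z, bracketPow (z.2 + z.1 ^ 2) (7 / 8) * V z ^ 2) *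
        ∫⁻ z, U z ^ 2 := by
  refine lintegral_weight_mul_sq_le_of_dual (by fun_prop) (by fun_prop)
    (w := fun ζ => bracketPow (ζ.2 + ζ.1 ^ 2) (7 / 8))
    (fun _ => bracketPow_le_one _ (by norm_num)) (fun ζ => ?_) fun H hH _ _ => ?_
  · rw [bracketPow_mul]; norm_num [bracketPow_zero]
  calc (∫⁻ ζ, H ζ * ∫⁻ z, V z * U (ζ - z)) ^ 2
      = (∫⁻ ζ, ∫⁻ z, H ζ * (V z * U (ζ - z))) ^ 2 := by
        congr 1
        exact lintegral_congr fun ζ => (lintegral_const_mul _ (by fun_prop)).symm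
    _ = (∫⁻ z, ∫⁻ ζ, H (z + ζ) * (V z * U ζ)) ^ 2 := by
        rw [lintegral_lintegral_swap (by fun_prop)]
        congr 1
        refine lintegral_congr fun z => ?_
        rw [← lintegral_add_left_eq_self _ z]
        simp only [add_sub_cancel_left]
    _ = (∫⁻ ζ, (∫⁻ z, H (z + ζ) * V z) * U ζ) ^ 2 := by
        rw [lintegral_lintegral_swap (by fun_prop)]
        congr 1
        refine lintegral_congr fun ζ => ?_
        rw [← lintegral_mul_const _ (by fun_prop)]
        simp only [mul_assoc]
    _ ≤ (∫⁻ ζ, (∫⁻ z, H (z + ζ) * V z) ^ 2) * ∫⁻ ζ, U ζ ^ 2 :=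
        sq_lintegral_mul_le (by fun_prop) hU.aemeasurable
    _ ≤ (schrodingerConst * (∫⁻ z, bracketPow (z.2 + z.1 ^ 2) (7 / 8) * H z ^ 2) *
          ∫⁻ z, bracketPow (z.2 + z.1 ^ 2) (7 / 8) * V z ^ 2) * ∫⁻ ζ, U ζ ^ 2 := by
        rw [lintegral_sq_corr_eq hH hV]
        gcongr
        exact lintegral_sq_conv_le hH hV
    _ = _ := by ring

/-! ### Convolution theorem and Plancherel on L² and L¹. -/

section Fourier

/-- Complex valued square integrable functions on `E`. -/
abbrev L2 (E : Type*) [NormedAddCommGroup E] [InnerProductSpace ℝ E] [FiniteDimensional ℝ E]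
    [MeasurableSpace E] [BorelSpace E] : Type _ := Lp ℂ 2 (volume : Measure E)

variable {E : Type*} [NormedAddCommGroup E] [InnerProductSpace ℝ E] [FiniteDimensional ℝ E]
  [MeasurableSpace E] [BorelSpace E]

lemma integral_fourier_mul_eq_of_integrable {f g : E → ℂ} (hf : Integrable f)
    (hg : Integrable g) : ∫ ξ, 𝓕 f ξ * g ξ = ∫ x, f x * 𝓕 g x := by
  simpa using! VectorFourier.integral_bilin_fourierIntegral_eq_flip (.mul ℂ ℂ) (L := innerₗ E)
    Real.continuous_fourierChar continuous_inner hf hg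

/-- The multiplication formula ∫ ĥ g = ∫ h ĝ with g = û(ζ - ·): by inversion, ĝ is u times the
character at ζ. -/
lemma integral_fourier_mul_fourier_sub_schwartz (h u : SchwartzMap E ℂ) (ζ : E) :
    ∫ a, 𝓕 h a * 𝓕 u (ζ - a) = 𝓕 (fun x => h x * u x) ζ := by
  have hg : Integrable fun a => 𝓕 u (ζ - a) := (𝓕 u).integrable.comp_sub_left ζ
  have h1 := integral_fourier_mul_eq_of_integrable h.integrable hg
  rw [← SchwartzMap.fourier_coe] at h1
  rw [h1, Real.fourier_eq]
  refine integral_congr_ae (.of_forall fun x => ?_)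
  dsimp only
  rw [Real.fourier_eq, ← integral_sub_left_eq_self
    (fun v => Real.fourierChar (-inner ℝ v x) • 𝓕 u (ζ - v)) volume ζ]
  simp only [sub_sub_cancel, inner_sub_left, neg_sub]
  have h2 : u x = 𝓕⁻ (𝓕 u : SchwartzMap E ℂ) x := by simp
  rw [SchwartzMap.fourierInv_coe, Real.fourierInv_eq] at h2
  have key : ∫ v : E, Real.fourierChar (inner ℝ v x - inner ℝ ζ x) • 𝓕 u v =
      (Real.fourierChar (-inner ℝ x ζ) : ℂ) * ∫ v : E, Real.fourierChar (inner ℝ v x) • 𝓕 u v := by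
    rw [← integral_const_mul]
    refine integral_congr_ae (.of_forall fun a => ?_)
    simp only [Circle.smul_def, smul_eq_mul]
    rw [← mul_assoc, ← Circle.coe_mul, ← AddChar.map_add_eq_mul, real_inner_comm ζ x,
      sub_eq_neg_add]
  rw [h2, key, Circle.smul_def, smul_eq_mul]
  ring

lemma coeFn_toLp_schwartz (φ : SchwartzMap E ℂ) : (φ.toLp 2 volume : L2 E) =ᵐ[volume] φ :=
  φ.coeFn_toLp 2 volume

lemma integral_fourier_mul_fourier_sub_toLp (h u : SchwartzMap E ℂ) (ζ : E) :
    ∫ a, (𝓕 (h.toLp 2 volume) : L2 E) a * (𝓕 (u.toLp 2 volume) : L2 E) (ζ - a) =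
      𝓕 (fun x => (h.toLp 2 volume : L2 E) x * (u.toLp 2 volume : L2 E) x) ζ := by
  have e₂ : 𝓕 (fun x => (h.toLp 2 volume : L2 E) x * (u.toLp 2 volume : L2 E) x) ζ =
      𝓕 (fun x => h x * u x) ζ :=
    Real.fourier_congr_ae ((coeFn_toLp_schwartz h).mul (coeFn_toLp_schwartz u)) ζ
  rw [e₂, ← integral_fourier_mul_fourier_sub_schwartz, SchwartzMap.toLp_fourier_eq,
    SchwartzMap.toLp_fourier_eq]
  refine integral_congr_ae ?_
  filter_upwards [coeFn_toLp_schwartz (𝓕 h), (Measure.measurePreserving_sub_left volume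
    ζ).quasiMeasurePreserving.ae (coeFn_toLp_schwartz (𝓕 u))] with a ha hb
  rw [ha, hb]

lemma continuous_integral_fourier_mul_fourier_sub (ζ : E) :
    Continuous fun p : L2 E × L2 E => ∫ a, (𝓕 p.1 : L2 E) a * (𝓕 p.2 : L2 E) (ζ - a) := by
  have hmp : MeasurePreserving (fun a : E => ζ - a) volume volume :=
    Measure.measurePreserving_sub_left volume ζ
  have hF : Continuous (𝓕 : L2 E → L2 E) := (Lp.fourierTransformₗᵢ E ℂ).continuous
  have hS : Continuous (Lp.compMeasurePreservingₗᵢ ℂ _ hmp : L2 E → L2 E) :=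
    (Lp.compMeasurePreservingₗᵢ ℂ _ hmp).continuous
  have hL := ((ContinuousLinearMap.mul ℂ ℂ).lpPairing (volume : Measure E) 2 2).continuous₂
  have h := hL.comp ((hF.comp continuous_fst).prodMk (hS.comp (hF.comp continuous_snd)))
  refine h.congr fun p => ?_
  refine (ContinuousLinearMap.lpPairing_eq_integral _ _ _).trans (integral_congr_ae ?_)
  filter_upwards [Lp.coeFn_compMeasurePreserving (𝓕 p.2 : L2 E) hmp] with a ha
  exact congrArg ((𝓕 p.1 : L2 E) a * ·) ha

/-- Hölder maps L² × L² to L¹, and the Fourier transform maps L¹ to bounded continuous functions.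
Evaluation at ζ is therefore continuous, and the convolution theorem extends by density at every ζ,
not merely almost everywhere. -/
lemma continuous_fourier_mul (ζ : E) :
    Continuous fun p : L2 E × L2 E => 𝓕 (fun x => p.1 x * p.2 x) ζ := by
  have hE : Continuous fun f : BoundedContinuousFunction E ℂ => f ζ :=
    continuous_eval_const ζ
  have hF := (Real.Lp.fourierTransformCLM E ℂ).continuous
  have hH := ((ContinuousLinearMap.mul ℂ ℂ).holderL (volume : Measure E) 2 2 1).continuous₂
  refine (hE.comp (hF.comp hH)).congr fun p => ?_
  exact Real.fourier_congr_ae ((ContinuousLinearMap.mul ℂ ℂ).coeFn_holder p.1 p.2) ζ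

/-- The convolution theorem for products of two `L²` functions. -/
lemma integral_fourier_mul_fourier_sub (h u : L2 E) (ζ : E) :
    ∫ a, (𝓕 h : L2 E) a * (𝓕 u : L2 E) (ζ - a) = 𝓕 (fun x => h x * u x) ζ :=
  DenseRange.induction_on₂ (p := fun h u : L2 E =>
      ∫ a, (𝓕 h : L2 E) a * (𝓕 u : L2 E) (ζ - a) = 𝓕 (fun x => h x * u x) ζ)
    (SchwartzMap.denseRange_toLpCLM (p := 2) ENNReal.ofNat_ne_top)
    (isClosed_eq (continuous_integral_fourier_mul_fourier_sub ζ) (continuous_fourier_mul ζ))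
    (fun h u => integral_fourier_mul_fourier_sub_toLp h u ζ) h u

/-- Plancherel for an integrable function, with both sides in `[0, ∞]`. -/
lemma eLpNorm_fourier_eq {f : E → ℂ} (hf : Integrable f) :
    eLpNorm (𝓕 f) 2 volume = eLpNorm f 2 volume := by
  have hcont : Continuous (𝓕 f) :=
    VectorFourier.fourierIntegral_continuous Real.continuous_fourierChar
      (innerSL ℝ).continuous₂ hf
  -- Locally integrable functions with equal pairings against Schwartz functions agree almost
  -- everywhere; this identifies integral transforms with L² transforms through tempered
  -- distributions.
  have test : ∀ g₁ g₂ : E → ℂ, LocallyIntegrable g₁ volume → LocallyIntegrable g₂ volume →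
      (∀ φ : SchwartzMap E ℂ, ∫ x, φ x * g₁ x = ∫ x, φ x * g₂ x) → g₁ =ᵐ[volume] g₂ := by
    intro g₁ g₂ h₁ h₂ h
    refine ae_eq_of_integral_contDiff_smul_eq h₁ h₂ fun g hg hgc => ?_
    have hc : HasCompactSupport (Complex.ofRealCLM ∘ g) := hgc.comp_left rfl
    have hd : ContDiff ℝ (⊤ : ℕ∞) (Complex.ofRealCLM ∘ g) := by fun_prop
    simpa using h (hc.toSchwartzMap hd)
  by_cases h2 : MemLp f 2 volume
  · have : 𝓕 f =ᵐ[volume] (𝓕 h2.toLp : L2 E) := by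
      refine test _ _ hcont.locallyIntegrable ((Lp.memLp _).locallyIntegrable (by norm_num))
        fun φ => ?_
      have h3 := DFunLike.congr_fun (Lp.fourier_toTemperedDistribution_eq h2.toLp) φ
      simp only [TemperedDistribution.fourier_apply, Lp.toTemperedDistribution_apply,
        smul_eq_mul] at h3
      rw [← h3, ← integral_fourier_mul_eq_of_integrable φ.integrable hf]
      refine integral_congr_ae ?_
      filter_upwards [h2.coeFn_toLp] with x hx
      rw [hx, SchwartzMap.fourier_coe]
    rw [eLpNorm_congr_ae this, ← Lp.enorm_def, ← eLpNorm_congr_ae h2.coeFn_toLp, ← Lp.enorm_def]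
    rw [← ofReal_norm, ← ofReal_norm, Lp.norm_fourier_eq]
  -- If f is not in L², neither is its transform: otherwise f would equal the inverse L² transform
  -- of it. Both norms are then infinite.
  · by_cases h3 : MemLp (𝓕 f) 2 volume
    · exfalso
      have : f =ᵐ[volume] (𝓕⁻ h3.toLp : L2 E) := by
        refine test _ _ hf.locallyIntegrable ((Lp.memLp _).locallyIntegrable (by norm_num))
          fun φ => ?_
        have h4 := DFunLike.congr_fun (Lp.fourierInv_toTemperedDistribution_eq h3.toLp) φ
        simp only [TemperedDistribution.fourierInv_apply, Lp.toTemperedDistribution_apply,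
          smul_eq_mul] at h4
        have h5 := integral_fourier_mul_eq_of_integrable (𝓕⁻ φ).integrable hf
        rw [← SchwartzMap.fourier_coe, FourierTransform.fourier_fourierInv_eq] at h5
        rw [← h4, h5]
        refine integral_congr_ae ?_
        filter_upwards [h3.coeFn_toLp] with x hx
        rw [hx]
      exact h2 ((memLp_congr_ae this).mpr (Lp.memLp _))
    · have e1 : eLpNorm f 2 volume = ∞ := by
        by_contra h; exact h2 ⟨hf.1, lt_top_iff_ne_top.mpr h⟩
      have e2 : eLpNorm (𝓕 f) 2 volume = ∞ := by
        by_contra h; exact h3 ⟨hcont.aestronglyMeasurable, lt_top_iff_ne_top.mpr h⟩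
      rw [e1, e2]

/-- The reflection `u ↦ u(-·)` on `L²`. -/
noncomputable def reflect (u : L2 E) : L2 E :=
  Lp.compMeasurePreservingₗᵢ ℂ _ (Measure.measurePreserving_neg volume) u

lemma coeFn_reflect (u : L2 E) : reflect u =ᵐ[volume] fun x => u (-x) :=
  Lp.coeFn_compMeasurePreserving u _

lemma fourier_reflect (u : L2 E) : 𝓕 (reflect u) = reflect (𝓕 u) := by
  refine DenseRange.induction_on (p := fun u => 𝓕 (reflect u) = reflect (𝓕 u))
    (SchwartzMap.denseRange_toLpCLM (p := 2) ENNReal.ofNat_ne_top) u ?_ fun φ => ?_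
  · have hr : Continuous (reflect : L2 E → L2 E) :=
      (Lp.compMeasurePreservingₗᵢ ℂ _ (Measure.measurePreserving_neg volume)).continuous
    have hF : Continuous (𝓕 : L2 E → L2 E) := (Lp.fourierTransformₗᵢ E ℂ).continuous
    exact isClosed_eq (hF.comp hr) (hr.comp hF)
  · have e₂ : ∀ φ : SchwartzMap E ℂ, reflect (φ.toLp 2 volume) = ((SchwartzMap.compCLMOfContinuousLinearEquiv ℂ
        (ContinuousLinearEquiv.neg ℝ : E ≃L[ℝ] E)) φ).toLp 2 volume := by
      intro φ
      ext1
      refine (coeFn_reflect _).trans (Filter.EventuallyEq.trans ?_ (coeFn_toLp_schwartz _).symm)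
      exact (Measure.measurePreserving_neg volume).quasiMeasurePreserving.ae (coeFn_toLp_schwartz φ)
    rw [SchwartzMap.toLpCLM_apply, e₂, SchwartzMap.toLp_fourier_eq, SchwartzMap.toLp_fourier_eq, e₂]
    congr 1
    ext x
    exact Real.fourier_comp_linearIsometry (LinearIsometryEquiv.neg ℝ) φ x

end Fourier
-- Passage to the angular normalization.
/-- The rescaling of frequencies from the angular normalization to Mathlib's normalization. -/
noncomputable def freqEquiv : ℝ × ℝ ≃ᵐ SpaceTime where
  toFun ζ := !₂[ζ.1 / (2 * Real.pi), ζ.2 / (2 * Real.pi)]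
  invFun a := (2 * Real.pi * a 0, 2 * Real.pi * a 1)
  left_inv ζ := by
    have := Real.pi_ne_zero
    ext <;> simp <;> field_simp
  right_inv a := by
    have := Real.pi_ne_zero
    ext i; fin_cases i <;> simp
  measurable_toFun := by
    refine (WithLp.measurable_toLp 2 _).comp (measurable_pi_lambda _ fun i => ?_)
    fin_cases i <;> simp <;> fun_prop
  measurable_invFun := by
    simp; fun_prop

lemma freqEquiv_apply (ζ : ℝ × ℝ) :
    freqEquiv ζ = !₂[ζ.1 / (2 * Real.pi), ζ.2 / (2 * Real.pi)] := rfl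

lemma freqEquiv_sub (ζ z : ℝ × ℝ) : freqEquiv (ζ - z) = freqEquiv ζ - freqEquiv z := by
  ext i; fin_cases i <;> simp [freqEquiv_apply, sub_div]

lemma freqEquiv_neg (z : ℝ × ℝ) : freqEquiv (-z) = -freqEquiv z := by
  ext i; fin_cases i <;> simp [freqEquiv_apply, neg_div]

lemma spaceTimeFourier_eq (u : L2xt) : spaceTimeFourier u = (𝓕 u : L2xt) ∘ freqEquiv := rfl

/-- The Jacobian `(2 π)²` of the rescaling of frequencies. -/
noncomputable def freqJac : ℝ≥0 := ⟨(2 * Real.pi) ^ 2, by positivity⟩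

lemma freqJac_pos : 0 < freqJac := by
  have : (0 : ℝ) < (2 * Real.pi) ^ 2 := by positivity
  exact this

lemma map_freqEquiv_volume :
    Measure.map freqEquiv volume = freqJac • (volume : Measure SpaceTime) := by
  have h1 : MeasurePreserving (fun z : ℝ × ℝ => (WithLp.toLp 2 ![z.1, z.2] : SpaceTime)) :=
    (EuclideanSpace.volume_preserving_symm_measurableEquiv_toLp (Fin 2)).symm.comp
      (volume_preserving_finTwoArrow ℝ).symm
  have h2 : (freqEquiv : ℝ × ℝ → SpaceTime) =
      (fun z : ℝ × ℝ => (WithLp.toLp 2 ![z.1, z.2] : SpaceTime)) ∘ ((2 * Real.pi)⁻¹ • ·) := by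
    ext z i; fin_cases i <;> simp [freqEquiv_apply] <;> ring
  rw [h2, ← Measure.map_map h1.measurable (by fun_prop), Measure.map_addHaar_smul _ (by positivity),
    Measure.map_smul, h1.map_eq]
  simp only [Module.finrank_prod, Module.finrank_self]
  have h3 : ENNReal.ofReal |((2 * Real.pi)⁻¹ ^ (1 + 1))⁻¹| = freqJac := by
    rw [abs_of_nonneg (by positivity), inv_pow, inv_inv]
    exact ENNReal.ofReal_eq_coe_nnreal _
  rw [h3]
  rfl

lemma lintegral_comp_freqEquiv (F : SpaceTime → ℝ≥0∞) :
    ∫⁻ ζ, F (freqEquiv ζ) = freqJac * ∫⁻ a, F a := by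
  rw [← lintegral_map_equiv, map_freqEquiv_volume, lintegral_smul_measure]; rfl

lemma integral_comp_freqEquiv (F : SpaceTime → ℂ) :
    ∫ ζ, F (freqEquiv ζ) = (freqJac : ℂ) * ∫ a, F a := by
  rw [← integral_map_equiv, map_freqEquiv_volume, integral_smul_nnreal_measure]
  simp [NNReal.smul_def]

lemma quasiMeasurePreserving_freqEquiv : Measure.QuasiMeasurePreserving freqEquiv :=
  ⟨freqEquiv.measurable, by
    rw [map_freqEquiv_volume]; exact Measure.smul_absolutelyContinuous⟩

lemma measurable_spaceTimeFourier (u : L2xt) : Measurable (spaceTimeFourier u) :=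
  (Lp.stronglyMeasurable (𝓕 u : L2xt)).measurable.comp freqEquiv.measurable

lemma eLpNorm_two_sq {α : Type*} [MeasurableSpace α] {μ : Measure α} (f : α → ℂ) :
    eLpNorm f 2 μ ^ 2 = ∫⁻ a, ‖f a‖ₑ ^ 2 ∂μ := by
  have := eLpNorm_nnreal_pow_eq_lintegral (f := f) (μ := μ) (p := 2) (by norm_num)
  simpa using this

lemma eLpNorm_four_pow {α : Type*} [MeasurableSpace α] {μ : Measure α} (f : α → ℂ) :
    eLpNorm f 4 μ ^ 4 = ∫⁻ a, ‖f a‖ₑ ^ 4 ∂μ := by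
  have := eLpNorm_nnreal_pow_eq_lintegral (f := f) (μ := μ) (p := 4) (by norm_num)
  simpa using this

lemma memLp_two_iff {α : Type*} [MeasurableSpace α] {μ : Measure α} {f : α → ℂ}
    (hf : AEStronglyMeasurable f μ) : MemLp f 2 μ ↔ ∫⁻ a, ‖f a‖ₑ ^ 2 ∂μ ≠ ∞ := by
  rw [← eLpNorm_two_sq]
  constructor
  · intro h; exact ENNReal.pow_ne_top h.2.ne
  · intro h
    refine ⟨hf, lt_top_iff_ne_top.mpr fun h' => h ?_⟩
    rw [h']; simp

lemma memLp_spaceTimeFourier (u : L2xt) : MemLp (spaceTimeFourier u) 2 := by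
  rw [memLp_two_iff (measurable_spaceTimeFourier u).aestronglyMeasurable, spaceTimeFourier_eq]
  have := lintegral_comp_freqEquiv fun a => ‖(𝓕 u : L2xt) a‖ₑ ^ 2
  simp only [Function.comp_apply]
  rw [this, ← eLpNorm_two_sq]
  exact ENNReal.mul_ne_top (by simp) (ENNReal.pow_ne_top (Lp.memLp _).2.ne)

lemma exists_spaceTimeFourier_eq {H : ℝ × ℝ → ℂ} (hH : Measurable H) (h2 : MemLp H 2) :
    ∃ h : L2xt, spaceTimeFourier h =ᵐ[volume] H := by
  have h3 : MemLp (H ∘ freqEquiv.symm) 2 (volume : Measure SpaceTime) := by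
    rw [memLp_two_iff (hH.comp freqEquiv.symm.measurable).aestronglyMeasurable]
    have := lintegral_comp_freqEquiv fun a => ‖(H ∘ freqEquiv.symm) a‖ₑ ^ 2
    simp only [Function.comp_apply, MeasurableEquiv.symm_apply_apply] at this ⊢
    rw [memLp_two_iff h2.1, this] at h2
    intro h
    rw [h, ENNReal.mul_top (by simpa using freqJac_pos.ne')] at h2
    exact h2 rfl
  refine ⟨𝓕⁻ h3.toLp, ?_⟩
  rw [spaceTimeFourier_eq, FourierTransform.fourier_fourierInv_eq]
  filter_upwards [quasiMeasurePreserving_freqEquiv.ae h3.coeFn_toLp] with ζ hζ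
  simpa using hζ

lemma spaceTimeFourier_reflect (u : L2xt) :
    spaceTimeFourier (reflect u) =ᵐ[volume] fun ζ => spaceTimeFourier u (-ζ) := by
  simp only [spaceTimeFourier_eq, fourier_reflect]
  filter_upwards [quasiMeasurePreserving_freqEquiv.ae (coeFn_reflect (𝓕 u : L2xt))] with ζ hζ
  simp only [Function.comp_apply, freqEquiv_neg, hζ]

lemma eLpNorm_reflect (u : L2xt) (p : ℝ≥0∞) : eLpNorm (reflect u) p volume = eLpNorm u p volume := by
  rw [eLpNorm_congr_ae (coeFn_reflect u)]
  exact eLpNorm_comp_measurePreserving (Lp.aestronglyMeasurable u)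
    (Measure.measurePreserving_neg volume)

lemma integral_convIntegrand_spaceTimeFourier (h u : L2xt) (ζ : ℝ × ℝ) :
    ∫ z, convIntegrand (spaceTimeFourier h) (spaceTimeFourier u) ζ z =
      (freqJac : ℂ) * 𝓕 (fun x => h x * u x) (freqEquiv ζ) := by
  rw [← integral_fourier_mul_fourier_sub h u (freqEquiv ζ), ← integral_comp_freqEquiv]
  simp only [convIntegrand, spaceTimeFourier_eq, Function.comp_apply, freqEquiv_sub]

/-- Plancherel for the product h u, which is only known to be integrable. Two Jacobians come from
the squared convolution and one from the outer integral. -/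
lemma lintegral_sq_conv_spaceTimeFourier (h u : L2xt) :
    ∫⁻ ζ, ‖∫ z, convIntegrand (spaceTimeFourier h) (spaceTimeFourier u) ζ z‖ₑ ^ 2 =
      (freqJac : ℝ≥0∞) ^ 3 * ∫⁻ x, ‖h x * u x‖ₑ ^ 2 := by
  have hi : Integrable fun x => h x * u x := (Lp.memLp h).integrable_mul (Lp.memLp u)
  simp only [integral_convIntegrand_spaceTimeFourier, enorm_mul, mul_pow]
  have e : ‖(freqJac : ℂ)‖ₑ = freqJac := by
    have : ((freqJac : ℝ) : ℂ) = (freqJac : ℂ) := rfl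
    rw [← this, ← ofReal_norm, Complex.norm_real, Real.norm_eq_abs,
      abs_of_nonneg freqJac.coe_nonneg, ENNReal.ofReal_coe_nnreal]
  rw [lintegral_const_mul' _ _ (by finiteness),
    lintegral_comp_freqEquiv (fun a => ‖𝓕 (fun x => h x * u x) a‖ₑ ^ 2), ← eLpNorm_two_sq,
    eLpNorm_fourier_eq hi, eLpNorm_two_sq, e]
  simp only [enorm_mul, mul_pow]
  ring

/-! ### The bilinear estimate with a factor in L⁴, and its dual. -/

/-- The constant in the bilinear estimate `lintegral_sq_conv_le_eLpNorm`. -/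
noncomputable def bilinearConst : ℝ≥0∞ := 1 + (freqJac : ℝ≥0∞) ^ 3 * schrodingerConst

lemma bilinearConst_ne_top : bilinearConst ≠ ∞ := by
  have := schrodingerConst_ne_top
  unfold bilinearConst
  finiteness

/-- `‖h u‖_{L²} ≤ C ‖h‖_{X^{0, 7/16}} ‖u‖_{L⁴}`, with the Schrödinger dispersion relation. -/
lemma lintegral_sq_conv_le_eLpNorm {H : ℝ × ℝ → ℂ} (hH : Measurable H) (h2 : MemLp H 2)
    (u : L2xt) :
    ∫⁻ ζ, ‖∫ z, convIntegrand H (spaceTimeFourier u) ζ z‖ₑ ^ 2 ≤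
      bilinearConst * (∫⁻ z, bracketPow (z.2 + z.1 ^ 2) (7 / 8) * ‖H z‖ₑ ^ 2) *
        eLpNorm u 4 volume ^ 2 := by
  obtain ⟨h, hh⟩ := exists_spaceTimeFourier_eq hH h2
  have e1 : ∀ ζ, ∫ z, convIntegrand H (spaceTimeFourier u) ζ z =
      ∫ z, convIntegrand (spaceTimeFourier h) (spaceTimeFourier u) ζ z := fun ζ => by
    refine integral_congr_ae ?_
    filter_upwards [hh] with z hz
    simp only [convIntegrand, hz]
  have e2 : ∫⁻ z, bracketPow (z.2 + z.1 ^ 2) (7 / 8) * ‖H z‖ₑ ^ 2 =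
      ∫⁻ z, bracketPow (z.2 + z.1 ^ 2) (7 / 8) * ‖spaceTimeFourier h z‖ₑ ^ 2 := by
    refine lintegral_congr_ae ?_
    filter_upwards [hh] with z hz
    rw [hz]
  simp only [e1, e2]
  have hhm := measurable_spaceTimeFourier h
  set w := ∫⁻ z, bracketPow (z.2 + z.1 ^ 2) (7 / 8) * ‖spaceTimeFourier h z‖ₑ ^ 2 with hw
  -- The Schrödinger estimate applied to h with itself controls ‖h²‖_{L²}² = ‖h‖_{L⁴}⁴, up to the
  -- Fourier constant.
  have hself : ∫⁻ ζ, ‖∫ z, convIntegrand (spaceTimeFourier h) (spaceTimeFourier h) ζ z‖ₑ ^ 2 ≤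
      schrodingerConst * w * w := by
    refine le_trans (lintegral_mono fun ζ => ?_) (lintegral_sq_conv_le hhm.enorm hhm.enorm)
    gcongr
    refine (enorm_integral_le_lintegral_enorm _).trans (le_of_eq ?_)
    simp only [convIntegrand, enorm_mul]
  -- Hölder: ‖h u‖_{L²} ≤ ‖h‖_{L⁴} ‖u‖_{L⁴}, raised to the fourth power.
  have h4 : (∫⁻ x, ‖h x * u x‖ₑ ^ 2) ^ 2 ≤
      (∫⁻ x, ‖h x * h x‖ₑ ^ 2) * eLpNorm u 4 volume ^ 4 := by
    rw [eLpNorm_four_pow]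
    have := sq_lintegral_mul_le (μ := (volume : Measure SpaceTime))
      (f := fun x => ‖h x‖ₑ ^ 2) (g := fun x => ‖u x‖ₑ ^ 2)
      ((Lp.aestronglyMeasurable h).enorm.pow_const 2) ((Lp.aestronglyMeasurable u).enorm.pow_const 2)
    convert this using 4
    · rw [enorm_mul, mul_pow]
    · rw [enorm_mul]; ring
    · ring
  have hsq : (∫⁻ ζ, ‖∫ z, convIntegrand (spaceTimeFourier h) (spaceTimeFourier u) ζ z‖ₑ ^ 2) ^ 2 ≤
      (bilinearConst * w * eLpNorm u 4 volume ^ 2) ^ 2 := by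
    rw [lintegral_sq_conv_spaceTimeFourier] at hself ⊢
    set j : ℝ≥0∞ := (freqJac : ℝ≥0∞)
    calc (j ^ 3 * ∫⁻ x, ‖h x * u x‖ₑ ^ 2) ^ 2
        = j ^ 6 * (∫⁻ x, ‖h x * u x‖ₑ ^ 2) ^ 2 := by ring
      _ ≤ j ^ 6 * ((∫⁻ x, ‖h x * h x‖ₑ ^ 2) * eLpNorm u 4 volume ^ 4) := by gcongr
      _ = j ^ 3 * (j ^ 3 * (∫⁻ x, ‖h x * h x‖ₑ ^ 2)) * eLpNorm u 4 volume ^ 4 := by ring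
      _ ≤ j ^ 3 * (schrodingerConst * w * w) * eLpNorm u 4 volume ^ 4 := by gcongr
      _ = (j ^ 3 * schrodingerConst) * (w ^ 2 * eLpNorm u 4 volume ^ 4) := by ring
      _ ≤ bilinearConst ^ 2 * (w ^ 2 * eLpNorm u 4 volume ^ 4) := by
          gcongr
          -- The summand 1 in `bilinearConst` serves to bound the constant by its own square before
          -- the square root is taken.
          calc j ^ 3 * schrodingerConst ≤ bilinearConst := le_add_self
            _ ≤ bilinearConst ^ 2 := le_self_pow₀ le_self_add two_ne_zero
      _ = _ := by ring
  exact (ENNReal.pow_le_pow_left_iff two_ne_zero).mp hsq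

lemma MemLp.comp_sub_left_two {U : ℝ × ℝ → ℂ} (hU : MemLp U 2) (ζ : ℝ × ℝ) :
    MemLp (fun z => U (ζ - z)) 2 :=
  hU.comp_measurePreserving (Measure.measurePreserving_sub_left volume ζ)

lemma integrable_convIntegrand {F G : ℝ × ℝ → ℂ} (hF : MemLp F 2) (hG : MemLp G 2)
    (ζ : ℝ × ℝ) : Integrable (convIntegrand F G ζ) :=
  hF.integrable_mul (MemLp.comp_sub_left_two hG ζ)

lemma measurable_uncurry_convIntegrand {F G : ℝ × ℝ → ℂ} (hF : Measurable F)
    (hG : Measurable G) : Measurable fun p : (ℝ × ℝ) × (ℝ × ℝ) => convIntegrand F G p.1 p.2 := by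
  unfold convIntegrand; fun_prop

lemma measurable_integral_convIntegrand {F G : ℝ × ℝ → ℂ} (hF : Measurable F)
    (hG : Measurable G) : Measurable fun ζ => ∫ z, convIntegrand F G ζ z :=
  ((measurable_uncurry_convIntegrand hF hG).stronglyMeasurable.integral_prod_right).measurable

lemma lintegral_conv_sq_le {F G : ℝ × ℝ → ℂ} (hF : Measurable F) (hG : Measurable G)
    (ζ : ℝ × ℝ) : (∫⁻ z, ‖convIntegrand F G ζ z‖ₑ) ^ 2 ≤
      (∫⁻ z, ‖F z‖ₑ ^ 2) * ∫⁻ z, ‖G z‖ₑ ^ 2 := by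
  simp only [convIntegrand, enorm_mul]
  refine (sq_lintegral_mul_le (by fun_prop) (by fun_prop)).trans (le_of_eq ?_)
  rw [lintegral_sub_left_eq_self (fun z => ‖G z‖ₑ ^ 2)]

/-- The dilated Fourier transform of `κ`, as a Fourier multiplier symbol. -/
noncomputable def dilatedSymbol (κ : ℝ → ℂ) (c : ℝ) (ξ : ℝ) : ℂ := 𝓕 κ (c * ξ)

lemma continuous_dilatedSymbol {κ : ℝ → ℂ} (hκ : Integrable κ) (c : ℝ) :
    Continuous (dilatedSymbol κ c) := by
  have : Continuous (𝓕 κ) :=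
    VectorFourier.fourierIntegral_continuous Real.continuous_fourierChar
      (innerSL ℝ).continuous₂ hκ
  unfold dilatedSymbol; fun_prop

lemma norm_dilatedSymbol_le (κ : ℝ → ℂ) (c ξ : ℝ) : ‖dilatedSymbol κ c ξ‖ ≤ ∫ y, ‖κ y‖ :=
  VectorFourier.norm_fourierIntegral_le_integral_norm _ _ _ _ _

lemma measurable_spaceMultiplier {m : ℝ → ℂ} (hm : Measurable m) {F : ℝ × ℝ → ℂ}
    (hF : Measurable F) : Measurable (spaceMultiplier m F) := by
  unfold spaceMultiplier; fun_prop

lemma memLp_spaceMultiplier {m : ℝ → ℂ} (hm : Measurable m) {F : ℝ × ℝ → ℂ} (hF : MemLp F 2)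
    {C : ℝ} (hC : ∀ ξ, ‖m ξ‖ ≤ C) : MemLp (spaceMultiplier m F) 2 :=
  hF.of_le_mul (c := C) ((hm.comp measurable_fst).aestronglyMeasurable.mul hF.1)
    (.of_forall fun ζ => by
      rw [spaceMultiplier, norm_mul]; exact mul_le_mul_of_nonneg_right (hC _) (norm_nonneg _))

/-- The modulation of `H` in the space frequency. -/
noncomputable def modulate (H : ℝ × ℝ → ℂ) (b : ℝ) (z : ℝ × ℝ) : ℂ :=
  (Real.fourierChar (b * z.1) : ℂ) * H z

lemma measurable_fourierChar : Measurable fun t : ℝ => (Real.fourierChar t : ℂ) :=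
  (continuous_subtype_val.comp Real.continuous_fourierChar).measurable

lemma norm_fourierChar (t : ℝ) : ‖(Real.fourierChar t : ℂ)‖ = 1 := Circle.norm_coe _

lemma enorm_fourierChar (t : ℝ) : ‖(Real.fourierChar t : ℂ)‖ₑ = 1 := by
  rw [← ofReal_norm, norm_fourierChar, ENNReal.ofReal_one]

lemma enorm_modulate (H : ℝ × ℝ → ℂ) (b : ℝ) (z : ℝ × ℝ) : ‖modulate H b z‖ₑ = ‖H z‖ₑ := by
  rw [modulate, enorm_mul, enorm_fourierChar, one_mul]

lemma measurable_modulate {H : ℝ × ℝ → ℂ} (hH : Measurable H) (b : ℝ) :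
    Measurable (modulate H b) := by
  have := measurable_fourierChar
  unfold modulate
  fun_prop

/-- The symbol is a superposition of characters, and each character at ζ - z splits into a phase in
ζ and a modulation in z. The modulation can be put on H, where it does not change |H|, so u itself
stays untouched and keeps its L⁴ norm. -/
lemma integral_convIntegrand_dilatedSymbol {H U : ℝ × ℝ → ℂ} (hH2 : MemLp H 2)
    (hU2 : MemLp U 2) {κ : ℝ → ℂ} (hκ : Integrable κ) (c : ℝ) (ζ : ℝ × ℝ) :
    ∫ z, convIntegrand H (spaceMultiplier (dilatedSymbol κ c) U) ζ z =
      ∫ y, κ y * ((Real.fourierChar (-(c * y * ζ.1)) : ℂ) *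
        ∫ z, convIntegrand (modulate H (c * y)) U ζ z) := by
  have hfc := measurable_fourierChar
  have hint : Integrable (fun p : (ℝ × ℝ) × ℝ =>
      (Real.fourierChar (-(p.2 * (c * (ζ - p.1).1))) : ℂ) *
        (convIntegrand H U ζ p.1 * κ p.2)) (volume.prod volume) := by
    have h1 := (integrable_convIntegrand hH2 hU2 ζ).mul_prod hκ
    refine h1.bdd_mul (c := 1) (by fun_prop) (.of_forall fun p => (norm_fourierChar _).le)
  calc ∫ z, convIntegrand H (spaceMultiplier (dilatedSymbol κ c) U) ζ z
      = ∫ z, ∫ y, (Real.fourierChar (-(y * (c * (ζ - z).1))) : ℂ) *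
          (convIntegrand H U ζ z * κ y) := by
        refine integral_congr_ae (.of_forall fun z => ?_)
        simp only [convIntegrand, spaceMultiplier, dilatedSymbol, Real.fourier_real_eq]
        rw [mul_left_comm, ← integral_mul_const]
        refine integral_congr_ae (.of_forall fun y => ?_)
        simp only [Circle.smul_def, smul_eq_mul]
        ring
    _ = ∫ y, ∫ z, (Real.fourierChar (-(y * (c * (ζ - z).1))) : ℂ) *
          (convIntegrand H U ζ z * κ y) := integral_integral_swap hint
    _ = _ := by
        refine integral_congr_ae (.of_forall fun y => ?_)
        simp only
        rw [← integral_const_mul, ← integral_const_mul]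
        refine integral_congr_ae (.of_forall fun z => ?_)
        simp only [convIntegrand, modulate]
        have : (Real.fourierChar (-(y * (c * (ζ - z).1))) : ℂ) =
            (Real.fourierChar (-(c * y * ζ.1)) : ℂ) * (Real.fourierChar (c * y * z.1) : ℂ) := by
          rw [← Circle.coe_mul, ← AddChar.map_add_eq_mul]
          congr 2
          simp; ring
        rw [this]; ring

/-- The bilinear estimate with a smooth frequency localization of the second factor. -/
lemma lintegral_sq_conv_dilatedSymbol_le {H : ℝ × ℝ → ℂ} (hH : Measurable H) (hH2 : MemLp H 2)
    (u : L2xt) {κ : ℝ → ℂ} (hκm : Measurable κ) (hκ : Integrable κ) (c : ℝ) :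
    ∫⁻ ζ, ‖∫ z, convIntegrand H (spaceMultiplier (dilatedSymbol κ c) (spaceTimeFourier u)) ζ z‖ₑ ^ 2
      ≤ (∫⁻ y, ‖κ y‖ₑ) ^ 2 * (bilinearConst *
        (∫⁻ z, bracketPow (z.2 + z.1 ^ 2) (7 / 8) * ‖H z‖ₑ ^ 2) * eLpNorm u 4 volume ^ 2) := by
  set U := spaceTimeFourier u with hU
  have hUm : Measurable U := measurable_spaceTimeFourier u
  have hU2 : MemLp U 2 := memLp_spaceTimeFourier u
  set B := bilinearConst * (∫⁻ z, bracketPow (z.2 + z.1 ^ 2) (7 / 8) * ‖H z‖ₑ ^ 2) *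
    eLpNorm u 4 volume ^ 2 with hB
  set T : ℝ → ℝ × ℝ → ℂ := fun y ζ => ∫ z, convIntegrand (modulate H (c * y)) U ζ z with hT
  have hTm : Measurable (Function.uncurry fun y ζ => ‖T y ζ‖ₑ) := by
    have : Measurable fun q : (ℝ × (ℝ × ℝ)) × (ℝ × ℝ) =>
        convIntegrand (modulate H (c * q.1.1)) U q.1.2 q.2 := by
      have h1 : Measurable fun q : (ℝ × (ℝ × ℝ)) × (ℝ × ℝ) => modulate H (c * q.1.1) q.2 := by
        unfold modulate
        have := measurable_fourierChar
        fun_prop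
      have h2 : Measurable fun q : (ℝ × (ℝ × ℝ)) × (ℝ × ℝ) => U (q.1.2 - q.2) := by fun_prop
      exact h1.mul h2
    exact this.stronglyMeasurable.integral_prod_right.measurable.enorm
  have hTB : ∀ y, ∫⁻ ζ, ‖T y ζ‖ₑ ^ 2 ≤ B := by
    intro y
    have hm : Measurable (modulate H (c * y)) := measurable_modulate hH _
    have hm2 : MemLp (modulate H (c * y)) 2 := by
      rw [memLp_two_iff hm.aestronglyMeasurable]
      simp only [enorm_modulate]
      rwa [← memLp_two_iff hH.aestronglyMeasurable]
    have := lintegral_sq_conv_le_eLpNorm hm hm2 u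
    simpa only [enorm_modulate] using this
  have hpt : ∀ ζ, ‖∫ z, convIntegrand H (spaceMultiplier (dilatedSymbol κ c) U) ζ z‖ₑ ^ 2 ≤
      (∫⁻ y, ‖κ y‖ₑ) * ∫⁻ y, ‖κ y‖ₑ * ‖T y ζ‖ₑ ^ 2 := by
    intro ζ
    have hTζ : Measurable fun y => ‖T y ζ‖ₑ := hTm.of_uncurry_right
    rw [integral_convIntegrand_dilatedSymbol hH2 hU2 hκ c ζ]
    calc _ ≤ (∫⁻ y, ‖κ y‖ₑ * ‖T y ζ‖ₑ) ^ 2 := by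
          gcongr
          refine (enorm_integral_le_lintegral_enorm _).trans (le_of_eq ?_)
          refine lintegral_congr fun y => ?_
          rw [enorm_mul, enorm_mul]
          congr 1
          rw [enorm_fourierChar, one_mul]
      -- Splitting |κ| into two square roots makes Cauchy–Schwarz act as Minkowski in y.
      _ = (∫⁻ y, ‖κ y‖ₑ ^ (1 / 2 : ℝ) * (‖κ y‖ₑ ^ (1 / 2 : ℝ) * ‖T y ζ‖ₑ)) ^ 2 := by
          congr 1
          refine lintegral_congr fun y => ?_
          rw [← mul_assoc, ← ENNReal.rpow_add_of_nonneg _ _ (by norm_num) (by norm_num)]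
          norm_num
      _ ≤ _ := by
          refine (sq_lintegral_mul_le (by fun_prop) (by fun_prop)).trans (le_of_eq ?_)
          simp only [mul_pow, ← ENNReal.rpow_mul_natCast]
          norm_num
  calc _ ≤ ∫⁻ ζ, (∫⁻ y, ‖κ y‖ₑ) * ∫⁻ y, ‖κ y‖ₑ * ‖T y ζ‖ₑ ^ 2 := lintegral_mono hpt
    _ = (∫⁻ y, ‖κ y‖ₑ) * ∫⁻ y, ‖κ y‖ₑ * ∫⁻ ζ, ‖T y ζ‖ₑ ^ 2 := by
        rw [lintegral_const_mul' _ _ hκ.2.ne, lintegral_lintegral_swap]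
        · congr 1
          refine lintegral_congr fun y => ?_
          rw [lintegral_const_mul' _ _ (by simp)]
        · have := hTm.comp measurable_swap
          exact ((hκm.enorm.comp measurable_snd).mul (this.pow_const 2)).aemeasurable
    _ ≤ (∫⁻ y, ‖κ y‖ₑ) * ∫⁻ y, ‖κ y‖ₑ * B := by gcongr with y; exact hTB y
    _ = _ := by rw [lintegral_mul_const _ hκm.enorm]; ring

lemma conj_div_norm_mul_self (t : ℂ) : (starRingEnd ℂ t / ‖t‖) * t = (‖t‖ : ℂ) := by
  by_cases h : t = 0
  · simp [h]
  · have : (‖t‖ : ℂ) ≠ 0 := by simpa using h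
    field_simp
    rw [← Complex.normSq_eq_conj_mul_self, Complex.normSq_eq_norm_sq]; push_cast; ring

lemma enorm_conj_div_norm_le (t : ℂ) : ‖starRingEnd ℂ t / (‖t‖ : ℂ)‖ₑ ≤ 1 := by
  rw [← ofReal_norm, ← ENNReal.ofReal_one]
  refine ENNReal.ofReal_le_ofReal ?_
  simp [div_self_le_one]

/-- The dual form of the bilinear estimate with a smooth frequency localization. -/
lemma lintegral_weight_sq_conv_dilatedSymbol_le {V : ℝ × ℝ → ℂ} (hV : Measurable V)
    (hV2 : MemLp V 2) (u : L2xt) {κ : ℝ → ℂ} (hκm : Measurable κ) (hκ : Integrable κ) (c : ℝ) :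
    ∫⁻ ζ, bracketPow (ζ.2 + ζ.1 ^ 2) (-7 / 8) *
      ‖∫ z, convIntegrand V (spaceMultiplier (dilatedSymbol κ c) (spaceTimeFourier u)) ζ z‖ₑ ^ 2
      ≤ (∫⁻ y, ‖κ y‖ₑ) ^ 2 * bilinearConst * (∫⁻ z, ‖V z‖ₑ ^ 2) * eLpNorm u 4 volume ^ 2 := by
  set U := spaceMultiplier (dilatedSymbol κ c) (spaceTimeFourier u) with hU
  have hUm : Measurable U := measurable_spaceMultiplier
    (continuous_dilatedSymbol hκ c).measurable (measurable_spaceTimeFourier u)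
  have hU2 : MemLp U 2 := memLp_spaceMultiplier (continuous_dilatedSymbol hκ c).measurable
    (memLp_spaceTimeFourier u) (norm_dilatedSymbol_le κ c)
  set T : ℝ × ℝ → ℂ := fun ζ => ∫ z, convIntegrand V U ζ z with hT
  have hTm : Measurable T := measurable_integral_convIntegrand hV hUm
  set A := (∫⁻ z, ‖V z‖ₑ ^ 2) * ∫⁻ z, ‖U z‖ₑ ^ 2 with hA
  have hAT : A ≠ ∞ := ENNReal.mul_ne_top ((memLp_two_iff hV2.1).mp hV2)
    ((memLp_two_iff hU2.1).mp hU2)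
  -- The convolution of two L² functions is bounded; this crude bound is used only to justify Fubini
  -- below.
  have hconv : ∀ ζ, ∫⁻ z, ‖convIntegrand V U ζ z‖ₑ ≤ A + 1 := by
    intro ζ
    have h1 := lintegral_conv_sq_le hV hUm ζ
    by_contra h
    push Not at h
    have h2 : A + 1 ≤ (A + 1) ^ 2 := le_self_pow₀ le_add_self two_ne_zero
    have h3 : (A + 1) ^ 2 ≤ A := le_trans (by gcongr) h1
    exact absurd (h2.trans h3) (not_le.mpr (ENNReal.lt_add_right hAT one_ne_zero))
  refine lintegral_weight_mul_sq_le_of_dual hTm.enorm (by fun_prop)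
    (w := fun ζ => bracketPow (ζ.2 + ζ.1 ^ 2) (7 / 8))
    (fun _ => bracketPow_le_one _ (by norm_num)) (fun ζ => ?_) fun H hH hHM hHi => ?_
  · rw [bracketPow_mul]; norm_num [bracketPow_zero]
  obtain ⟨M, hM⟩ := hHM
  have hHt : ∀ ζ, H ζ ≠ ∞ := fun ζ => ne_top_of_le_ne_top (by simp) (hM ζ)
  -- The conjugate phase of T turns the test integral of H |T| into a linear pairing of P with T.
  set P : ℝ × ℝ → ℂ := fun ζ => ((H ζ).toReal : ℂ) * (starRingEnd ℂ (T ζ) / ‖T ζ‖) with hP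
  have hPm : Measurable P := by
    have : Measurable fun ζ => starRingEnd ℂ (T ζ) := Complex.continuous_conj.measurable.comp hTm
    fun_prop
  have hPH : ∀ ζ, ‖P ζ‖ₑ ≤ H ζ := by
    intro ζ
    rw [hP, enorm_mul]
    calc _ ≤ ‖((H ζ).toReal : ℂ)‖ₑ * 1 := by gcongr; exact enorm_conj_div_norm_le _
      _ = H ζ := by
        rw [mul_one, ← ofReal_norm, Complex.norm_real, Real.norm_of_nonneg ENNReal.toReal_nonneg,
          ENNReal.ofReal_toReal (hHt ζ)]
  have hPi : ∫⁻ ζ, ‖P ζ‖ₑ ≠ ∞ := ne_top_of_le_ne_top hHi (lintegral_mono hPH)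
  have hP2 : MemLp P 2 := by
    rw [memLp_two_iff hPm.aestronglyMeasurable]
    refine ne_top_of_le_ne_top (b := (M : ℝ≥0∞) * ∫⁻ ζ, H ζ) (ENNReal.mul_ne_top (by simp) hHi) ?_
    rw [← lintegral_const_mul' _ _ (by simp)]
    refine lintegral_mono fun ζ => ?_
    rw [sq]
    gcongr
    · exact (hPH ζ).trans (hM ζ)
    · exact hPH ζ
  have hint : Integrable (fun p : (ℝ × ℝ) × (ℝ × ℝ) => P p.1 * convIntegrand V U p.1 p.2)
      (volume.prod volume) := by
    have hm : Measurable fun p : (ℝ × ℝ) × (ℝ × ℝ) => P p.1 * convIntegrand V U p.1 p.2 :=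
      (hPm.comp measurable_fst).mul (measurable_uncurry_convIntegrand hV hUm)
    refine ⟨hm.aestronglyMeasurable, ?_⟩
    rw [hasFiniteIntegral_iff_enorm, lintegral_prod _ hm.enorm.aemeasurable]
    refine lt_of_le_of_lt (b := (∫⁻ ζ, ‖P ζ‖ₑ) * (A + 1)) ?_ ?_
    · rw [← lintegral_mul_const _ hPm.enorm]
      refine lintegral_mono fun ζ => ?_
      simp only [enorm_mul]
      rw [lintegral_const_mul' _ _ (by simp)]
      gcongr
      exact hconv ζ
    · exact ENNReal.mul_lt_top hPi.lt_top (by simpa using hAT.lt_top)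
  have e1 : ∫⁻ ζ, H ζ * ‖T ζ‖ₑ = ‖∫ ζ, P ζ * T ζ‖ₑ := by
    have h1 : ∀ ζ, P ζ * T ζ = (((H ζ).toReal * ‖T ζ‖ : ℝ) : ℂ) := by
      intro ζ
      rw [hP]
      simp only
      rw [mul_assoc, conj_div_norm_mul_self]; push_cast; rfl
    have h2 : Integrable fun ζ => (H ζ).toReal * ‖T ζ‖ := by
      have h3 := (hint.integral_prod_left).norm
      refine h3.congr (.of_forall fun ζ => ?_)
      simp only
      rw [integral_const_mul]
      change ‖P ζ * T ζ‖ = _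
      rw [h1, Complex.norm_real, Real.norm_of_nonneg (by positivity)]
    simp only [h1]
    rw [integral_complex_ofReal, ← ofReal_norm, Complex.norm_real,
      Real.norm_of_nonneg (by positivity), ofReal_integral_eq_lintegral_ofReal h2
        (.of_forall fun ζ => by positivity)]
    refine lintegral_congr fun ζ => ?_
    rw [ENNReal.ofReal_mul (by positivity), ENNReal.ofReal_toReal (hHt ζ), ofReal_norm]
  -- Transposing convolution by U gives convolution by U(-·), which is the transform of the
  -- reflected u with the symbol dilated by -c.
  set W := spaceMultiplier (dilatedSymbol κ (-c)) (spaceTimeFourier (reflect u)) with hW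
  have hWm : Measurable W := measurable_spaceMultiplier
    (continuous_dilatedSymbol hκ (-c)).measurable (measurable_spaceTimeFourier _)
  have hUW : ∀ᵐ ζ, W ζ = U (-ζ) := by
    filter_upwards [spaceTimeFourier_reflect u] with ζ hζ
    simp only [hW, hU, spaceMultiplier, hζ, dilatedSymbol]
    simp
  have e2 : ∫ ζ, P ζ * T ζ = ∫ z, V z * ∫ ζ, convIntegrand P W z ζ := by
    calc ∫ ζ, P ζ * T ζ = ∫ ζ, ∫ z, P ζ * convIntegrand V U ζ z := by
          refine integral_congr_ae (.of_forall fun ζ => ?_)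
          exact (integral_const_mul _ _).symm
      _ = ∫ z, ∫ ζ, P ζ * convIntegrand V U ζ z := integral_integral_swap hint
      _ = _ := by
          refine integral_congr_ae (.of_forall fun z => ?_)
          simp only
          rw [← integral_const_mul]
          refine integral_congr_ae ?_
          filter_upwards [(Measure.measurePreserving_sub_left volume z).quasiMeasurePreserving.ae
            hUW] with ζ hζ
          simp only [convIntegrand, hζ, neg_sub]
          ring
  rw [e1, e2]
  calc ‖∫ z, V z * ∫ ζ, convIntegrand P W z ζ‖ₑ ^ 2
      ≤ (∫⁻ z, ‖V z‖ₑ * ‖∫ ζ, convIntegrand P W z ζ‖ₑ) ^ 2 := by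
        gcongr
        refine (enorm_integral_le_lintegral_enorm _).trans (le_of_eq ?_)
        simp only [enorm_mul]
    _ ≤ (∫⁻ z, ‖V z‖ₑ ^ 2) * ∫⁻ z, ‖∫ ζ, convIntegrand P W z ζ‖ₑ ^ 2 :=
        sq_lintegral_mul_le hV.enorm.aemeasurable
          (measurable_integral_convIntegrand hPm hWm).enorm.aemeasurable
    _ ≤ (∫⁻ z, ‖V z‖ₑ ^ 2) * ((∫⁻ y, ‖κ y‖ₑ) ^ 2 * (bilinearConst *
        (∫⁻ z, bracketPow (z.2 + z.1 ^ 2) (7 / 8) * ‖P z‖ₑ ^ 2) *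
          eLpNorm (reflect u) 4 volume ^ 2)) := by
        gcongr
        exact lintegral_sq_conv_dilatedSymbol_le hPm hP2 (reflect u) hκm hκ (-c)
    _ ≤ (∫⁻ z, ‖V z‖ₑ ^ 2) * ((∫⁻ y, ‖κ y‖ₑ) ^ 2 * (bilinearConst *
        (∫⁻ z, bracketPow (z.2 + z.1 ^ 2) (7 / 8) * H z ^ 2) * eLpNorm u 4 volume ^ 2)) := by
        rw [eLpNorm_reflect]
        gcongr with z
        exact hPH z
    _ = _ := by ring

/-! ### The combined output norm. -/

lemma ennreal_add_sq_le (x y : ℝ≥0∞) : (x + y) ^ 2 ≤ 2 * (x ^ 2 + y ^ 2) := by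
  have := ENNReal.rpow_add_le_mul_rpow_add_rpow x y (p := 2) (by norm_num)
  norm_num at this
  exact_mod_cast this

lemma tsum_sq_le_weighted {a x : ℤ → ℝ≥0∞} (h0 : ∀ k, a k ≠ 0) (ht : ∀ k, a k ≠ ∞) :
    (∑' k, x k) ^ 2 ≤ (∑' k, (a k)⁻¹) * ∑' k, a k * x k ^ 2 := by
  have h := sq_lintegral_mul_le (μ := (Measure.count : Measure ℤ))
    (f := fun k => (a k)⁻¹ ^ (1 / 2 : ℝ)) (g := fun k => a k ^ (1 / 2 : ℝ) * x k)
    (Measurable.of_discrete).aemeasurable (Measurable.of_discrete).aemeasurable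
  simp only [lintegral_count, mul_pow, ← ENNReal.rpow_mul_natCast] at h
  norm_num only [ENNReal.rpow_one] at h
  refine le_trans (le_of_eq ?_) h
  congr 1
  refine tsum_congr fun k => ?_
  rw [← mul_assoc, ← ENNReal.mul_rpow_of_ne_top (ENNReal.inv_ne_top.mpr (h0 k)) (ht k),
    ENNReal.inv_mul_cancel (h0 k) (ht k), ENNReal.one_rpow, one_mul]

/-- The square of the sum of the `X^{0,-1/2}` and the `Z^{0,-1}` norm (up to constants), localized
to spatial frequencies in `A`. -/
noncomputable def outNorm (A : Set ℝ) (f : ℝ × ℝ → ℝ≥0∞) : ℝ≥0∞ :=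
  ∫⁻ ξ in A, ((∫⁻ τ, bracketPow (τ + |ξ| * ξ) (-1) * f (ξ, τ) ^ 2) +
    (∫⁻ τ, bracketPow (τ + |ξ| * ξ) (-1) * f (ξ, τ)) ^ 2)

lemma outNorm_mono {A : Set ℝ} (hA : MeasurableSet A) {f g : ℝ × ℝ → ℝ≥0∞}
    (h : ∀ ζ : ℝ × ℝ, ζ.1 ∈ A → f ζ ≤ g ζ) : outNorm A f ≤ outNorm A g := by
  refine setLIntegral_mono' hA fun ξ hξ => ?_
  gcongr with τ τ
  · exact h (ξ, τ) hξ
  · exact h (ξ, τ) hξ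

lemma outNorm_const_mul (A : Set ℝ) {c : ℝ≥0∞} (hc : c ≠ ∞) (f : ℝ × ℝ → ℝ≥0∞) :
    outNorm A (fun ζ => c * f ζ) = c ^ 2 * outNorm A f := by
  unfold outNorm
  rw [← lintegral_const_mul' _ _ (by finiteness)]
  refine lintegral_congr fun ξ => ?_
  simp only [mul_pow, mul_left_comm _ (c ^ 2), mul_left_comm _ c]
  rw [lintegral_const_mul' _ _ (by finiteness), lintegral_const_mul' _ _ hc]
  ring

lemma measurable_outNorm_integrand {f : ℝ × ℝ → ℝ≥0∞} (hf : Measurable f) :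
    Measurable fun ξ => (∫⁻ τ, bracketPow (τ + |ξ| * ξ) (-1) * f (ξ, τ) ^ 2) +
    (∫⁻ τ, bracketPow (τ + |ξ| * ξ) (-1) * f (ξ, τ)) ^ 2 := by
  have h1 : Measurable (Function.uncurry fun ξ τ : ℝ =>
      bracketPow (τ + |ξ| * ξ) (-1) * f (ξ, τ) ^ 2) := by
    unfold Function.uncurry; fun_prop
  have h2 : Measurable (Function.uncurry fun ξ τ : ℝ =>
      bracketPow (τ + |ξ| * ξ) (-1) * f (ξ, τ)) := by
    unfold Function.uncurry; fun_prop
  exact h1.lintegral_prod_right.add (h2.lintegral_prod_right.pow_const 2)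

lemma outNorm_add_le (A : Set ℝ) {f g : ℝ × ℝ → ℝ≥0∞} (hf : Measurable f) :
    outNorm A (fun ζ => f ζ + g ζ) ≤ 2 * (outNorm A f + outNorm A g) := by
  unfold outNorm
  rw [← lintegral_add_left (measurable_outNorm_integrand hf), ← lintegral_const_mul' _ _ (by simp)]
  refine lintegral_mono fun ξ => ?_
  simp only
  set b : ℝ → ℝ≥0∞ := fun τ => bracketPow (τ + |ξ| * ξ) (-1) with hb
  have hbm : Measurable b := by fun_prop
  have h1 : ∫⁻ τ, b τ * (f (ξ, τ) + g (ξ, τ)) ^ 2 ≤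
      2 * ((∫⁻ τ, b τ * f (ξ, τ) ^ 2) + ∫⁻ τ, b τ * g (ξ, τ) ^ 2) := by
    rw [← lintegral_add_left (by fun_prop), ← lintegral_const_mul' _ _ (by simp)]
    refine lintegral_mono fun τ => ?_
    calc b τ * (f (ξ, τ) + g (ξ, τ)) ^ 2 ≤ b τ * (2 * (f (ξ, τ) ^ 2 + g (ξ, τ) ^ 2)) := by
          gcongr; exact ennreal_add_sq_le _ _
      _ = _ := by ring
  have h2 : (∫⁻ τ, b τ * (f (ξ, τ) + g (ξ, τ))) ^ 2 ≤
      2 * ((∫⁻ τ, b τ * f (ξ, τ)) ^ 2 + (∫⁻ τ, b τ * g (ξ, τ)) ^ 2) := by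
    simp only [mul_add]
    rw [lintegral_add_left (by fun_prop), ← mul_add]
    exact ennreal_add_sq_le _ _
  calc _ ≤ _ := add_le_add h1 h2
    _ = _ := by ring

/-- Cauchy–Schwarz in k, applied inside both quadratic parts of `outNorm`. With weights growing
geometrically away from the diagonal, the loss is a convergent series. -/
lemma outNorm_tsum_le (A : Set ℝ) {f : ℤ → ℝ × ℝ → ℝ≥0∞} (hf : ∀ k, Measurable (f k))
    {a : ℤ → ℝ≥0∞} (h0 : ∀ k, a k ≠ 0) (ht : ∀ k, a k ≠ ∞) :
    outNorm A (fun ζ => ∑' k, f k ζ) ≤ (∑' k, (a k)⁻¹) * ∑' k, a k * outNorm A (f k) := by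
  set S := ∑' k, (a k)⁻¹ with hS
  have hpt : ∀ ξ : ℝ, (∫⁻ τ, bracketPow (τ + |ξ| * ξ) (-1) * (∑' k, f k (ξ, τ)) ^ 2) +
      (∫⁻ τ, bracketPow (τ + |ξ| * ξ) (-1) * ∑' k, f k (ξ, τ)) ^ 2 ≤
      S * ∑' k, a k * ((∫⁻ τ, bracketPow (τ + |ξ| * ξ) (-1) * f k (ξ, τ) ^ 2) +
        (∫⁻ τ, bracketPow (τ + |ξ| * ξ) (-1) * f k (ξ, τ)) ^ 2) := by
    intro ξ
    set b : ℝ → ℝ≥0∞ := fun τ => bracketPow (τ + |ξ| * ξ) (-1) with hb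
    have hbm : Measurable b := by fun_prop
    have h1 : ∫⁻ τ, b τ * (∑' k, f k (ξ, τ)) ^ 2 ≤ S * ∑' k, a k * ∫⁻ τ, b τ * f k (ξ, τ) ^ 2 := by
      calc _ ≤ ∫⁻ τ, S * ∑' k, a k * (b τ * f k (ξ, τ) ^ 2) := by
            refine lintegral_mono fun τ => ?_
            calc b τ * (∑' k, f k (ξ, τ)) ^ 2 ≤ b τ * (S * ∑' k, a k * f k (ξ, τ) ^ 2) := by
                  gcongr; exact tsum_sq_le_weighted h0 ht
              _ = _ := by
                  rw [mul_left_comm, ← ENNReal.tsum_mul_left]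
                  simp only [mul_left_comm (b τ)]
        _ = _ := by
            rw [lintegral_const_mul _ (by fun_prop), lintegral_tsum (fun k => by fun_prop)]
            congr 1
            refine tsum_congr fun k => ?_
            rw [lintegral_const_mul' _ _ (ht k)]
    have h2 : (∫⁻ τ, b τ * ∑' k, f k (ξ, τ)) ^ 2 ≤
        S * ∑' k, a k * (∫⁻ τ, b τ * f k (ξ, τ)) ^ 2 := by
      simp only [← ENNReal.tsum_mul_left]
      rw [lintegral_tsum (fun k => by fun_prop), ENNReal.tsum_mul_left]
      exact tsum_sq_le_weighted h0 ht
    calc _ ≤ _ := add_le_add h1 h2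
      _ = _ := by rw [← mul_add, ← ENNReal.tsum_add]; simp only [mul_add, hb]
  have hm : ∀ k, Measurable fun ξ => (∫⁻ τ, bracketPow (τ + |ξ| * ξ) (-1) * f k (ξ, τ) ^ 2) +
        (∫⁻ τ, bracketPow (τ + |ξ| * ξ) (-1) * f k (ξ, τ)) ^ 2 := fun k =>
    measurable_outNorm_integrand (hf k)
  calc outNorm A (fun ζ => ∑' k, f k ζ) ≤ _ := lintegral_mono fun ξ => hpt ξ
    _ = _ := by
      rw [lintegral_const_mul _ (Measurable.tsum fun k => (hm k).const_mul _),
        lintegral_tsum (fun k => ((hm k).const_mul _).aemeasurable)]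
      congr 1
      refine tsum_congr fun k => ?_
      rw [lintegral_const_mul' _ _ (ht k)]
      rfl

lemma outNorm_iUnion_le (E : ℕ → Set ℝ) (f : ℝ × ℝ → ℝ≥0∞) :
    outNorm (⋃ n, E n) f ≤ ∑' n, outNorm (E n) f :=
  lintegral_iUnion_le _ _

lemma tsum_outNorm_le {E : ℕ → Set ℝ} (hE : ∀ n, MeasurableSet (E n))
    (hd : Pairwise (Function.onFun Disjoint E)) {B : Set ℝ} (hB : ∀ n, E n ⊆ B)
    (f : ℝ × ℝ → ℝ≥0∞) : ∑' n, outNorm (E n) f ≤ outNorm B f := by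
  unfold outNorm
  rw [← lintegral_iUnion hE hd]
  exact lintegral_mono_set (Set.iUnion_subset hB)

lemma lintegral_bracketPow_dilate {K : ℝ} (hK : 0 < K) (p : ℝ) :
    ∫⁻ t, bracketPow (K⁻¹ * t) p = ENNReal.ofReal K * ∫⁻ t, bracketPow t p := by
  have h := lintegral_map (μ := volume) (measurable_bracketPow p)
    (measurable_const_mul (K⁻¹ : ℝ))
  rw [Real.map_volume_mul_left (inv_ne_zero hK.ne'), lintegral_smul_measure, inv_inv,
    abs_of_pos hK] at h
  exact h.symm

/-- Where |τ + a| ≥ K one has K⟨(τ + a)/K⟩ ≤ 2⟨τ + a⟩. The tail is thus dominated by K⁻² times a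
dilate, whose integral contributes a factor K. -/
lemma lintegral_indicator_bracketPow_le {K : ℝ} (hK : 0 < K) (a : ℝ) :
    ∫⁻ τ, {τ | K ≤ |τ + a|}.indicator (fun τ => bracketPow (τ + a) (-2)) τ ≤
      4 * (∫⁻ t, bracketPow t (-2)) * ENNReal.ofReal K⁻¹ := by
  calc ∫⁻ τ, {τ | K ≤ |τ + a|}.indicator (fun τ => bracketPow (τ + a) (-2)) τ
      ≤ ∫⁻ τ, ENNReal.ofReal (4 * (K⁻¹ * K⁻¹)) * bracketPow (K⁻¹ * (τ + a)) (-2) := by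
        refine lintegral_mono fun τ => Set.indicator_apply_le' (fun hτ => ?_) (fun _ => zero_le)
        have hτ' : K ≤ |τ + a| := hτ
        unfold bracketPow
        rw [← ENNReal.ofReal_mul (by positivity)]
        refine ENNReal.ofReal_le_ofReal ?_
        rw [Real.rpow_neg (bracket_pos _).le, Real.rpow_neg (bracket_pos _).le]
        norm_num only [Real.rpow_ofNat]
        have h1 : bracket (K⁻¹ * (τ + a)) * K ≤ 2 * bracket (τ + a) := by
          unfold bracket
          rw [abs_mul, abs_of_pos (inv_pos.mpr hK)]
          have : (1 + K⁻¹ * |τ + a|) * K = K + |τ + a| := by field_simp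
          rw [this]; linarith
        have p1 := bracket_pos (τ + a)
        have p2 := bracket_pos (K⁻¹ * (τ + a))
        rw [show 4 * (K⁻¹ * K⁻¹) * (bracket (K⁻¹ * (τ + a)) ^ 2)⁻¹ =
          4 * ((bracket (K⁻¹ * (τ + a)) * K) ^ 2)⁻¹ by field_simp]
        rw [← div_eq_mul_inv, inv_eq_one_div, div_le_div_iff₀ (by positivity) (by positivity)]
        have : (bracket (K⁻¹ * (τ + a)) * K) ^ 2 ≤ (2 * bracket (τ + a)) ^ 2 := by gcongr
        linarith
    _ = _ := by
        rw [lintegral_const_mul' _ _ ENNReal.ofReal_ne_top,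
          lintegral_add_right_eq_self (fun τ => bracketPow (K⁻¹ * τ) (-2)),
          lintegral_bracketPow_dilate hK, ← mul_assoc, ← ENNReal.ofReal_mul (by positivity),
          show 4 * (K⁻¹ * K⁻¹) * K = 4 * K⁻¹ by field_simp, ENNReal.ofReal_mul (by norm_num)]
        norm_num
        ring

/-- The constant in `outNorm_le_of_large_modulation` and `outNorm_le_weighted`. -/
noncomputable def outConst : ℝ≥0∞ :=
  1 + 4 * (∫⁻ t, bracketPow t (-2)) + ∫⁻ t, bracketPow t (-9 / 8)

lemma outConst_ne_top : outConst ≠ ∞ := by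
  have h1 := (lintegral_bracketPow_lt_top (p := -9 / 8) (by norm_num)).ne
  have h2 := (lintegral_bracketPow_lt_top (p := -2) (by norm_num)).ne
  unfold outConst
  finiteness

/-- In the X part the weight is at most K⁻¹ on the support. In the Z part, Cauchy–Schwarz in τ
against ⟨σ⟩⁻² restricted to |σ| ≥ K yields the same K⁻¹. This is the gain when the output has large
modulation. -/
lemma outNorm_le_of_large_modulation (A : Set ℝ) {f : ℝ × ℝ → ℝ≥0∞}
    (hf : Measurable f) {K : ℝ} (hK : 0 < K)
    (h : ∀ ζ : ℝ × ℝ, |ζ.2 + |ζ.1| * ζ.1| < K → f ζ = 0) :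
    outNorm A f ≤ outConst * ENNReal.ofReal K⁻¹ * ∫⁻ ζ, f ζ ^ 2 := by
  have hpt : ∀ ξ : ℝ, (∫⁻ τ, bracketPow (τ + |ξ| * ξ) (-1) * f (ξ, τ) ^ 2) +
      (∫⁻ τ, bracketPow (τ + |ξ| * ξ) (-1) * f (ξ, τ)) ^ 2 ≤
      outConst * ENNReal.ofReal K⁻¹ * ∫⁻ τ, f (ξ, τ) ^ 2 := by
    intro ξ
    have h1 : ∫⁻ τ, bracketPow (τ + |ξ| * ξ) (-1) * f (ξ, τ) ^ 2 ≤
        1 * ENNReal.ofReal K⁻¹ * ∫⁻ τ, f (ξ, τ) ^ 2 := by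
      rw [one_mul, ← lintegral_const_mul' _ _ (by simp)]
      refine lintegral_mono fun τ => ?_
      by_cases hτ : |τ + |ξ| * ξ| < K
      · simp [h (ξ, τ) hτ]
      · gcongr
        refine ENNReal.ofReal_le_ofReal ?_
        rw [Real.rpow_neg_one]
        refine inv_anti₀ hK ?_
        unfold bracket; linarith
    have h2 : (∫⁻ τ, bracketPow (τ + |ξ| * ξ) (-1) * f (ξ, τ)) ^ 2 ≤
        4 * (∫⁻ t, bracketPow t (-2)) * ENNReal.ofReal K⁻¹ * ∫⁻ τ, f (ξ, τ) ^ 2 := by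
      have hS : MeasurableSet {τ : ℝ | K ≤ |τ + |ξ| * ξ|} := measurableSet_le (by fun_prop) (by fun_prop)
      calc (∫⁻ τ, bracketPow (τ + |ξ| * ξ) (-1) * f (ξ, τ)) ^ 2
          = (∫⁻ τ, {τ : ℝ | K ≤ |τ + |ξ| * ξ|}.indicator
              (fun τ => bracketPow (τ + |ξ| * ξ) (-1)) τ * f (ξ, τ)) ^ 2 := by
            congr 1
            refine lintegral_congr fun τ => ?_
            by_cases hτ : |τ + |ξ| * ξ| < K
            · simp [h (ξ, τ) hτ]
            · rw [Set.indicator_of_mem]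
              simpa using hτ
        _ ≤ (∫⁻ τ, {τ : ℝ | K ≤ |τ + |ξ| * ξ|}.indicator
              (fun τ => bracketPow (τ + |ξ| * ξ) (-1)) τ ^ 2) * ∫⁻ τ, f (ξ, τ) ^ 2 :=
            sq_lintegral_mul_le (Measurable.indicator (by fun_prop) hS).aemeasurable (by fun_prop)
        _ ≤ _ := by
            gcongr
            refine le_trans (le_of_eq (lintegral_congr fun τ => ?_))
              (lintegral_indicator_bracketPow_le hK (|ξ| * ξ))
            by_cases hτ : τ ∈ {τ : ℝ | K ≤ |τ + |ξ| * ξ|}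
            · rw [Set.indicator_of_mem hτ, Set.indicator_of_mem hτ, bracketPow_sq]; norm_num
            · rw [Set.indicator_of_notMem hτ, Set.indicator_of_notMem hτ]; norm_num
    calc _ ≤ _ := add_le_add h1 h2
      _ = (1 + 4 * ∫⁻ t, bracketPow t (-2)) * ENNReal.ofReal K⁻¹ * ∫⁻ τ, f (ξ, τ) ^ 2 := by ring
      _ ≤ _ := by gcongr; exact le_self_add
  calc outNorm A f ≤ ∫⁻ ξ in A, outConst * ENNReal.ofReal K⁻¹ * ∫⁻ τ, f (ξ, τ) ^ 2 :=
        lintegral_mono fun ξ => hpt ξ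
    _ ≤ ∫⁻ ξ, outConst * ENNReal.ofReal K⁻¹ * ∫⁻ τ, f (ξ, τ) ^ 2 := setLIntegral_le_lintegral _ _
    _ = _ := by
      rw [lintegral_const_mul' _ _ (ENNReal.mul_ne_top outConst_ne_top (by simp)),
        Measure.volume_eq_prod, lintegral_prod _ (by fun_prop)]

/-- Splitting 1 = 9/16 + 7/16, Cauchy–Schwarz in τ absorbs the Z part because ⟨σ⟩^{-9/8} is
integrable. Positivity of ξ on A identifies the modulation with τ + ξ². -/
lemma outNorm_le_weighted {A : Set ℝ} (hA : MeasurableSet A) (hA0 : A ⊆ Set.Ioi 0)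
    {f : ℝ × ℝ → ℝ≥0∞} (hf : Measurable f) :
    outNorm A f ≤ outConst * ∫⁻ ζ, bracketPow (ζ.2 + ζ.1 ^ 2) (-7 / 8) * f ζ ^ 2 := by
  have hpt : ∀ ξ ∈ A, (∫⁻ τ, bracketPow (τ + |ξ| * ξ) (-1) * f (ξ, τ) ^ 2) +
      (∫⁻ τ, bracketPow (τ + |ξ| * ξ) (-1) * f (ξ, τ)) ^ 2 ≤
      outConst * ∫⁻ τ, bracketPow (τ + ξ ^ 2) (-7 / 8) * f (ξ, τ) ^ 2 := by
    intro ξ hξ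
    rw [abs_of_pos (hA0 hξ), ← sq]
    have h1 : ∫⁻ τ, bracketPow (τ + ξ ^ 2) (-1) * f (ξ, τ) ^ 2 ≤
        1 * ∫⁻ τ, bracketPow (τ + ξ ^ 2) (-7 / 8) * f (ξ, τ) ^ 2 := by
      rw [one_mul]
      gcongr with τ
      exact bracketPow_mono _ (by norm_num)
    have h2 : (∫⁻ τ, bracketPow (τ + ξ ^ 2) (-1) * f (ξ, τ)) ^ 2 ≤
        (∫⁻ t, bracketPow t (-9 / 8)) * ∫⁻ τ, bracketPow (τ + ξ ^ 2) (-7 / 8) * f (ξ, τ) ^ 2 := by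
      calc _ = (∫⁻ τ, bracketPow (τ + ξ ^ 2) (-9 / 16) *
              (bracketPow (τ + ξ ^ 2) (-7 / 16) * f (ξ, τ))) ^ 2 := by
            congr 1
            refine lintegral_congr fun τ => ?_
            rw [← mul_assoc, bracketPow_mul]; norm_num
        _ ≤ _ := by
            refine (sq_lintegral_mul_le (by fun_prop) (by fun_prop)).trans (le_of_eq ?_)
            simp only [mul_pow, bracketPow_sq]
            norm_num only
            rw [lintegral_add_right_eq_self (fun τ => bracketPow τ (-(9 / 8)))]
    calc _ ≤ _ := add_le_add h1 h2
      _ ≤ _ := by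
        rw [← add_mul]
        gcongr
        unfold outConst
        gcongr
        exact le_self_add
  calc outNorm A f ≤ ∫⁻ ξ in A, outConst * ∫⁻ τ, bracketPow (τ + ξ ^ 2) (-7 / 8) * f (ξ, τ) ^ 2 :=
        setLIntegral_mono' hA hpt
    _ ≤ ∫⁻ ξ, outConst * ∫⁻ τ, bracketPow (τ + ξ ^ 2) (-7 / 8) * f (ξ, τ) ^ 2 :=
        setLIntegral_le_lintegral _ _
    _ = _ := by
      rw [lintegral_const_mul' _ _ outConst_ne_top, Measure.volume_eq_prod,
        lintegral_prod _ (by fun_prop)]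

/-! ### Dyadic decomposition of the symbols. -/

/-- The shell `2 ^ (k - 1) ≤ x ≤ 2 ^ (k + 2)`. -/
def dyadicShell (k : ℤ) : Set ℝ := Set.Icc (2 ^ (k - 1)) (2 ^ (k + 2))

lemma measurableSet_dyadicShell (k : ℤ) : MeasurableSet (dyadicShell k) := measurableSet_Icc

lemma zpow_two_lt_iff {m n : ℤ} : (2 : ℝ) ^ m < 2 ^ n ↔ m < n :=
  zpow_lt_zpow_iff_right₀ one_lt_two

lemma zpow_two_le_iff {m n : ℤ} : (2 : ℝ) ^ m ≤ 2 ^ n ↔ m ≤ n :=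
  zpow_le_zpow_iff_right₀ one_lt_two

lemma exists_zpow_two_le_lt {x : ℝ} (hx : 0 < x) : ∃ l : ℤ, (2 : ℝ) ^ l ≤ x ∧ x < 2 ^ (l + 1) :=
  ⟨Int.log 2 x, by exact_mod_cast Int.zpow_log_le_self one_lt_two hx,
    by exact_mod_cast Int.lt_zpow_succ_log_self one_lt_two x⟩

lemma tsum_indicator_dyadicShell_le (x : ℝ) (c : ℝ≥0∞) :
    ∑' k : ℤ, (dyadicShell k).indicator (fun _ => c) x ≤ 4 * c := by
  by_cases hx : 0 < x
  · obtain ⟨l, h1, h2⟩ := exists_zpow_two_le_lt hx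
    -- If 2^l ≤ x < 2^(l+1), only the four values k = l - 2, …, l + 1 can occur.
    rw [tsum_eq_sum (s := Finset.Icc (l - 2) (l + 1))]
    · refine (Finset.sum_le_card_nsmul _ _ c fun k _ => ?_).trans ?_
      · exact Set.indicator_apply_le' (fun _ => le_rfl) (fun _ => zero_le)
      · rw [Int.card_Icc, show (l + 1 + 1 - (l - 2)).toNat = 4 by omega, nsmul_eq_mul]
        norm_num
    · intro k hk
      refine Set.indicator_of_notMem (fun h => hk ?_) _
      have h3 := zpow_two_lt_iff.mp (h.1.trans_lt h2)
      have h4 := zpow_two_le_iff.mp (h1.trans h.2)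
      rw [Finset.mem_Icc]; omega
  · have : ∀ k : ℤ, (dyadicShell k).indicator (fun _ => c) x = 0 := fun k =>
      Set.indicator_of_notMem (fun h => hx (lt_of_lt_of_le (by positivity) h.1)) _
    simp [this]

variable {η : ℝ → ℝ}

lemma IsCutoff.eq_zero (hη : IsCutoff η) {x : ℝ} (hx : 2 < |x|) : η x = 0 := by
  by_contra h
  have := hη.support_subset (subset_tsupport _ h)
  exact absurd (abs_le.mpr this) (not_le.mpr hx)

lemma IsCutoff.eq_one_of_abs_le (hη : IsCutoff η) {x : ℝ} (hx : |x| ≤ 1) : η x = 1 :=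
  hη.eq_one x (abs_le.mp hx)

lemma IsCutoff.sub_eq_zero (hη : IsCutoff η) {x : ℝ} (hx : |x| ≤ 1 / 2 ∨ 2 < |x|) :
    η x - η (2 * x) = 0 := by
  rcases hx with h | h
  · rw [hη.eq_one_of_abs_le (by linarith), hη.eq_one_of_abs_le, sub_self]
    rw [abs_mul, abs_two]; linarith
  · rw [hη.eq_zero h, hη.eq_zero, sub_self]
    rw [abs_mul, abs_two]; linarith

lemma IsCutoff.abs_sub_le (hη : IsCutoff η) (x : ℝ) : |η x - η (2 * x)| ≤ 1 := by
  have h1 := hη.nonneg x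
  have h2 := hη.le_one x
  have h3 := hη.nonneg (2 * x)
  have h4 := hη.le_one (2 * x)
  rw [abs_le]; constructor <;> linarith

/-- The symbol of `P_- ∂_x P_N` (up to the factor `i N`), at the scale `N = 1`. -/
noncomputable def negBump (η : ℝ → ℝ) (x : ℝ) : ℂ :=
  if x < 0 then ((x * (η x - η (2 * x)) : ℝ) : ℂ) else 0

lemma IsCutoff.negBump_support (hη : IsCutoff η) {x : ℝ} (hx : negBump η x ≠ 0) :
    -2 ≤ x ∧ x ≤ -1 / 2 := by
  unfold negBump at hx
  split_ifs at hx with h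
  · by_contra hc
    refine hx ?_
    rw [hη.sub_eq_zero, mul_zero, Complex.ofReal_zero]
    rw [abs_of_neg h]
    by_cases h2 : -2 ≤ x
    · left; by_contra h3; exact hc ⟨h2, by linarith⟩
    · right; linarith
  · exact absurd rfl hx

lemma IsCutoff.norm_negBump_le (hη : IsCutoff η) (x : ℝ) : ‖negBump η x‖ ≤ |x| := by
  unfold negBump
  split_ifs with h
  · rw [Complex.norm_real, Real.norm_eq_abs, abs_mul]
    exact mul_le_of_le_one_right (abs_nonneg _) (hη.abs_sub_le x)
  · simp

/-- The sharp cutoff at 0 does no harm, since the annular factor already vanishes near 0. -/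
lemma IsCutoff.contDiff_negBump (hη : IsCutoff η) : ContDiff ℝ (⊤ : ℕ∞) (negBump η) := by
  rw [contDiff_iff_contDiffAt]
  intro x
  by_cases hx : x < 0
  · have h1 : ContDiff ℝ (⊤ : ℕ∞) fun x => ((x * (η x - η (2 * x)) : ℝ) : ℂ) := by
      have := hη.smooth
      have h2 : ContDiff ℝ (⊤ : ℕ∞) fun x => x * (η x - η (2 * x)) := by fun_prop
      exact Complex.ofRealCLM.contDiff.comp h2
    refine h1.contDiffAt.congr_of_eventuallyEq ?_
    filter_upwards [Iio_mem_nhds hx] with y hy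
    exact if_pos hy
  · have h0 : ContDiffAt ℝ (⊤ : ℕ∞) (fun _ : ℝ => (0 : ℂ)) x := contDiffAt_const
    refine h0.congr_of_eventuallyEq ?_
    filter_upwards [Ioi_mem_nhds (show (-1 / 2 : ℝ) < x by linarith)] with y hy
    by_contra h
    exact absurd (hη.negBump_support h).2 (not_le.mpr hy)

lemma IsCutoff.hasCompactSupport_negBump (hη : IsCutoff η) : HasCompactSupport (negBump η) := by
  refine HasCompactSupport.intro (isCompact_Icc (a := (-2 : ℝ)) (b := -1 / 2)) fun x hx => ?_
  by_contra h
  exact hx (hη.negBump_support h)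

/-- Each dyadic piece of P_-∂_x is thereby 2^k times convolution with a dilate of one fixed
integrable kernel, so its L⁴ cost is uniform in k. The sharp projection P_- alone has no integrable
kernel. -/
lemma IsCutoff.exists_fourier_eq_negBump (hη : IsCutoff η) :
    ∃ κ : SchwartzMap ℝ ℂ, ∀ x, 𝓕 (κ : ℝ → ℂ) x = negBump η x := by
  set φ := hη.hasCompactSupport_negBump.toSchwartzMap hη.contDiff_negBump with hφ
  refine ⟨𝓕⁻ φ, fun x => ?_⟩
  rw [← SchwartzMap.fourier_coe, FourierTransform.fourier_fourierInv_eq]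
  rfl

lemma zpow_inv_mul_bounds {k : ℤ} {x c d : ℝ} (h : c ≤ ((2 : ℝ) ^ k)⁻¹ * x ∧ ((2 : ℝ) ^ k)⁻¹ * x ≤ d) :
    c * 2 ^ k ≤ x ∧ x ≤ d * 2 ^ k := by
  have hk : (0 : ℝ) < 2 ^ k := by positivity
  rw [← div_eq_inv_mul, le_div_iff₀ hk, div_le_iff₀ hk] at h
  exact h

lemma IsCutoff.neg_mem_dyadicShell (hη : IsCutoff η) {k : ℤ} {x : ℝ}
    (h : negBump η (((2 : ℝ) ^ k)⁻¹ * x) ≠ 0) : (2 : ℝ) ^ (k - 1) ≤ -x ∧ -x ≤ 2 ^ (k + 1) := by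
  obtain ⟨h1, h2⟩ := zpow_inv_mul_bounds (hη.negBump_support h)
  rw [zpow_sub_one₀ two_ne_zero, zpow_add_one₀ two_ne_zero]
  constructor <;> linarith

/-- The dyadic decomposition of the symbol of `P_- ∂_x` (up to the factor `i`). -/
lemma IsCutoff.hasSum_negBump (hη : IsCutoff η) {ξ : ℝ} (hξ : ξ < 0) :
    HasSum (fun k : ℤ => (2 : ℂ) ^ k * negBump η (((2 : ℝ) ^ k)⁻¹ * ξ)) ξ := by
  obtain ⟨l, h1, h2⟩ := exists_zpow_two_le_lt (abs_pos.mpr hξ.ne)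
  set f : ℤ → ℝ := fun k => η (((2 : ℝ) ^ k)⁻¹ * ξ) with hf
  have habs : ∀ k : ℤ, |((2 : ℝ) ^ k)⁻¹ * ξ| = |ξ| / 2 ^ k := by
    intro k
    rw [abs_mul, abs_of_pos (by positivity), div_eq_inv_mul]
  have hf1 : ∀ k, l + 1 ≤ k → f k = 1 := by
    intro k hk
    refine hη.eq_one_of_abs_le ?_
    rw [habs, div_le_one (by positivity)]
    exact h2.le.trans (zpow_two_le_iff.mpr hk)
  have hf0 : ∀ k, k ≤ l - 2 → f k = 0 := by
    intro k hk
    refine hη.eq_zero ?_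
    rw [habs, lt_div_iff₀ (by positivity)]
    refine lt_of_lt_of_le ?_ h1
    calc (2 : ℝ) * 2 ^ k = 2 ^ (k + 1) := by rw [zpow_add_one₀ two_ne_zero, mul_comm]
      _ < 2 ^ l := zpow_two_lt_iff.mpr (by omega)
  have hterm : ∀ k : ℤ, (2 : ℂ) ^ k * negBump η (((2 : ℝ) ^ k)⁻¹ * ξ) =
      ((ξ * (f k - f (k - 1)) : ℝ) : ℂ) := by
    intro k
    have hk : (0 : ℝ) < 2 ^ k := by positivity
    have hneg : ((2 : ℝ) ^ k)⁻¹ * ξ < 0 := mul_neg_of_pos_of_neg (by positivity) hξ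
    have h3 : (2 : ℝ) * (((2 : ℝ) ^ k)⁻¹ * ξ) = ((2 : ℝ) ^ (k - 1))⁻¹ * ξ := by
      rw [zpow_sub_one₀ two_ne_zero]; field_simp
    unfold negBump
    rw [if_pos hneg, h3]
    have h4 : (2 : ℂ) ^ k = ((2 ^ k : ℝ) : ℂ) := by push_cast; rfl
    rw [h4, ← Complex.ofReal_mul]
    congr 1
    simp only [hf]
    field_simp
  simp only [hterm]
  have hsum : HasSum (fun k : ℤ => ξ * (f k - f (k - 1))) ξ := by
    -- The sum telescopes from f (l - 2) = 0 to f (l + 1) = 1.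
    have h5 : HasSum (fun k : ℤ => ξ * (f k - f (k - 1)))
        (∑ k ∈ {l - 1, l, l + 1}, ξ * (f k - f (k - 1))) :=
      hasSum_sum_of_ne_finset_zero (fun k hk => by
        simp only [Finset.mem_insert, Finset.mem_singleton, not_or] at hk
        rcases lt_or_ge k (l - 1) with h | h
        · rw [hf0 k (by omega), hf0 (k - 1) (by omega)]; ring
        · rw [hf1 k (by omega), hf1 (k - 1) (by omega)]; ring)
    convert h5 using 1
    rw [Finset.sum_insert (by simp; omega), Finset.sum_insert (by simp), Finset.sum_singleton,
      hf1 (l + 1) le_rfl, show l - 1 - 1 = l - 2 by ring, hf0 (l - 2) le_rfl,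
      show l + 1 - 1 = l by ring]
    ring
  exact Complex.hasSum_ofReal.mpr hsum

lemma negBump_of_nonneg {x : ℝ} (hx : 0 ≤ x) : negBump η x = 0 := if_neg (not_lt.mpr hx)

/-- The dyadic symbols telescope, and η(ξ/2^n) = 1 for large n. -/
lemma IsCutoff.hiSymbol_eq (hη : IsCutoff η) (ξ : ℝ) : hiSymbol η ξ = ((1 - η ξ : ℝ) : ℂ) := by
  set f : ℕ → ℝ := fun n => η (ξ / 2 ^ n) with hf
  obtain ⟨M, hM⟩ := pow_unbounded_of_one_lt |ξ| one_lt_two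
  have hf1 : ∀ n, M ≤ n → f n = 1 := by
    intro n hn
    refine hη.eq_one_of_abs_le ?_
    rw [abs_div, abs_of_pos (by positivity : (0 : ℝ) < 2 ^ n), div_le_one (by positivity)]
    exact hM.le.trans (pow_le_pow_right₀ one_le_two hn)
  have hterm : ∀ n, lpSymbol η (n + 1) ξ = ((f (n + 1) - f n : ℝ) : ℂ) := by
    intro n
    unfold lpSymbol
    simp only [hf]
    rw [show 2 * (ξ / 2 ^ (n + 1)) = ξ / 2 ^ n by rw [pow_succ]; field_simp]
  unfold hiSymbol
  rw [tsum_eq_sum (s := Finset.range M)]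
  · simp only [hterm]
    rw [← Complex.ofReal_sum, Finset.sum_range_sub, hf1 M le_rfl]
    simp [hf]
  · intro n hn
    rw [hterm, hf1 _ (by simp at hn; omega), hf1 _ (by simp at hn; omega)]
    simp

lemma IsCutoff.enorm_loSymbol_le (hη : IsCutoff η) (ξ : ℝ) : ‖loSymbol η ξ‖ₑ ≤ 1 := by
  have : loSymbol η ξ = ((η ξ : ℝ) : ℂ) := by
    rw [loSymbol, hη.hiSymbol_eq]; push_cast; ring
  rw [this, ← ofReal_norm, Complex.norm_real, Real.norm_of_nonneg (hη.nonneg ξ)]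
  simpa using hη.le_one ξ

/-- The symbol 1 - η vanishes on [-1, 1], so the output lives at ξ ≥ 1; this is why only dyadic
scales n ≥ 0 occur later. -/
lemma IsCutoff.enorm_posHiSymbol_le (hη : IsCutoff η) (ξ : ℝ) :
    ‖posHiSymbol η ξ‖ₑ ≤ (Set.Ici (1 : ℝ)).indicator (fun _ => 1) ξ := by
  unfold posHiSymbol posSymbol
  rw [hη.hiSymbol_eq]
  by_cases h : 1 ≤ ξ
  · rw [Set.indicator_of_mem (show ξ ∈ Set.Ici 1 from h),
      Set.indicator_of_mem (show ξ ∈ Set.Ioi 0 from by rw [Set.mem_Ioi]; linarith), Pi.one_apply,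
      one_mul, ← ofReal_norm, Complex.norm_real,
      Real.norm_of_nonneg (by linarith [hη.le_one ξ])]
    simpa using hη.nonneg ξ
  · rw [Set.indicator_of_notMem (show ξ ∉ Set.Ici 1 from h)]
    push Not at h
    by_cases h0 : 0 < ξ
    · rw [hη.eq_one_of_abs_le (by rw [abs_of_pos h0]; exact h.le)]; simp
    · rw [Set.indicator_of_notMem (show ξ ∉ Set.Ioi 0 from h0)]; simp

lemma IsCutoff.tsum_enorm_lpSymbol_sq_le (hη : IsCutoff η) (ξ : ℝ) :
    ∑' n : ℕ, ‖lpSymbol η n ξ‖ₑ ^ 2 ≤ 4 := by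
  calc ∑' n : ℕ, ‖lpSymbol η n ξ‖ₑ ^ 2
      ≤ ∑' n : ℕ, (dyadicShell (n : ℤ)).indicator (fun _ => (1 : ℝ≥0∞)) |ξ| := by
        refine ENNReal.tsum_le_tsum fun n => ?_
        unfold lpSymbol
        by_cases h : |ξ| ∈ dyadicShell (n : ℤ)
        · rw [Set.indicator_of_mem h, ← ofReal_norm, Complex.norm_real, Real.norm_eq_abs]
          refine pow_le_one' ?_ 2
          rw [← ENNReal.ofReal_one]
          exact ENNReal.ofReal_le_ofReal (hη.abs_sub_le _)
        · rw [hη.sub_eq_zero]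
          · simp
          · by_contra hc
            push Not at hc
            refine h ?_
            have h2 : (0 : ℝ) < 2 ^ n := by positivity
            rw [abs_div, abs_of_pos h2, lt_div_iff₀ h2, div_le_iff₀ h2] at hc
            unfold dyadicShell
            rw [Set.mem_Icc, zpow_sub_one₀ two_ne_zero, zpow_add₀ two_ne_zero, zpow_natCast]
            norm_num
            constructor <;> linarith
    _ ≤ ∑' k : ℤ, (dyadicShell k).indicator (fun _ => (1 : ℝ≥0∞)) |ξ| :=
        ENNReal.tsum_comp_le_tsum_of_injective Nat.cast_injective
          (fun k : ℤ => (dyadicShell k).indicator (fun _ => (1 : ℝ≥0∞)) |ξ|)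
    _ ≤ 4 := by simpa using tsum_indicator_dyadicShell_le |ξ| 1

/-! ### Resonance and localization in frequency and modulation. -/

/-- The modulation `σ = τ + |ξ| ξ`. -/
def modulation (z : ℝ × ℝ) : ℝ := z.2 + |z.1| * z.1

@[fun_prop]
lemma measurable_modulation : Measurable modulation := by unfold modulation; fun_prop

lemma modulation_of_pos {z : ℝ × ℝ} (hz : 0 < z.1) : modulation z = z.2 + z.1 ^ 2 := by
  rw [modulation, abs_of_pos hz, sq]

/-- With ξ, ξ₁ > 0 > ξ₂ the quadratic terms combine to σ = σ₁ + σ₂ - 2ξ|ξ₂|. If σ and σ₁ are below K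
≤ (2/3)ξ|ξ₂|, then σ₂ ≥ 2ξ|ξ₂| - 2K ≥ (2/3)ξ|ξ₂|. -/
lemma bracket_modulation_ge {ζ z : ℝ × ℝ} {K : ℝ} (h1 : 0 < ζ.1) (h2 : (ζ - z).1 < 0)
    (hK : 3 * K ≤ 2 * (ζ.1 * -(ζ - z).1)) (hζ : |modulation ζ| < K) (hz : |modulation z| < K) :
    ζ.1 * -(ζ - z).1 ≤ 2 * |modulation (ζ - z)| := by
  have h3 : 0 < z.1 := by rw [Prod.fst_sub] at h2; linarith
  have e : modulation ζ = modulation z + modulation (ζ - z) + 2 * (ζ.1 * (ζ - z).1) := by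
    rw [modulation_of_pos h1, modulation_of_pos h3, modulation, abs_of_neg h2]
    simp only [Prod.fst_sub, Prod.snd_sub]; ring
  rw [abs_lt] at hζ hz
  have := le_abs_self (modulation (ζ - z))
  nlinarith

/-- The part of `∂_x⁻¹ w` (up to the factor `i`) with space frequencies in a dyadic shell. -/
noncomputable def shellPart (F : ℝ × ℝ → ℂ) (m : ℤ) (z : ℝ × ℝ) : ℂ :=
  (dyadicShell m).indicator (fun ξ => (ξ : ℂ)⁻¹) z.1 * F z

/-- The part of `F` with modulation at least `K`. -/
noncomputable def highModulation (K : ℝ) (F : ℝ × ℝ → ℂ) : ℝ × ℝ → ℂ :=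
  {z | K ≤ |modulation z|}.indicator F

/-- The squared `X^{s,1/2}` norm of the part of `F` with space frequencies in a dyadic shell. -/
noncomputable def shellMass (F : ℝ × ℝ → ℂ) (s : ℝ) (m : ℤ) : ℝ≥0∞ :=
  ∫⁻ z, (dyadicShell m).indicator
    (fun _ => bracketPow (modulation z) 1 * bracketPow z.1 (2 * s) * ‖F z‖ₑ ^ 2) z.1

lemma measurable_shellPart {F : ℝ × ℝ → ℂ} (hF : Measurable F) (m : ℤ) :
    Measurable (shellPart F m) := by
  have h : Measurable ((dyadicShell m).indicator fun ξ : ℝ => (ξ : ℂ)⁻¹) :=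
    Measurable.indicator (by fun_prop) (measurableSet_dyadicShell m)
  exact (h.comp measurable_fst).mul hF

lemma measurable_highModulation {F : ℝ × ℝ → ℂ} (hF : Measurable F) (K : ℝ) :
    Measurable (highModulation K F) :=
  hF.indicator (measurableSet_le measurable_const (by fun_prop))

lemma norm_shellPart_le (F : ℝ × ℝ → ℂ) (m : ℤ) (z : ℝ × ℝ) :
    ‖shellPart F m z‖ ≤ (dyadicShell m).indicator (fun _ => ((2 : ℝ) ^ (m - 1))⁻¹ * ‖F z‖) z.1 := by
  unfold shellPart
  by_cases h : z.1 ∈ dyadicShell m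
  · have h1 : (0 : ℝ) < 2 ^ (m - 1) := by positivity
    have h2 : 0 < z.1 := h1.trans_le h.1
    rw [Set.indicator_of_mem h, Set.indicator_of_mem h, norm_mul, norm_inv, Complex.norm_real,
      Real.norm_of_nonneg h2.le]
    gcongr
    exact h.1
  · rw [Set.indicator_of_notMem h, Set.indicator_of_notMem h, zero_mul, norm_zero]

lemma memLp_shellPart {F : ℝ × ℝ → ℂ} (hF : Measurable F) (hF2 : MemLp F 2) (m : ℤ) :
    MemLp (shellPart F m) 2 :=
  hF2.of_le_mul (c := ((2 : ℝ) ^ (m - 1))⁻¹) (measurable_shellPart hF m).aestronglyMeasurable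
    (.of_forall fun z => (norm_shellPart_le F m z).trans
      (Set.indicator_apply_le' (fun _ => le_rfl) (fun _ => by positivity)))

lemma memLp_highModulation {F : ℝ × ℝ → ℂ} (hF2 : MemLp F 2) (K : ℝ) :
    MemLp (highModulation K F) 2 :=
  hF2.indicator (measurableSet_le measurable_const (by fun_prop))

lemma enorm_shellPart_sq_le (F : ℝ × ℝ → ℂ) (m : ℤ) (z : ℝ × ℝ) :
    ‖shellPart F m z‖ₑ ^ 2 ≤ ENNReal.ofReal (4 * 2 ^ (-(2 * m))) *
      (dyadicShell m).indicator (fun _ => ‖F z‖ₑ ^ 2) z.1 := by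
  have h := norm_shellPart_le F m z
  by_cases hz : z.1 ∈ dyadicShell m
  · rw [Set.indicator_of_mem hz] at h ⊢
    rw [← ofReal_norm, ← ofReal_norm, ← ENNReal.ofReal_pow (norm_nonneg _),
      ← ENNReal.ofReal_pow (norm_nonneg _), ← ENNReal.ofReal_mul (by positivity)]
    refine ENNReal.ofReal_le_ofReal ?_
    calc ‖shellPart F m z‖ ^ 2 ≤ (((2 : ℝ) ^ (m - 1))⁻¹ * ‖F z‖) ^ 2 := by gcongr
      _ = _ := by
        rw [mul_pow, zpow_sub_one₀ two_ne_zero, zpow_neg, two_mul m, zpow_add₀ two_ne_zero]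
        field_simp
        ring
  · rw [Set.indicator_of_notMem hz] at h ⊢
    rw [norm_le_zero_iff.mp h]; simp

lemma lintegral_weight_shellPart_le (F : ℝ × ℝ → ℂ) (m : ℤ) :
    ∫⁻ z, bracketPow (z.2 + z.1 ^ 2) (7 / 8) * ‖shellPart F m z‖ₑ ^ 2 ≤
      ENNReal.ofReal (4 * 2 ^ (-(2 * m))) * shellMass F 0 m := by
  unfold shellMass
  rw [← lintegral_const_mul' _ _ ENNReal.ofReal_ne_top]
  refine lintegral_mono fun z => ?_
  have h := enorm_shellPart_sq_le F m z
  by_cases hz : z.1 ∈ dyadicShell m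
  · have h2 : 0 < z.1 := lt_of_lt_of_le (by positivity) hz.1
    simp only [Set.indicator_of_mem hz] at h ⊢
    rw [modulation_of_pos h2, mul_zero, bracketPow_zero, mul_one, mul_left_comm]
    gcongr
    exact bracketPow_mono _ (by norm_num)
  · simp only [Set.indicator_of_notMem hz, mul_zero] at h ⊢
    rw [nonpos_iff_eq_zero.mp h, mul_zero]

/-- Chebyshev: where |σ₁| ≥ K, the weight ⟨σ₁⟩/K is at least 1, so the X^{0,1/2} norm pays for the
gain. -/
lemma lintegral_highModulation_shellPart_le (F : ℝ × ℝ → ℂ) (m : ℤ) {K : ℝ} (hK : 0 < K) :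
    ∫⁻ z, ‖highModulation K (shellPart F m) z‖ₑ ^ 2 ≤
      ENNReal.ofReal K⁻¹ * (ENNReal.ofReal (4 * 2 ^ (-(2 * m))) * shellMass F 0 m) := by
  unfold shellMass
  rw [← lintegral_const_mul' _ _ ENNReal.ofReal_ne_top,
    ← lintegral_const_mul' _ _ ENNReal.ofReal_ne_top]
  refine lintegral_mono fun z => ?_
  have h := enorm_shellPart_sq_le F m z
  unfold highModulation
  by_cases hz : z.1 ∈ dyadicShell m
  · simp only [Set.indicator_of_mem hz] at h ⊢
    by_cases hk : z ∈ {z | K ≤ |modulation z|}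
    · rw [Set.indicator_of_mem hk, mul_zero, bracketPow_zero, mul_one]
      have h1 : 1 ≤ ENNReal.ofReal K⁻¹ * bracketPow (modulation z) 1 := by
        unfold bracketPow
        rw [← ENNReal.ofReal_mul (by positivity), Real.rpow_one, ← ENNReal.ofReal_one]
        refine ENNReal.ofReal_le_ofReal ?_
        rw [← div_eq_inv_mul, one_le_div hK]
        have hk' : K ≤ |modulation z| := hk
        unfold bracket; linarith
      calc _ ≤ 1 * (ENNReal.ofReal (4 * 2 ^ (-(2 * m))) * ‖F z‖ₑ ^ 2) := by rwa [one_mul]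
        _ ≤ (ENNReal.ofReal K⁻¹ * bracketPow (modulation z) 1) *
            (ENNReal.ofReal (4 * 2 ^ (-(2 * m))) * ‖F z‖ₑ ^ 2) := by gcongr
        _ = _ := by ring
    · rw [Set.indicator_of_notMem hk]; simp
  · simp only [Set.indicator_of_notMem hz, mul_zero] at h ⊢
    refine le_trans ?_ h
    gcongr
    exact enorm_indicator_le_enorm_self _ _

/-- The frequency of w dominates the output frequency: 2^(n+1) ≤ 4 · 2^(m-1) ≤ 4ξ₁. As s ≥ 0, the
weight ⟨ξ⟩^s can be moved onto w. -/
lemma ofReal_rpow_mul_shellMass_le (F : ℝ × ℝ → ℂ) {s : ℝ} (hs : 0 ≤ s) {n m : ℤ} (hnm : n ≤ m) :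
    ENNReal.ofReal ((1 + 2 ^ (n + 1)) ^ (2 * s)) * shellMass F 0 m ≤
      ENNReal.ofReal (4 ^ (2 * s)) * shellMass F s m := by
  unfold shellMass
  rw [← lintegral_const_mul' _ _ ENNReal.ofReal_ne_top,
    ← lintegral_const_mul' _ _ ENNReal.ofReal_ne_top]
  refine lintegral_mono fun z => ?_
  by_cases hz : z.1 ∈ dyadicShell m
  · simp only [Set.indicator_of_mem hz]
    rw [mul_zero, bracketPow_zero, mul_one]
    have h1 : ENNReal.ofReal ((1 + 2 ^ (n + 1)) ^ (2 * s)) ≤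
        ENNReal.ofReal (4 ^ (2 * s)) * bracketPow z.1 (2 * s) := by
      unfold bracketPow
      rw [← ENNReal.ofReal_mul (by positivity), ← Real.mul_rpow (by norm_num) (bracket_pos _).le]
      refine ENNReal.ofReal_le_ofReal (Real.rpow_le_rpow (by positivity) ?_ (by linarith))
      have h2 : (2 : ℝ) ^ (n + 1) ≤ 2 ^ (m + 1) := zpow_two_le_iff.mpr (by omega)
      have h3 : (2 : ℝ) ^ (m + 1) = 4 * 2 ^ (m - 1) := by
        rw [zpow_add_one₀ two_ne_zero, zpow_sub_one₀ two_ne_zero]; ring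
      have h4 := hz.1
      unfold bracket
      linarith [le_abs_self z.1]
    calc _ ≤ (ENNReal.ofReal (4 ^ (2 * s)) * bracketPow z.1 (2 * s)) *
          (bracketPow (modulation z) 1 * ‖F z‖ₑ ^ 2) := by gcongr
      _ = _ := by ring
  · simp only [Set.indicator_of_notMem hz, mul_zero, le_refl]

lemma tsum_shellMass_le {F : ℝ × ℝ → ℂ} (hF : Measurable F) (s : ℝ) :
    ∑' m, shellMass F s m ≤
      4 * ∫⁻ z, bracketPow (modulation z) 1 * bracketPow z.1 (2 * s) * ‖F z‖ₑ ^ 2 := by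
  unfold shellMass
  rw [← lintegral_tsum, ← lintegral_const_mul' _ _ (by simp)]
  · exact lintegral_mono fun z => tsum_indicator_dyadicShell_le _ _
  · intro m
    have : Measurable fun z : ℝ × ℝ => bracketPow (modulation z) 1 * bracketPow z.1 (2 * s) *
      ‖F z‖ₑ ^ 2 := by fun_prop
    exact (this.indicator (measurable_fst (measurableSet_dyadicShell m))).aemeasurable

/-- The dyadic piece of `P_- ∂_x u` (up to the factor `i 2 ^ k`). -/
noncomputable def negPiece (κ : ℝ → ℂ) (u : L2xt) (k : ℤ) : ℝ × ℝ → ℂ :=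
  spaceMultiplier (dilatedSymbol κ ((2 : ℝ) ^ k)⁻¹) (spaceTimeFourier u)

lemma measurable_negPiece {κ : ℝ → ℂ} (hκ : Integrable κ) (u : L2xt) (k : ℤ) :
    Measurable (negPiece κ u k) :=
  measurable_spaceMultiplier (continuous_dilatedSymbol hκ _).measurable
    (measurable_spaceTimeFourier u)

lemma memLp_negPiece {κ : ℝ → ℂ} (hκ : Integrable κ) (u : L2xt) (k : ℤ) :
    MemLp (negPiece κ u k) 2 :=
  memLp_spaceMultiplier (continuous_dilatedSymbol hκ _).measurable
    (memLp_spaceTimeFourier u) (norm_dilatedSymbol_le κ _)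

/-- The threshold for the modulations. -/
noncomputable def threshold (n k : ℤ) : ℝ := 2 ^ (n + k) / 3

lemma threshold_pos (n k : ℤ) : 0 < threshold n k := by unfold threshold; positivity

/-- The part of a dyadic interaction in which the output or the first factor has large
modulation. -/
noncomputable def largePart (κ : ℝ → ℂ) (F : ℝ × ℝ → ℂ) (u : L2xt) (n k : ℤ) (ζ : ℝ × ℝ) : ℝ≥0∞ :=
  {ζ | threshold n k ≤ |modulation ζ|}.indicator
      (fun ζ => ‖∫ z, convIntegrand (shellPart F (max n k)) (negPiece κ u k) ζ z‖ₑ) ζ +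
    ‖∫ z, convIntegrand (highModulation (threshold n k) (shellPart F (max n k)))
      (negPiece κ u k) ζ z‖ₑ

lemma measurable_largePart {κ : ℝ → ℂ} (hκ : Integrable κ) {F : ℝ × ℝ → ℂ} (hF : Measurable F)
    (u : L2xt) (n k : ℤ) : Measurable (largePart κ F u n k) := by
  have hW := measurable_shellPart hF (max n k)
  have hP := measurable_negPiece hκ u k
  exact ((measurable_integral_convIntegrand hW hP).enorm.indicator
    (measurableSet_le measurable_const (by fun_prop))).add
    (measurable_integral_convIntegrand (measurable_highModulation hW _) hP).enorm

/-- The constant in `outNorm_largePart_le`. -/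
noncomputable def largeConst (κ : ℝ → ℂ) : ℝ≥0∞ :=
  4 * outConst * ((∫⁻ y, ‖κ y‖ₑ) ^ 2 * bilinearConst)

/-- Both pieces gain the same K⁻¹. For large output modulation the gain sits in `outNorm` and the
direct L⁴ estimate is applied; for large modulation of w it comes from Chebyshev and the dual L⁴
estimate is applied. The factor 2^{-2m} is the square of ∂_x⁻¹ at scale 2^m. -/
lemma outNorm_largePart_le {κ : ℝ → ℂ} (hκm : Measurable κ) (hκ : Integrable κ) {F : ℝ × ℝ → ℂ}
    (hF : Measurable F) (hF2 : MemLp F 2) (u : L2xt) {A : Set ℝ} (hA : MeasurableSet A)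
    (hA0 : A ⊆ Set.Ioi 0) (n k : ℤ) :
    outNorm A (largePart κ F u n k) ≤ largeConst κ * ENNReal.ofReal (threshold n k)⁻¹ *
      ENNReal.ofReal (4 * 2 ^ (-(2 * max n k))) * shellMass F 0 (max n k) *
        eLpNorm u 4 volume ^ 2 := by
  set m := max n k
  set K := threshold n k
  have hK : 0 < K := threshold_pos n k
  have hW := measurable_shellPart hF m
  have hW2 := memLp_shellPart hF hF2 m
  have hP := measurable_negPiece hκ u k
  have hS : MeasurableSet {ζ : ℝ × ℝ | K ≤ |modulation ζ|} :=
    measurableSet_le measurable_const (by fun_prop)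
  set f : ℝ × ℝ → ℝ≥0∞ := {ζ | K ≤ |modulation ζ|}.indicator
      (fun ζ => ‖∫ z, convIntegrand (shellPart F m) (negPiece κ u k) ζ z‖ₑ) with hf
  have hfm : Measurable f := (measurable_integral_convIntegrand hW hP).enorm.indicator hS
  set g : ℝ × ℝ → ℝ≥0∞ := fun ζ => ‖∫ z, convIntegrand (highModulation K (shellPart F m))
      (negPiece κ u k) ζ z‖ₑ with hg
  have hgm : Measurable g :=
    (measurable_integral_convIntegrand (measurable_highModulation hW _) hP).enorm
  set D := ENNReal.ofReal (4 * 2 ^ (-(2 * m))) * shellMass F 0 m with hD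
  set k1 := (∫⁻ y, ‖κ y‖ₑ) ^ 2
  set u4 := eLpNorm u 4 volume ^ 2
  have h1 : outNorm A f ≤ outConst * ENNReal.ofReal K⁻¹ * (k1 * (bilinearConst * D * u4)) := by
    refine (outNorm_le_of_large_modulation A hfm hK fun ζ hζ => ?_).trans ?_
    · rw [hf]
      refine Set.indicator_of_notMem ?_ _
      exact not_le.mpr hζ
    · gcongr
      calc ∫⁻ ζ, f ζ ^ 2
          ≤ ∫⁻ ζ, ‖∫ z, convIntegrand (shellPart F m) (negPiece κ u k) ζ z‖ₑ ^ 2 := by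
            gcongr with ζ
            exact Set.indicator_le_self _ _ ζ
        _ ≤ _ := lintegral_sq_conv_dilatedSymbol_le hW hW2 u hκm hκ _
        _ ≤ _ := by gcongr; exact lintegral_weight_shellPart_le F m
  have h2 : outNorm A g ≤ outConst * (k1 * bilinearConst * (ENNReal.ofReal K⁻¹ * D) * u4) := by
    refine (outNorm_le_weighted hA hA0 hgm).trans ?_
    gcongr
    refine (lintegral_weight_sq_conv_dilatedSymbol_le (measurable_highModulation hW K)
      (memLp_highModulation hW2 K) u hκm hκ _).trans ?_
    gcongr
    exact lintegral_highModulation_shellPart_le F m hK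
  calc outNorm A (largePart κ F u n k) ≤ 2 * (outNorm A f + outNorm A g) := outNorm_add_le A hfm
    _ ≤ 2 * (outConst * ENNReal.ofReal K⁻¹ * (k1 * (bilinearConst * D * u4)) +
        outConst * (k1 * bilinearConst * (ENNReal.ofReal K⁻¹ * D) * u4)) := by gcongr
    _ = _ := by rw [largeConst, hD]; ring

/-! ### Dyadic decomposition of the interaction. -/

lemma measurable_dxInvHat (w : L2xt) : Measurable (dxInvHat w) :=
  measurable_spaceMultiplier (by unfold dxInvSymbol; fun_prop) (measurable_spaceTimeFourier w)

lemma measurable_negDxHat (u : L2xt) : Measurable (negDxHat u) :=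
  measurable_spaceMultiplier (measurable_one.indicator measurableSet_Iio)
    (measurable_spaceMultiplier (by unfold dxSymbol; fun_prop) (measurable_spaceTimeFourier u))

lemma convIntegrand_dxInvHat_negDxHat (w u : L2xt) (ζ z : ℝ × ℝ) :
    convIntegrand (dxInvHat w) (negDxHat u) ζ z =
      ((z.1 : ℂ)⁻¹ * spaceTimeFourier w z) *
        ((Set.Iio (0 : ℝ)).indicator (fun ξ => (ξ : ℂ)) (ζ - z).1 * spaceTimeFourier u (ζ - z)) := by
  simp only [convIntegrand, dxInvHat, negDxHat, spaceMultiplier, dxInvSymbol, dxSymbol, negSymbol]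
  by_cases h : (ζ - z).1 ∈ Set.Iio (0 : ℝ)
  · rw [Set.indicator_of_mem h, Set.indicator_of_mem h, mul_inv, Complex.inv_I]
    simp only [Pi.one_apply]
    linear_combination (-((z.1 : ℂ)⁻¹ * spaceTimeFourier w z *
      (((ζ - z).1 : ℂ) * spaceTimeFourier u (ζ - z)))) * Complex.I_sq
  · rw [Set.indicator_of_notMem h, Set.indicator_of_notMem h]; simp

/-- Here ξ₁ = ξ + |ξ₂| is a sum of positive terms, ξ in [2^n, 2^(n+1)) and |ξ₂| in [2^(k-1),
2^(k+1)]. No cancellation is possible, and the bounds of the enlarged shell follow. -/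
lemma mem_dyadicShell_of_negBump_ne_zero (hη : IsCutoff η) {n k : ℤ} {ζ z : ℝ × ℝ}
    (hζ : ζ.1 ∈ Set.Ico ((2 : ℝ) ^ n) (2 ^ (n + 1)))
    (h : negBump η (((2 : ℝ) ^ k)⁻¹ * (ζ - z).1) ≠ 0) : z.1 ∈ dyadicShell (max n k) := by
  obtain ⟨h1, h2⟩ := hη.neg_mem_dyadicShell h
  rw [Prod.fst_sub] at h1 h2
  have hp1 : (0 : ℝ) < 2 ^ (k - 1) := by positivity
  have hp2 : (0 : ℝ) < 2 ^ n := by positivity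
  have e1 : (2 : ℝ) ^ (n + 1) ≤ 2 ^ (max n k + 1) := zpow_two_le_iff.mpr (by omega)
  have e2 : (2 : ℝ) ^ (k + 1) ≤ 2 ^ (max n k + 1) := zpow_two_le_iff.mpr (by omega)
  have e3 : (2 : ℝ) ^ (max n k + 2) = 2 * 2 ^ (max n k + 1) := by
    rw [show max n k + 2 = (max n k + 1) + 1 by ring, zpow_add_one₀ two_ne_zero]; ring
  refine ⟨?_, by rw [e3]; linarith [hζ.2]⟩
  rcases le_total n k with hnk | hnk
  · rw [max_eq_right hnk]; linarith [hζ.1]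
  · rw [max_eq_left hnk]
    have : (2 : ℝ) ^ (n - 1) ≤ 2 ^ n := zpow_two_le_iff.mpr (by omega)
    linarith [hζ.1]

/-- The decomposition of P_-∂_x u is inserted, and each piece of u automatically confines w to its
shell, so localizing w changes nothing. -/
lemma hasSum_convIntegrand (hη : IsCutoff η) {κ : ℝ → ℂ} (hκ : ∀ x, 𝓕 κ x = negBump η x)
    (w u : L2xt) {n : ℤ} {ζ : ℝ × ℝ} (hζ : ζ.1 ∈ Set.Ico ((2 : ℝ) ^ n) (2 ^ (n + 1)))
    (z : ℝ × ℝ) :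
    HasSum (fun k : ℤ => (2 : ℂ) ^ k *
      convIntegrand (shellPart (spaceTimeFourier w) (max n k)) (negPiece κ u k) ζ z)
      (convIntegrand (dxInvHat w) (negDxHat u) ζ z) := by
  rw [convIntegrand_dxInvHat_negDxHat]
  have hterm : ∀ k : ℤ, (2 : ℂ) ^ k *
      convIntegrand (shellPart (spaceTimeFourier w) (max n k)) (negPiece κ u k) ζ z =
      ((z.1 : ℂ)⁻¹ * spaceTimeFourier w z) *
        (((2 : ℂ) ^ k * negBump η (((2 : ℝ) ^ k)⁻¹ * (ζ - z).1)) *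
          spaceTimeFourier u (ζ - z)) := by
    intro k
    simp only [convIntegrand, negPiece, spaceMultiplier, dilatedSymbol, hκ]
    by_cases h : negBump η (((2 : ℝ) ^ k)⁻¹ * (ζ - z).1) = 0
    · rw [h]; ring
    · rw [shellPart, Set.indicator_of_mem (mem_dyadicShell_of_negBump_ne_zero hη hζ h)]; ring
  simp only [hterm]
  refine HasSum.mul_left _ (HasSum.mul_right _ ?_)
  by_cases h : (ζ - z).1 ∈ Set.Iio (0 : ℝ)
  · rw [Set.indicator_of_mem h]
    exact hη.hasSum_negBump h
  · rw [Set.indicator_of_notMem h]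
    have : ∀ k : ℤ, (2 : ℂ) ^ k * negBump η (((2 : ℝ) ^ k)⁻¹ * (ζ - z).1) = 0 := fun k => by
      rw [negBump_of_nonneg, mul_zero]
      exact mul_nonneg (by positivity) (not_lt.mp h)
    simp only [this]
    exact hasSum_zero

lemma norm_two_zpow (k : ℤ) : ‖(2 : ℂ) ^ k‖ₑ = ENNReal.ofReal (2 ^ k) := by
  rw [← ofReal_norm, norm_zpow, Complex.norm_two]

lemma enorm_negPiece_le (hη : IsCutoff η) {κ : ℝ → ℂ} (hκ : ∀ x, 𝓕 κ x = negBump η x) (u : L2xt)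
    (k : ℤ) (z : ℝ × ℝ) :
    ENNReal.ofReal (2 ^ k) * ‖negPiece κ u k z‖ₑ ≤ (dyadicShell k).indicator
      (fun _ => (Set.Iio (0 : ℝ)).indicator (fun ξ => ENNReal.ofReal (-ξ)) z.1 *
        ‖spaceTimeFourier u z‖ₑ) (-z.1) := by
  have h2k : (0 : ℝ) < 2 ^ k := by positivity
  simp only [negPiece, spaceMultiplier, dilatedSymbol, hκ]
  by_cases h : negBump η (((2 : ℝ) ^ k)⁻¹ * z.1) = 0
  · rw [h]; simp
  · obtain ⟨h1, h2⟩ := hη.neg_mem_dyadicShell h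
    have hneg : z.1 < 0 := by
      have : (0 : ℝ) < 2 ^ (k - 1) := by positivity
      linarith
    rw [Set.indicator_of_mem (show -z.1 ∈ dyadicShell k from
        ⟨h1, h2.trans (zpow_two_le_iff.mpr (by omega))⟩), Set.indicator_of_mem
        (show z.1 ∈ Set.Iio 0 from hneg), enorm_mul, ← mul_assoc]
    gcongr
    rw [← ofReal_norm, ← ENNReal.ofReal_mul h2k.le]
    refine ENNReal.ofReal_le_ofReal ?_
    calc (2 : ℝ) ^ k * ‖negBump η (((2 : ℝ) ^ k)⁻¹ * z.1)‖
        ≤ 2 ^ k * |((2 : ℝ) ^ k)⁻¹ * z.1| := by gcongr; exact hη.norm_negBump_le _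
      _ = -z.1 := by
        rw [abs_mul, abs_of_pos (inv_pos.mpr h2k), abs_of_neg hneg, ← mul_assoc,
          mul_inv_cancel₀ h2k.ne', one_mul]

lemma enorm_shellPart_le (F : ℝ × ℝ → ℂ) (m : ℤ) (z : ℝ × ℝ) :
    ‖shellPart F m z‖ₑ ≤ ‖(z.1 : ℂ)⁻¹ * F z‖ₑ := by
  rw [shellPart, enorm_mul, enorm_mul]
  gcongr
  exact enorm_indicator_le_enorm_self (fun ξ : ℝ => (ξ : ℂ)⁻¹) z.1

/-- The bounded overlap of the shells gives absolute summability dominated by the full integrand;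
this justifies exchanging the sum over k with the convolution integral. -/
lemma tsum_enorm_convIntegrand_le (hη : IsCutoff η) {κ : ℝ → ℂ}
    (hκ : ∀ x, 𝓕 κ x = negBump η x) (w u : L2xt) (n : ℤ) (ζ z : ℝ × ℝ) :
    ∑' k : ℤ, ‖(2 : ℂ) ^ k * convIntegrand (shellPart (spaceTimeFourier w) (max n k))
      (negPiece κ u k) ζ z‖ₑ ≤ 4 * ‖convIntegrand (dxInvHat w) (negDxHat u) ζ z‖ₑ := by
  refine le_trans (ENNReal.tsum_le_tsum fun k => ?_)
    (tsum_indicator_dyadicShell_le (-(ζ - z).1) ‖convIntegrand (dxInvHat w) (negDxHat u) ζ z‖ₑ)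
  rw [convIntegrand_dxInvHat_negDxHat, enorm_mul, norm_two_zpow, convIntegrand, enorm_mul]
  have h1 := enorm_shellPart_le (spaceTimeFourier w) (max n k) z
  have h2 := enorm_negPiece_le hη hκ u k (ζ - z)
  have h3 : (Set.Iio (0 : ℝ)).indicator (fun ξ => ENNReal.ofReal (-ξ)) (ζ - z).1 =
      ‖(Set.Iio (0 : ℝ)).indicator (fun ξ => (ξ : ℂ)) (ζ - z).1‖ₑ := by
    by_cases h : (ζ - z).1 ∈ Set.Iio (0 : ℝ)
    · rw [Set.indicator_of_mem h, Set.indicator_of_mem h, ← ofReal_norm, Complex.norm_real,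
        Real.norm_of_nonpos (le_of_lt h)]
    · rw [Set.indicator_of_notMem h, Set.indicator_of_notMem h, enorm_zero]
  rw [h3] at h2
  by_cases h : -(ζ - z).1 ∈ dyadicShell k
  · rw [Set.indicator_of_mem h] at h2 ⊢
    calc _ = ‖shellPart (spaceTimeFourier w) (max n k) z‖ₑ *
          (ENNReal.ofReal (2 ^ k) * ‖negPiece κ u k (ζ - z)‖ₑ) := by ring
      _ ≤ _ := by
        rw [enorm_mul (_ * _) (_ * _), enorm_mul (Set.indicator _ _ _)]
        gcongr
  · rw [Set.indicator_of_notMem h] at h2 ⊢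
    calc _ = ‖shellPart (spaceTimeFourier w) (max n k) z‖ₑ *
          (ENNReal.ofReal (2 ^ k) * ‖negPiece κ u k (ζ - z)‖ₑ) := by ring
      _ ≤ ‖shellPart (spaceTimeFourier w) (max n k) z‖ₑ * 0 := by gcongr
      _ = 0 := mul_zero _

lemma enorm_integral_convIntegrand_le_tsum (hη : IsCutoff η) {κ : ℝ → ℂ} (hκi : Integrable κ)
    (hκ : ∀ x, 𝓕 κ x = negBump η x) (w u : L2xt) {n : ℤ} {ζ : ℝ × ℝ}
    (hζ : ζ.1 ∈ Set.Ico ((2 : ℝ) ^ n) (2 ^ (n + 1)))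
    (hint : Integrable (convIntegrand (dxInvHat w) (negDxHat u) ζ)) :
    ‖∫ z, convIntegrand (dxInvHat w) (negDxHat u) ζ z‖ₑ ≤ ∑' k : ℤ, ENNReal.ofReal (2 ^ k) *
      ‖∫ z, convIntegrand (shellPart (spaceTimeFourier w) (max n k)) (negPiece κ u k) ζ z‖ₑ := by
  set c : ℤ → ℝ × ℝ → ℂ := fun k z => (2 : ℂ) ^ k *
    convIntegrand (shellPart (spaceTimeFourier w) (max n k)) (negPiece κ u k) ζ z with hc
  have hcm : ∀ k, Measurable (c k) := fun k => by
    have h := measurable_uncurry_convIntegrand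
      (measurable_shellPart (measurable_spaceTimeFourier w) (max n k)) (measurable_negPiece hκi u k)
    exact (h.comp measurable_prodMk_left).const_mul _
  have h1 : ∫ z, convIntegrand (dxInvHat w) (negDxHat u) ζ z = ∫ z, ∑' k, c k z :=
    integral_congr_ae (.of_forall fun z => (hasSum_convIntegrand hη hκ w u hζ z).tsum_eq.symm)
  have h2 : ∑' k, ∫⁻ z, ‖c k z‖ₑ ≠ ∞ := by
    rw [← lintegral_tsum fun k => (hcm k).enorm.aemeasurable]
    refine ne_top_of_le_ne_top
      (b := 4 * ∫⁻ z, ‖convIntegrand (dxInvHat w) (negDxHat u) ζ z‖ₑ)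
      (ENNReal.mul_ne_top (by simp) hint.2.ne) ?_
    rw [← lintegral_const_mul' _ _ (by simp)]
    exact lintegral_mono fun z => tsum_enorm_convIntegrand_le hη hκ w u n ζ z
  rw [h1, integral_tsum (fun k => (hcm k).aestronglyMeasurable) h2]
  refine enorm_tsum_le_tsum_enorm.trans (le_of_eq (tsum_congr fun k => ?_))
  simp only [hc]
  rw [integral_const_mul, enorm_mul, norm_two_zpow]

/-! ### Interactions in which u carries the large modulation. -/

/-- The first factor in the interactions in which `u` has the large modulation. -/
noncomputable def posWeighted (s : ℝ) (w : L2xt) (z : ℝ × ℝ) : ℝ≥0∞ :=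
  (Set.Ioi (0 : ℝ)).indicator (fun _ => bracketPow z.1 s * ‖spaceTimeFourier w z‖ₑ) z.1

/-- The second factor in the interactions in which `u` has the large modulation. -/
noncomputable def negWeighted (u : L2xt) (z : ℝ × ℝ) : ℝ≥0∞ :=
  (Set.Iio (0 : ℝ)).indicator
    (fun _ => bracketPow (modulation z) 1 * bracketPow z.1 (-1) * ‖spaceTimeFourier u z‖ₑ) z.1

lemma measurable_posWeighted (s : ℝ) (w : L2xt) : Measurable (posWeighted s w) := by
  have h := measurable_spaceTimeFourier w
  have h1 : Measurable fun z : ℝ × ℝ => bracketPow z.1 s * ‖spaceTimeFourier w z‖ₑ := by fun_prop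
  exact h1.indicator (measurable_fst measurableSet_Ioi)

lemma measurable_negWeighted (u : L2xt) : Measurable (negWeighted u) := by
  have h := measurable_spaceTimeFourier u
  have h1 : Measurable fun z : ℝ × ℝ =>
    bracketPow (modulation z) 1 * bracketPow z.1 (-1) * ‖spaceTimeFourier u z‖ₑ := by fun_prop
  exact h1.indicator (measurable_fst measurableSet_Iio)

/-- With σ and σ₁ below the threshold, resonance gives ξ|ξ₂| ≤ 2|σ₂|. Since ξ ≥ 1, also ξ₁ = ξ +
|ξ₂| ≥ ⟨ξ₂⟩. Hence ξ|ξ₂|/ξ₁ ≤ 2⟨σ₂⟩/⟨ξ₂⟩, which is the X^{-1,1} weight, while ⟨ξ⟩^s ≤ ⟨ξ₁⟩^s. -/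
lemma small_modulation_term_le (hη : IsCutoff η) {κ : ℝ → ℂ} (hκ : ∀ x, 𝓕 κ x = negBump η x)
    {s : ℝ} (hs : 0 ≤ s) (w u : L2xt) {n : ℤ} (hn : 0 ≤ n) (k : ℤ) {ζ : ℝ × ℝ}
    (hζ : ζ.1 ∈ Set.Ico ((2 : ℝ) ^ n) (2 ^ (n + 1)))
    (hσ : |modulation ζ| < threshold n k) (z : ℝ × ℝ) :
    bracketPow ζ.1 s * ENNReal.ofReal ζ.1 * (ENNReal.ofReal (2 ^ k) *
      ‖convIntegrand (shellPart (spaceTimeFourier w) (max n k) -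
        highModulation (threshold n k) (shellPart (spaceTimeFourier w) (max n k)))
        (negPiece κ u k) ζ z‖ₑ) ≤
      (dyadicShell k).indicator (fun _ => 2 * (posWeighted s w z * negWeighted u (ζ - z)))
        (-(ζ - z).1) := by
  set W := shellPart (spaceTimeFourier w) (max n k) with hW
  set K := threshold n k with hK
  have hζ0 : 0 < ζ.1 := lt_of_lt_of_le (by positivity) hζ.1
  have hζ1 : 1 ≤ ζ.1 := le_trans (one_le_zpow₀ one_le_two hn) hζ.1
  by_cases hP : negBump η (((2 : ℝ) ^ k)⁻¹ * (ζ - z).1) = 0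
  · have : negPiece κ u k (ζ - z) = 0 := by
      simp only [negPiece, spaceMultiplier, dilatedSymbol, hκ, hP, zero_mul]
    simp [convIntegrand, this]
  obtain ⟨hk1, hk2⟩ := hη.neg_mem_dyadicShell hP
  have hneg : (ζ - z).1 < 0 := by
    have : (0 : ℝ) < 2 ^ (k - 1) := by positivity
    linarith
  have hshell : -(ζ - z).1 ∈ dyadicShell k := ⟨hk1, hk2.trans (zpow_two_le_iff.mpr (by omega))⟩
  rw [Set.indicator_of_mem hshell]
  by_cases hz : K ≤ |modulation z|
  · have : (W - highModulation K W) z = 0 := by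
      rw [Pi.sub_apply, highModulation, Set.indicator_of_mem (show z ∈ {z | K ≤ |modulation z|}
        from hz), sub_self]
    simp [convIntegrand, this]
  have hWz : (W - highModulation K W) z = W z := by
    rw [Pi.sub_apply, highModulation, Set.indicator_of_notMem (show z ∉ {z | K ≤ |modulation z|}
        from hz), sub_zero]
  push Not at hz
  have hzeq : z.1 = ζ.1 + -(ζ - z).1 := by rw [Prod.fst_sub]; ring
  have hz0 : 0 < z.1 := by linarith
  have hprod : 3 * K ≤ 2 * (ζ.1 * -(ζ - z).1) := by
    -- The resonance function satisfies 2ξ|ξ₂| ≥ 2 · 2^n · 2^(k-1) = 2^(n+k), which is three times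
    -- the threshold: one third for each modulation.
    have : 2 * ((2 : ℝ) ^ n * 2 ^ (k - 1)) = 3 * K := by
      rw [hK, threshold, zpow_sub_one₀ two_ne_zero, zpow_add₀ two_ne_zero]; ring
    rw [← this]
    gcongr
    exact hζ.1
  have hres := bracket_modulation_ge hζ0 hneg hprod hσ hz
  have hP2 := enorm_negPiece_le hη hκ u k (ζ - z)
  rw [Set.indicator_of_mem hshell, Set.indicator_of_mem (show (ζ - z).1 ∈ Set.Iio 0 from hneg)]
    at hP2
  have hW2 : ‖W z‖ₑ ≤ ENNReal.ofReal z.1⁻¹ * ‖spaceTimeFourier w z‖ₑ := by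
    refine (enorm_shellPart_le _ _ z).trans (le_of_eq ?_)
    rw [enorm_mul, ← ofReal_norm (z.1 : ℂ)⁻¹, norm_inv, Complex.norm_real,
      Real.norm_of_nonneg hz0.le]
  have hs1 : bracketPow ζ.1 s ≤ bracketPow z.1 s := by
    refine ENNReal.ofReal_le_ofReal (Real.rpow_le_rpow (bracket_pos _).le ?_ hs)
    unfold bracket
    rw [abs_of_pos hζ0, abs_of_pos hz0]; linarith
  have hfreq : ENNReal.ofReal ζ.1 * ENNReal.ofReal (-(ζ - z).1) * ENNReal.ofReal z.1⁻¹ ≤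
      2 * (bracketPow (modulation (ζ - z)) 1 * bracketPow (ζ - z).1 (-1)) := by
    unfold bracketPow
    rw [← ENNReal.ofReal_mul hζ0.le, ← ENNReal.ofReal_mul (mul_nonneg hζ0.le (by linarith)),
      ← ENNReal.ofReal_mul (Real.rpow_nonneg (bracket_pos _).le _),
      show (2 : ℝ≥0∞) = ENNReal.ofReal 2 by simp, ← ENNReal.ofReal_mul (by norm_num)]
    refine ENNReal.ofReal_le_ofReal ?_
    rw [Real.rpow_one, Real.rpow_neg_one, ← mul_assoc]
    refine mul_le_mul ?_ ?_ (by positivity) ?_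
    · refine hres.trans ?_
      unfold bracket; linarith
    · refine inv_anti₀ (bracket_pos _) ?_
      unfold bracket
      rw [abs_of_neg hneg]; linarith
    · have := bracket_pos (modulation (ζ - z)); positivity
  rw [posWeighted, negWeighted, Set.indicator_of_mem (show z.1 ∈ Set.Ioi 0 from hz0),
    Set.indicator_of_mem (show (ζ - z).1 ∈ Set.Iio 0 from hneg), convIntegrand, hWz, enorm_mul]
  calc bracketPow ζ.1 s * ENNReal.ofReal ζ.1 *
        (ENNReal.ofReal (2 ^ k) * (‖W z‖ₑ * ‖negPiece κ u k (ζ - z)‖ₑ))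
      = bracketPow ζ.1 s * ENNReal.ofReal ζ.1 * ‖W z‖ₑ *
        (ENNReal.ofReal (2 ^ k) * ‖negPiece κ u k (ζ - z)‖ₑ) := by ring
    _ ≤ bracketPow z.1 s * ENNReal.ofReal ζ.1 *
        (ENNReal.ofReal z.1⁻¹ * ‖spaceTimeFourier w z‖ₑ) *
        (ENNReal.ofReal (-(ζ - z).1) * ‖spaceTimeFourier u (ζ - z)‖ₑ) := by gcongr
    _ = bracketPow z.1 s * ‖spaceTimeFourier w z‖ₑ * ‖spaceTimeFourier u (ζ - z)‖ₑ *
        (ENNReal.ofReal ζ.1 * ENNReal.ofReal (-(ζ - z).1) * ENNReal.ofReal z.1⁻¹) := by ring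
    _ ≤ bracketPow z.1 s * ‖spaceTimeFourier w z‖ₑ * ‖spaceTimeFourier u (ζ - z)‖ₑ *
        (2 * (bracketPow (modulation (ζ - z)) 1 * bracketPow (ζ - z).1 (-1))) := by gcongr
    _ = _ := by ring

/-- The part of a dyadic interaction in which only the second factor has large modulation. -/
noncomputable def smallPart (κ : ℝ → ℂ) (F : ℝ × ℝ → ℂ) (u : L2xt) (n k : ℤ) (ζ : ℝ × ℝ) : ℝ≥0∞ :=
  if |modulation ζ| < threshold n k then
    ∫⁻ z, ‖convIntegrand (shellPart F (max n k) -
      highModulation (threshold n k) (shellPart F (max n k))) (negPiece κ u k) ζ z‖ₑ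
  else 0

lemma enorm_integral_convIntegrand_le_add {κ : ℝ → ℂ} (hκi : Integrable κ) {F : ℝ × ℝ → ℂ}
    (hFm : Measurable F) (hF2 : MemLp F 2) (u : L2xt) (n k : ℤ) (ζ : ℝ × ℝ) :
    ‖∫ z, convIntegrand (shellPart F (max n k)) (negPiece κ u k) ζ z‖ₑ ≤
      largePart κ F u n k ζ + smallPart κ F u n k ζ := by
  unfold smallPart
  split_ifs with hk
  · have hW2 := memLp_shellPart hFm hF2 (max n k)
    have hV2 := memLp_highModulation hW2 (threshold n k)
    have hP2 := memLp_negPiece hκi u k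
    have e : ∫ z, convIntegrand (shellPart F (max n k)) (negPiece κ u k) ζ z =
        (∫ z, convIntegrand (highModulation (threshold n k) (shellPart F (max n k)))
          (negPiece κ u k) ζ z) + ∫ z, convIntegrand (shellPart F (max n k) -
            highModulation (threshold n k) (shellPart F (max n k))) (negPiece κ u k) ζ z := by
      rw [← integral_add (integrable_convIntegrand hV2 hP2 ζ)
        (integrable_convIntegrand (hW2.sub hV2) hP2 ζ)]
      refine integral_congr_ae (.of_forall fun z => ?_)
      simp only [convIntegrand, Pi.sub_apply]
      ring
    rw [e]
    exact (enorm_add_le _ _).trans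
      (add_le_add le_add_self (enorm_integral_le_lintegral_enorm _))
  · rw [add_zero, largePart, Set.indicator_of_mem
      (show ζ ∈ {ζ | threshold n k ≤ |modulation ζ|} from not_lt.mp hk)]
    exact le_self_add

/-- The bound on each term depends on k only through the shell indicator, so summation costs just
the overlap 4 and 8 = 4 · 2. No decay in k is needed. -/
lemma tsum_smallPart_le (hη : IsCutoff η) {κ : ℝ → ℂ} (hκ : ∀ x, 𝓕 κ x = negBump η x) {s : ℝ}
    (hs : 0 ≤ s) (w u : L2xt) {n : ℤ} (hn : 0 ≤ n) {ζ : ℝ × ℝ}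
    (hζ : ζ.1 ∈ Set.Ico ((2 : ℝ) ^ n) (2 ^ (n + 1))) :
    ∑' k : ℤ, bracketPow ζ.1 s * ENNReal.ofReal ζ.1 *
      (ENNReal.ofReal (2 ^ k) * smallPart κ (spaceTimeFourier w) u n k ζ) ≤
      8 * ∫⁻ z, posWeighted s w z * negWeighted u (ζ - z) := by
  have hbt : bracketPow ζ.1 s * ENNReal.ofReal ζ.1 ≠ ∞ :=
    ENNReal.mul_ne_top (bracketPow_ne_top _ _) ENNReal.ofReal_ne_top
  have hpn : Measurable fun z => 2 * (posWeighted s w z * negWeighted u (ζ - z)) := by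
    have h1 := measurable_posWeighted s w
    have h2 := measurable_negWeighted u
    fun_prop
  calc _ ≤ ∑' k : ℤ, ∫⁻ z, (dyadicShell k).indicator
          (fun _ => 2 * (posWeighted s w z * negWeighted u (ζ - z))) (-(ζ - z).1) := by
        refine ENNReal.tsum_le_tsum fun k => ?_
        unfold smallPart
        split_ifs with hk
        · rw [← lintegral_const_mul' _ _ ENNReal.ofReal_ne_top, ← lintegral_const_mul' _ _ hbt]
          exact lintegral_mono fun z => small_modulation_term_le hη hκ hs w u hn k hζ hk z
        · simp
    _ = ∫⁻ z, ∑' k : ℤ, (dyadicShell k).indicator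
          (fun _ => 2 * (posWeighted s w z * negWeighted u (ζ - z))) (-(ζ - z).1) := by
        rw [lintegral_tsum]
        intro k
        exact (hpn.indicator ((by fun_prop : Measurable fun z : ℝ × ℝ => -(ζ - z).1)
          (measurableSet_dyadicShell k))).aemeasurable
    _ ≤ ∫⁻ z, 8 * (posWeighted s w z * negWeighted u (ζ - z)) := by
        refine lintegral_mono fun z => ?_
        refine (tsum_indicator_dyadicShell_le _ _).trans (le_of_eq ?_)
        rw [← mul_assoc]; norm_num
    _ = _ := lintegral_const_mul' _ _ (by simp)

lemma bracketPow_mul_ofReal_le {s : ℝ} (hs : 0 ≤ s) {n : ℤ} {ξ : ℝ}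
    (hξ : ξ ∈ Set.Ico ((2 : ℝ) ^ n) (2 ^ (n + 1))) (k : ℤ) :
    bracketPow ξ s * ENNReal.ofReal ξ * ENNReal.ofReal (2 ^ k) ≤
      ENNReal.ofReal ((1 + 2 ^ (n + 1)) ^ s * 2 ^ (n + 1 + k)) := by
  have hξ0 : 0 < ξ := lt_of_lt_of_le (by positivity) hξ.1
  rw [bracketPow, ← ENNReal.ofReal_mul (Real.rpow_nonneg (bracket_pos _).le _),
    ← ENNReal.ofReal_mul (mul_nonneg (Real.rpow_nonneg (bracket_pos _).le _) hξ0.le)]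
  refine ENNReal.ofReal_le_ofReal ?_
  rw [zpow_add₀ two_ne_zero (n + 1) k, ← mul_assoc]
  have h1 : bracket ξ ≤ 1 + 2 ^ (n + 1) := by
    unfold bracket
    rw [abs_of_pos hξ0]; linarith [hξ.2]
  have h2 := bracket_pos ξ
  have h3 := hξ.2.le
  gcongr

/-- The pointwise decomposition of the nonlinear interaction at a frequency `ξ ∼ 2 ^ n`. -/
lemma pointwise_bound (hη : IsCutoff η) {κ : ℝ → ℂ} (hκi : Integrable κ)
    (hκ : ∀ x, 𝓕 κ x = negBump η x) {s : ℝ} (hs : 0 ≤ s) (w u : L2xt) {n : ℤ} (hn : 0 ≤ n)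
    {ζ : ℝ × ℝ} (hζ : ζ.1 ∈ Set.Ico ((2 : ℝ) ^ n) (2 ^ (n + 1)))
    (hint : Integrable (convIntegrand (dxInvHat w) (negDxHat u) ζ)) :
    bracketPow ζ.1 s * (ENNReal.ofReal ζ.1 *
      ‖∫ z, convIntegrand (dxInvHat w) (negDxHat u) ζ z‖ₑ) ≤
      (∑' k : ℤ, ENNReal.ofReal ((1 + 2 ^ (n + 1)) ^ s * 2 ^ (n + 1 + k)) *
        largePart κ (spaceTimeFourier w) u n k ζ) +
      8 * ∫⁻ z, posWeighted s w z * negWeighted u (ζ - z) := by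
  have hT := enorm_integral_convIntegrand_le_add hκi (measurable_spaceTimeFourier w)
    (memLp_spaceTimeFourier w) u n
  rw [← mul_assoc]
  calc bracketPow ζ.1 s * ENNReal.ofReal ζ.1 *
        ‖∫ z, convIntegrand (dxInvHat w) (negDxHat u) ζ z‖ₑ
      ≤ bracketPow ζ.1 s * ENNReal.ofReal ζ.1 * ∑' k : ℤ, ENNReal.ofReal (2 ^ k) *
          (largePart κ (spaceTimeFourier w) u n k ζ +
            smallPart κ (spaceTimeFourier w) u n k ζ) := by
        gcongr
        refine (enorm_integral_convIntegrand_le_tsum hη hκi hκ w u hζ hint).trans ?_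
        exact ENNReal.tsum_le_tsum fun k => mul_le_mul_right (hT k ζ) _
    _ = (∑' k : ℤ, bracketPow ζ.1 s * ENNReal.ofReal ζ.1 * ENNReal.ofReal (2 ^ k) *
          largePart κ (spaceTimeFourier w) u n k ζ) +
        ∑' k : ℤ, bracketPow ζ.1 s * ENNReal.ofReal ζ.1 *
          (ENNReal.ofReal (2 ^ k) * smallPart κ (spaceTimeFourier w) u n k ζ) := by
        rw [← ENNReal.tsum_mul_left, ← ENNReal.tsum_add]
        refine tsum_congr fun k => ?_
        ring
    _ ≤ _ := add_le_add
        (ENNReal.tsum_le_tsum fun k => mul_le_mul_left (bracketPow_mul_ofReal_le hs hζ k) _)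
        (tsum_smallPart_le hη hκ hs w u hn hζ)

/-! ### Summation over dyadic scales. -/

/-- The two-sided geometric series `∑ r ^ |j|`. -/
noncomputable def geomSum (r : ℝ) : ℝ≥0∞ := ∑' j : ℤ, ENNReal.ofReal (r ^ j.natAbs)

lemma geomSum_ne_top {r : ℝ} (h0 : 0 ≤ r) (h1 : r < 1) : geomSum r ≠ ∞ := by
  have h : Summable fun j : ℤ => r ^ j.natAbs :=
    Summable.of_nat_of_neg (by simpa using summable_geometric_of_lt_one h0 h1)
      (by simpa using summable_geometric_of_lt_one h0 h1)
  exact h.tsum_ofReal_ne_top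

lemma tsum_ofReal_pow_natAbs_sub_left (r : ℝ) (n : ℤ) :
    ∑' k : ℤ, ENNReal.ofReal (r ^ (n - k).natAbs) = geomSum r :=
  (Equiv.subLeft n).tsum_eq fun j : ℤ => ENNReal.ofReal (r ^ j.natAbs)

lemma tsum_ofReal_pow_natAbs_sub_right (r : ℝ) (k : ℤ) :
    ∑' n : ℤ, ENNReal.ofReal (r ^ (n - k).natAbs) = geomSum r :=
  (Equiv.subRight k).tsum_eq fun j : ℤ => ENNReal.ofReal (r ^ j.natAbs)

/-- Schur's test: M at the maximum is at most the sum of M at n and at k, and the kernel r^|n-k| is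
summable in either index. -/
lemma tsum_tsum_max_le (r : ℝ) (M : ℤ → ℝ≥0∞) :
    ∑' n : ℕ, ∑' k : ℤ, ENNReal.ofReal (r ^ ((n : ℤ) - k).natAbs) * M (max n k) ≤
      2 * geomSum r * ∑' m, M m := by
  have hmax : ∀ n k : ℤ, M (max n k) ≤ M n + M k := fun n k => by
    rcases le_total n k with h | h
    · rw [max_eq_right h]; exact le_add_self
    · rw [max_eq_left h]; exact le_self_add
  calc _ ≤ ∑' n : ℤ, ∑' k : ℤ, ENNReal.ofReal (r ^ (n - k).natAbs) * M (max n k) :=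
        ENNReal.tsum_comp_le_tsum_of_injective Nat.cast_injective
          (fun n : ℤ => ∑' k : ℤ, ENNReal.ofReal (r ^ (n - k).natAbs) * M (max n k))
    _ ≤ ∑' n : ℤ, ∑' k : ℤ, (ENNReal.ofReal (r ^ (n - k).natAbs) * M n +
          ENNReal.ofReal (r ^ (n - k).natAbs) * M k) := by
        gcongr with n k
        rw [← mul_add]
        gcongr
        exact hmax n k
    _ = (∑' n : ℤ, ∑' k : ℤ, ENNReal.ofReal (r ^ (n - k).natAbs) * M n) +
          ∑' n : ℤ, ∑' k : ℤ, ENNReal.ofReal (r ^ (n - k).natAbs) * M k := by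
        simp only [ENNReal.tsum_add]
    _ = geomSum r * (∑' m, M m) + geomSum r * ∑' m, M m := by
        congr 1
        · simp only [ENNReal.tsum_mul_right, tsum_ofReal_pow_natAbs_sub_left,
            ENNReal.tsum_mul_left]
        · rw [ENNReal.tsum_comm]
          simp only [ENNReal.tsum_mul_right, tsum_ofReal_pow_natAbs_sub_right,
            ENNReal.tsum_mul_left]
    _ = _ := by ring

lemma zpow_two_max (n k : ℤ) :
    (2 : ℝ) ^ (n + k) * 2 ^ (-(2 * max n k)) = (1 / 2) ^ (n - k).natAbs := by
  rw [← zpow_add₀ two_ne_zero, one_div, inv_pow, ← zpow_natCast, ← zpow_neg]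
  congr 1
  rcases le_total n k with h | h
  · rw [max_eq_right h]; omega
  · rw [max_eq_left h]; omega

/-- The two derivatives contribute (2 · 2^(n+k))², the modulation gain 3 · 2^{-(n+k)} and ∂_x⁻¹ the
factor 4 · 2^{-2 max}. The product is 48 · 2^{-|n-k|}, and the Cauchy–Schwarz weight (3/2)^|n-k|
reduces the decay to (3/4)^|n-k|. -/
lemma coefficient_eq (n k : ℤ) :
    (3 / 2 : ℝ) ^ (n - k).natAbs * (2 ^ (n + 1 + k)) ^ 2 * (threshold n k)⁻¹ *
      (4 * 2 ^ (-(2 * max n k))) = 48 * (3 / 4) ^ (n - k).natAbs := by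
  have h1 : (3 / 4 : ℝ) ^ (n - k).natAbs = (3 / 2) ^ (n - k).natAbs * (1 / 2) ^ (n - k).natAbs := by
    rw [← mul_pow]; norm_num
  have h2 : (2 : ℝ) ^ (n + 1 + k) = 2 * 2 ^ (n + k) := by
    rw [show n + 1 + k = n + k + 1 by ring, zpow_add_one₀ two_ne_zero, mul_comm]
  have h3 : (0 : ℝ) < 2 ^ (n + k) := by positivity
  rw [h1, ← zpow_two_max, h2, threshold]
  field_simp
  norm_num

/-- The dyadic intervals `[2 ^ n, 2 ^ (n + 1))`. -/
def dyadicInterval (n : ℕ) : Set ℝ := Set.Ico ((2 : ℝ) ^ (n : ℤ)) (2 ^ ((n : ℤ) + 1))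

lemma measurableSet_dyadicInterval (n : ℕ) : MeasurableSet (dyadicInterval n) := measurableSet_Ico

lemma dyadicInterval_subset (n : ℕ) : dyadicInterval n ⊆ Set.Ioi 0 := fun _ hx =>
  lt_of_lt_of_le (by positivity) hx.1

lemma pairwise_disjoint_dyadicInterval : Pairwise (Function.onFun Disjoint dyadicInterval) := by
  intro m n hmn
  refine Set.disjoint_left.mpr fun x hm hn => hmn ?_
  have h1 := zpow_two_lt_iff.mp (hm.1.trans_lt hn.2)
  have h2 := zpow_two_lt_iff.mp (hn.1.trans_lt hm.2)
  omega

lemma Ici_subset_iUnion_dyadicInterval : Set.Ici 1 ⊆ ⋃ n, dyadicInterval n := by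
  intro x hx
  have hx1 : (1 : ℝ) ≤ x := hx
  obtain ⟨l, h1, h2⟩ := exists_zpow_two_le_lt (zero_lt_one.trans_le hx1)
  have hl : 0 ≤ l := by
    have : (2 : ℝ) ^ (0 : ℤ) < 2 ^ (l + 1) := by rw [zpow_zero]; exact hx1.trans_lt h2
    have := zpow_two_lt_iff.mp this
    omega
  obtain ⟨n, rfl⟩ := Int.eq_ofNat_of_zero_le hl
  exact Set.mem_iUnion.mpr ⟨n, h1, h2⟩

/-- The constant in `outNorm_tsum_largePart_le`. -/
noncomputable def sumConst (κ : ℝ → ℂ) (s : ℝ) : ℝ≥0∞ :=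
  48 * ENNReal.ofReal (4 ^ (2 * s)) * largeConst κ

lemma outNorm_largePart_term_le {κ : ℝ → ℂ} (hκm : Measurable κ) (hκ : Integrable κ)
    {s : ℝ} (hs : 0 ≤ s) (w u : L2xt) (n : ℕ) (k : ℤ) :
    ENNReal.ofReal ((3 / 2) ^ ((n : ℤ) - k).natAbs) * outNorm (dyadicInterval n) (fun ζ =>
      ENNReal.ofReal ((1 + 2 ^ ((n : ℤ) + 1)) ^ s * 2 ^ ((n : ℤ) + 1 + k)) *
        largePart κ (spaceTimeFourier w) u n k ζ) ≤
      sumConst κ s * eLpNorm u 4 volume ^ 2 * (ENNReal.ofReal ((3 / 4) ^ ((n : ℤ) - k).natAbs) *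
        shellMass (spaceTimeFourier w) s (max n k)) := by
  set F := spaceTimeFourier w
  set m := max (n : ℤ) k with hm
  set j := ((n : ℤ) - k).natAbs with hj
  set u4 := eLpNorm u 4 volume ^ 2
  rw [outNorm_const_mul _ ENNReal.ofReal_ne_top]
  have h1 := outNorm_largePart_le hκm hκ (measurable_spaceTimeFourier w) (memLp_spaceTimeFourier w)
    u (measurableSet_dyadicInterval n) (dyadicInterval_subset n) n k
  have h2 : ENNReal.ofReal ((1 + 2 ^ ((n : ℤ) + 1)) ^ s * 2 ^ ((n : ℤ) + 1 + k)) ^ 2 =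
      ENNReal.ofReal ((1 + 2 ^ ((n : ℤ) + 1)) ^ (2 * s)) *
        ENNReal.ofReal ((2 ^ ((n : ℤ) + 1 + k)) ^ 2) := by
    rw [← ENNReal.ofReal_pow (by positivity), mul_pow, ENNReal.ofReal_mul (by positivity)]
    congr 2
    rw [← Real.rpow_mul_natCast (by positivity), mul_comm s]; norm_num
  have h3 : ENNReal.ofReal ((3 / 2) ^ j) * ENNReal.ofReal ((2 ^ ((n : ℤ) + 1 + k)) ^ 2) *
      ENNReal.ofReal (threshold n k)⁻¹ * ENNReal.ofReal (4 * 2 ^ (-(2 * m))) =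
      48 * ENNReal.ofReal ((3 / 4) ^ j) := by
    have ht := (threshold_pos n k).le
    rw [← ENNReal.ofReal_mul (by positivity), ← ENNReal.ofReal_mul (by positivity),
      ← ENNReal.ofReal_mul (by positivity), hj, hm, coefficient_eq, ENNReal.ofReal_mul (by norm_num)]
    norm_num
  calc _ ≤ ENNReal.ofReal ((3 / 2) ^ j) * (ENNReal.ofReal ((1 + 2 ^ ((n : ℤ) + 1)) ^ (2 * s)) *
        ENNReal.ofReal ((2 ^ ((n : ℤ) + 1 + k)) ^ 2) *
        (largeConst κ * ENNReal.ofReal (threshold n k)⁻¹ *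
          ENNReal.ofReal (4 * 2 ^ (-(2 * m))) * shellMass F 0 m * u4)) := by
        rw [h2]; gcongr
    _ = (ENNReal.ofReal ((3 / 2) ^ j) * ENNReal.ofReal ((2 ^ ((n : ℤ) + 1 + k)) ^ 2) *
        ENNReal.ofReal (threshold n k)⁻¹ * ENNReal.ofReal (4 * 2 ^ (-(2 * m)))) *
        (largeConst κ * u4) *
        (ENNReal.ofReal ((1 + 2 ^ ((n : ℤ) + 1)) ^ (2 * s)) * shellMass F 0 m) := by ring
    _ ≤ (48 * ENNReal.ofReal ((3 / 4) ^ j)) * (largeConst κ * u4) *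
        (ENNReal.ofReal (4 ^ (2 * s)) * shellMass F s m) := by
        rw [h3]
        exact mul_le_mul_right (ofReal_rpow_mul_shellMass_le F hs (le_max_left _ _)) _
    _ = _ := by rw [sumConst]; ring

lemma outNorm_tsum_largePart_le {κ : ℝ → ℂ} (hκm : Measurable κ) (hκ : Integrable κ)
    {s : ℝ} (hs : 0 ≤ s) (w u : L2xt) :
    ∑' n : ℕ, outNorm (dyadicInterval n) (fun ζ => ∑' k : ℤ,
      ENNReal.ofReal ((1 + 2 ^ ((n : ℤ) + 1)) ^ s * 2 ^ ((n : ℤ) + 1 + k)) *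
        largePart κ (spaceTimeFourier w) u n k ζ) ≤
      geomSum (2 / 3) * (sumConst κ s * eLpNorm u 4 volume ^ 2 * (2 * geomSum (3 / 4) *
        ∑' m, shellMass (spaceTimeFourier w) s m)) := by
  calc _ ≤ ∑' n : ℕ, geomSum (2 / 3) * ∑' k : ℤ, sumConst κ s * eLpNorm u 4 volume ^ 2 *
        (ENNReal.ofReal ((3 / 4) ^ ((n : ℤ) - k).natAbs) *
          shellMass (spaceTimeFourier w) s (max n k)) := by
        refine ENNReal.tsum_le_tsum fun n => ?_
        refine (outNorm_tsum_le (dyadicInterval n)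
          -- Any base strictly between 1 and 2 would serve: its inverse must be summable, and so
          -- must its product with 2^{-|n-k|}.
          (a := fun k => ENNReal.ofReal ((3 / 2) ^ ((n : ℤ) - k).natAbs)) (fun k => ?_) (fun k => ?_)
          fun k => ENNReal.ofReal_ne_top).trans ?_
        · exact (measurable_largePart hκ (measurable_spaceTimeFourier w) u n k).const_mul _
        · exact (ENNReal.ofReal_pos.mpr (by positivity)).ne'
        · refine mul_le_mul' (le_of_eq ?_)
            (ENNReal.tsum_le_tsum fun k => outNorm_largePart_term_le hκm hκ hs w u n k)
          rw [← tsum_ofReal_pow_natAbs_sub_left (2 / 3) n]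
          refine tsum_congr fun k => ?_
          rw [← ENNReal.ofReal_inv_of_pos (by positivity), ← inv_pow]
          norm_num
    _ ≤ _ := by
        simp only [ENNReal.tsum_mul_left]
        gcongr
        exact tsum_tsum_max_le _ _

/-- The squared `X^{s,1/2}` norm. -/
noncomputable def mass (F : ℝ × ℝ → ℂ) (s : ℝ) : ℝ≥0∞ :=
  ∫⁻ z, bracketPow (modulation z) 1 * bracketPow z.1 (2 * s) * ‖F z‖ₑ ^ 2

/-- The X^{0,-7/16} bound on the output followed by the dual Schrödinger estimate: w needs only
exponent 7/16 ≤ 1/2 of its modulation, and the weighted u enters through its L² norm. -/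
lemma outNorm_posWeighted_negWeighted_le (s : ℝ) (w u : L2xt) :
    outNorm (Set.Ioi 0) (fun ζ => 8 * ∫⁻ z, posWeighted s w z * negWeighted u (ζ - z)) ≤
      64 * (outConst * schrodingerConst * mass (spaceTimeFourier w) s *
        ∫⁻ z, negWeighted u z ^ 2) := by
  have hp := measurable_posWeighted s w
  have hn := measurable_negWeighted u
  rw [outNorm_const_mul _ (by simp)]
  norm_num only
  gcongr
  refine (outNorm_le_weighted measurableSet_Ioi subset_rfl (by fun_prop)).trans ?_
  calc _ ≤ outConst * (schrodingerConst *
        (∫⁻ z, bracketPow (z.2 + z.1 ^ 2) (7 / 8) * posWeighted s w z ^ 2) *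
          ∫⁻ z, negWeighted u z ^ 2) := by
        gcongr
        exact lintegral_weight_sq_conv_le hp hn
    _ ≤ outConst * (schrodingerConst * mass (spaceTimeFourier w) s *
          ∫⁻ z, negWeighted u z ^ 2) := by
        gcongr
        refine lintegral_mono fun z => ?_
        unfold posWeighted
        by_cases hz : z.1 ∈ Set.Ioi (0 : ℝ)
        · rw [Set.indicator_of_mem hz, mul_pow, bracketPow_sq, modulation_of_pos hz, mul_assoc]
          gcongr
          exact bracketPow_mono _ (by norm_num)
        · rw [Set.indicator_of_notMem hz]; simp
    _ = _ := by ring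

/-- The constant in the bilinear estimate. -/
noncomputable def totalConst (κ : ℝ → ℂ) (s : ℝ) : ℝ≥0∞ :=
  16 * geomSum (2 / 3) * sumConst κ s * geomSum (3 / 4) + 128 * outConst * schrodingerConst

lemma totalConst_ne_top {κ : ℝ → ℂ} (hκ : Integrable κ) (s : ℝ) : totalConst κ s ≠ ∞ := by
  have h1 : geomSum (2 / 3) ≠ ∞ := geomSum_ne_top (by norm_num) (by norm_num)
  have h2 : geomSum (3 / 4) ≠ ∞ := geomSum_ne_top (by norm_num) (by norm_num)
  have h3 := outConst_ne_top
  have h4 := schrodingerConst_ne_top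
  have h5 := bilinearConst_ne_top
  have h6 : ∫⁻ y, ‖κ y‖ₑ ≠ ∞ := hκ.2.ne
  unfold totalConst sumConst largeConst
  finiteness

lemma outNorm_interaction_le (hη : IsCutoff η) {κ : ℝ → ℂ} (hκm : Measurable κ)
    (hκi : Integrable κ) (hκ : ∀ x, 𝓕 κ x = negBump η x) {s : ℝ} (hs : 0 ≤ s) (w u : L2xt)
    (hint : ∀ ζ, Integrable (convIntegrand (dxInvHat w) (negDxHat u) ζ)) :
    outNorm (Set.Ici 1) (fun ζ => bracketPow ζ.1 s * (ENNReal.ofReal ζ.1 *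
      ‖∫ z, convIntegrand (dxInvHat w) (negDxHat u) ζ z‖ₑ)) ≤
      totalConst κ s * mass (spaceTimeFourier w) s *
        (eLpNorm u 4 volume ^ 2 + ∫⁻ z, negWeighted u z ^ 2) := by
  set G : ℝ × ℝ → ℝ≥0∞ := fun ζ => bracketPow ζ.1 s * (ENNReal.ofReal ζ.1 *
      ‖∫ z, convIntegrand (dxInvHat w) (negDxHat u) ζ z‖ₑ)
  set c : ℝ × ℝ → ℝ≥0∞ := fun ζ => 8 * ∫⁻ z, posWeighted s w z * negWeighted u (ζ - z)
  set g : ℕ → ℝ × ℝ → ℝ≥0∞ := fun n ζ => ∑' k : ℤ,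
      ENNReal.ofReal ((1 + 2 ^ ((n : ℤ) + 1)) ^ s * 2 ^ ((n : ℤ) + 1 + k)) *
        largePart κ (spaceTimeFourier w) u n k ζ
  set M := mass (spaceTimeFourier w) s with hM
  set N := ∫⁻ z, negWeighted u z ^ 2
  set u4 := eLpNorm u 4 volume ^ 2
  have hgm : ∀ n, Measurable (g n) := fun n => Measurable.tsum fun k =>
    (measurable_largePart hκi (measurable_spaceTimeFourier w) u n k).const_mul _
  calc outNorm (Set.Ici 1) G ≤ outNorm (⋃ n, dyadicInterval n) G :=
        lintegral_mono_set Ici_subset_iUnion_dyadicInterval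
    _ ≤ ∑' n, outNorm (dyadicInterval n) G := outNorm_iUnion_le _ _
    _ ≤ ∑' n, 2 * (outNorm (dyadicInterval n) (g n) + outNorm (dyadicInterval n) c) := by
        refine ENNReal.tsum_le_tsum fun n => ?_
        refine (outNorm_mono (measurableSet_dyadicInterval n) fun ζ hζ => ?_).trans
          (outNorm_add_le _ (hgm n))
        exact pointwise_bound hη hκi hκ hs w u (Int.natCast_nonneg n) hζ (hint ζ)
    _ = 2 * ((∑' n, outNorm (dyadicInterval n) (g n)) +
          ∑' n, outNorm (dyadicInterval n) c) := by
        rw [ENNReal.tsum_mul_left, ENNReal.tsum_add]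
    _ ≤ 2 * (geomSum (2 / 3) * (sumConst κ s * u4 * (2 * geomSum (3 / 4) * (4 * M))) +
          64 * (outConst * schrodingerConst * M * N)) := by
        gcongr
        · refine (outNorm_tsum_largePart_le hκm hκi hs w u).trans ?_
          gcongr
          exact tsum_shellMass_le (measurable_spaceTimeFourier w) s
        -- This majorant does not depend on n, so the disjoint dyadic intervals reassemble into the
        -- half-line without loss.
        · exact (tsum_outNorm_le measurableSet_dyadicInterval pairwise_disjoint_dyadicInterval
            dyadicInterval_subset c).trans (outNorm_posWeighted_negWeighted_le s w u)
    _ = 16 * geomSum (2 / 3) * sumConst κ s * geomSum (3 / 4) * (M * u4) +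
          128 * outConst * schrodingerConst * (M * N) := by ring
    _ ≤ totalConst κ s * (M * u4) + totalConst κ s * (M * N) := by
        gcongr
        · exact le_self_add
        · exact le_add_self
    _ = _ := by ring

/-! ### Translation to the X, Z and Z̃ norms. -/

lemma ennreal_sqrt_sq (x : ℝ≥0∞) : (x ^ (1 / 2 : ℝ)) ^ 2 = x := by
  rw [← ENNReal.rpow_natCast, ← ENNReal.rpow_mul]; norm_num

lemma ofReal_bracket_mul (x y p q : ℝ) :
    ENNReal.ofReal (bracket x ^ p * bracket y ^ q) = bracketPow x p * bracketPow y q :=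
  ENNReal.ofReal_mul (Real.rpow_nonneg (bracket_pos x).le _)

lemma xNorm_sq (s b : ℝ) (F : ℝ × ℝ → ℂ) : xNorm s b F ^ 2 =
    ∫⁻ z : ℝ × ℝ, bracketPow (modulation z) (2 * b) * bracketPow z.1 (2 * s) * ‖F z‖ₑ ^ 2 := by
  rw [xNorm, ennreal_sqrt_sq]
  simp only [ofReal_bracket_mul, modulation]

lemma zNorm_sq (s b : ℝ) (F : ℝ × ℝ → ℂ) : zNorm s b F ^ 2 =
    ∫⁻ ξ, (∫⁻ τ, bracketPow (τ + |ξ| * ξ) b * bracketPow ξ s * ‖F (ξ, τ)‖ₑ) ^ 2 := by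
  rw [zNorm, ennreal_sqrt_sq]
  simp only [ofReal_bracket_mul]

lemma xNorm_half_sq (s : ℝ) (F : ℝ × ℝ → ℂ) : xNorm s (1 / 2) F ^ 2 = mass F s := by
  rw [xNorm_sq, mass]; norm_num

lemma lintegral_negWeighted_sq_le (u : L2xt) :
    ∫⁻ z, negWeighted u z ^ 2 ≤ xNorm (-1) 1 (spaceTimeFourier u) ^ 2 := by
  rw [xNorm_sq]
  refine lintegral_mono fun z => ?_
  unfold negWeighted
  by_cases hz : z.1 ∈ Set.Iio (0 : ℝ)
  · rw [Set.indicator_of_mem hz, mul_pow, mul_pow, bracketPow_sq, bracketPow_sq]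
  · rw [Set.indicator_of_notMem hz]; simp

lemma outNorm_univ_le {A : Set ℝ} (hA : MeasurableSet A) {f g : ℝ × ℝ → ℝ≥0∞}
    (h : ∀ ζ : ℝ × ℝ, f ζ ≤ A.indicator (fun _ => g ζ) ζ.1) :
    outNorm Set.univ f ≤ outNorm A g := by
  unfold outNorm
  rw [Measure.restrict_univ, ← lintegral_indicator hA]
  refine lintegral_mono fun ξ => ?_
  by_cases hξ : ξ ∈ A
  · have h' : ∀ τ, f (ξ, τ) ≤ g (ξ, τ) := fun τ => by
      have := h (ξ, τ); rwa [Set.indicator_of_mem hξ] at this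
    rw [Set.indicator_of_mem hξ]
    gcongr with τ τ
    · exact h' τ
    · exact h' τ
  · have h' : ∀ τ, f (ξ, τ) = 0 := fun τ => by
      have := h (ξ, τ); rw [Set.indicator_of_notMem hξ] at this; exact le_zero_iff.mp this
    simp [h']

lemma xNorm_sq_add_zNorm_sq {F : ℝ × ℝ → ℂ} (hF : Measurable F) (s : ℝ) :
    xNorm s (-1 / 2) F ^ 2 + zNorm s (-1) F ^ 2 =
      outNorm Set.univ (fun ζ => bracketPow ζ.1 s * ‖F ζ‖ₑ) := by
  have h1 : Measurable fun z : ℝ × ℝ =>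
      bracketPow (modulation z) (-1) * bracketPow z.1 (2 * s) * ‖F z‖ₑ ^ 2 := by
    have := measurable_modulation
    fun_prop
  rw [xNorm_sq, zNorm_sq, outNorm, Measure.restrict_univ, show 2 * (-1 / 2 : ℝ) = -1 by norm_num,
    Measure.volume_eq_prod, lintegral_prod _ h1.aemeasurable,
    ← lintegral_add_left (h1.lintegral_prod_right')]
  refine lintegral_congr fun ξ => ?_
  simp only [mul_pow, bracketPow_sq, mul_assoc, modulation]

lemma zNorm_spaceMultiplier_sq {m : ℝ → ℂ} (F : ℝ × ℝ → ℂ) (s b : ℝ) :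
    zNorm s b (spaceMultiplier m F) ^ 2 = ∫⁻ ξ, ‖m ξ‖ₑ ^ 2 *
      (∫⁻ τ, bracketPow (τ + |ξ| * ξ) b * bracketPow ξ s * ‖F (ξ, τ)‖ₑ) ^ 2 := by
  rw [zNorm_sq]
  refine lintegral_congr fun ξ => ?_
  rw [← mul_pow, ← lintegral_const_mul' _ _ enorm_ne_top]
  congr 2 with τ
  rw [spaceMultiplier, enorm_mul]
  ring

lemma IsCutoff.measurable_lpSymbol (hη : IsCutoff η) (n : ℕ) : Measurable (lpSymbol η n) := by
  have := hη.smooth.continuous.measurable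
  unfold lpSymbol
  fun_prop

lemma IsCutoff.measurable_hiSymbol (hη : IsCutoff η) : Measurable (hiSymbol η) := by
  have := hη.smooth.continuous.measurable
  rw [funext hη.hiSymbol_eq]
  fun_prop

/-- The symbols depend on ξ only and so leave the inner τ-integral. The low-frequency symbol is at
most 1, and the squares of the dyadic symbols sum to at most 4 = 2², whence 3 = 1 + 2. -/
lemma IsCutoff.zTildeNorm_le (hη : IsCutoff η) (s b : ℝ) {F : ℝ × ℝ → ℂ} (hF : Measurable F) :
    zTildeNorm η s b F ≤ 3 * zNorm s b F := by
  have hlo : zNorm s b (spaceMultiplier (loSymbol η) F) ≤ zNorm s b F := by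
    rw [← ENNReal.pow_le_pow_left_iff two_ne_zero, zNorm_spaceMultiplier_sq, zNorm_sq]
    refine lintegral_mono fun ξ => ?_
    exact mul_le_of_le_one_left zero_le (pow_le_one' (hη.enorm_loSymbol_le ξ) 2)
  have hsum : (∑' n : ℕ, zNorm s b (spaceMultiplier (lpSymbol η n) F) ^ 2) ≤
      (2 * zNorm s b F) ^ 2 := by
    have hm : Measurable fun ξ => ∫⁻ τ, bracketPow (τ + |ξ| * ξ) b * bracketPow ξ s * ‖F (ξ, τ)‖ₑ :=
      Measurable.lintegral_prod_right' (f := fun z : ℝ × ℝ =>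
        bracketPow (z.2 + |z.1| * z.1) b * bracketPow z.1 s * ‖F z‖ₑ) (by fun_prop)
    simp only [zNorm_spaceMultiplier_sq]
    rw [← lintegral_tsum fun n => by
        have := hη.measurable_lpSymbol n
        fun_prop,
      mul_pow, zNorm_sq, ← lintegral_const_mul' _ _ (by finiteness)]
    refine lintegral_mono fun ξ => ?_
    rw [ENNReal.tsum_mul_right]
    gcongr
    exact (hη.tsum_enorm_lpSymbol_sq_le ξ).trans (by norm_num)
  have hsqrt : (∑' n : ℕ, zNorm s b (spaceMultiplier (lpSymbol η n) F) ^ 2) ^ (1 / 2 : ℝ) ≤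
      2 * zNorm s b F := by
    rw [← ENNReal.pow_le_pow_left_iff two_ne_zero, ennreal_sqrt_sq]
    exact hsum
  calc zTildeNorm η s b F ≤ zNorm s b F + 2 * zNorm s b F := add_le_add hlo hsqrt
    _ = 3 * zNorm s b F := by ring

lemma IsCutoff.measurable_bilinearHat (hη : IsCutoff η) (w u : L2xt) :
    Measurable (bilinearHat η w u) := by
  refine measurable_spaceMultiplier (by unfold dxSymbol; fun_prop)
    (measurable_spaceMultiplier ?_ ?_)
  · exact (measurable_one.indicator measurableSet_Ioi).mul hη.measurable_hiSymbol
  · exact (measurable_integral_convIntegrand (measurable_dxInvHat w)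
      (measurable_negDxHat u)).const_mul _

lemma IsCutoff.enorm_bilinearHat_le (hη : IsCutoff η) (w u : L2xt) (ζ : ℝ × ℝ) :
    ‖bilinearHat η w u ζ‖ₑ ≤ (Set.Ici (1 : ℝ)).indicator (fun _ => ENNReal.ofReal ζ.1 *
      ‖∫ z, convIntegrand (dxInvHat w) (negDxHat u) ζ z‖ₑ) ζ.1 := by
  have h1 := hη.enorm_posHiSymbol_le ζ.1
  have hpi : ‖((2 * Real.pi) ^ 2 : ℂ)⁻¹‖ₑ ≤ 1 := by
    rw [← ofReal_norm]
    refine ENNReal.ofReal_le_one.mpr ?_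
    rw [norm_inv, norm_pow, norm_mul, Complex.norm_real, Complex.norm_two, Real.norm_eq_abs,
      abs_of_pos Real.pi_pos]
    exact inv_le_one_of_one_le₀ (one_le_pow₀ (by linarith [Real.pi_gt_three]))
  simp only [bilinearHat, spaceMultiplier, fourierProduct, enorm_mul]
  by_cases hζ : ζ.1 ∈ Set.Ici (1 : ℝ)
  · rw [Set.indicator_of_mem hζ] at h1 ⊢
    have h0 : (0 : ℝ) ≤ ζ.1 := zero_le_one.trans hζ
    have hd : ‖dxSymbol ζ.1‖ₑ = ENNReal.ofReal ζ.1 := by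
      rw [dxSymbol, ← ofReal_norm, norm_mul, Complex.norm_I, one_mul, Complex.norm_real,
        Real.norm_of_nonneg h0]
    rw [hd]
    gcongr
    exact mul_le_of_le_one_of_le h1 (mul_le_of_le_one_left zero_le hpi)
  · rw [Set.indicator_of_notMem hζ] at h1 ⊢
    rw [le_zero_iff.mp h1]; simp

/-- If the spatial frequencies of `w` stay away from zero, then the convolution giving the Fourier
transform of `∂_x⁻¹ w · P_- ∂_x u` converges absolutely at every frequency. -/
lemma integrable_convIntegrand_dxInvHat_negDxHat (w u : L2xt) {δ : ℝ} (hδ : 0 < δ)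
    (hw : ∀ᵐ ζ : ℝ × ℝ, |ζ.1| < δ → spaceTimeFourier w ζ = 0) (ζ : ℝ × ℝ) :
    Integrable (convIntegrand (dxInvHat w) (negDxHat u) ζ) := by
  have hdom : Integrable fun z => (1 + |ζ.1| / δ) *
      ‖convIntegrand (spaceTimeFourier w) (spaceTimeFourier u) ζ z‖ :=
    (integrable_convIntegrand (memLp_spaceTimeFourier w) (memLp_spaceTimeFourier u) ζ).norm.const_mul _
  have hm : Measurable (convIntegrand (dxInvHat w) (negDxHat u) ζ) :=
    (measurable_dxInvHat w).mul ((measurable_negDxHat u).comp (measurable_const.sub measurable_id))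
  refine hdom.mono' hm.aestronglyMeasurable ?_
  filter_upwards [hw] with z hz
  rw [convIntegrand_dxInvHat_negDxHat, convIntegrand]
  by_cases h : |z.1| < δ
  · rw [hz h]; simp
  push Not at h
  have hz0 : 0 < |z.1| := hδ.trans_le h
  have h2 : ‖(Set.Iio (0 : ℝ)).indicator (fun ξ => (ξ : ℂ)) (ζ - z).1‖ ≤ |ζ.1| + |z.1| := by
    refine (norm_indicator_le_norm_self _ _).trans ?_
    rw [Complex.norm_real]
    exact abs_sub _ _
  -- At fixed ζ the symbol |ξ₂|/|ξ₁| is bounded by 1 + |ξ|/δ where w lives. This δ-dependent bound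
  -- serves convergence only and does not enter the estimates.
  have h3 : |z.1|⁻¹ * (|ζ.1| + |z.1|) ≤ 1 + |ζ.1| / δ := by
    rw [mul_add, inv_mul_cancel₀ hz0.ne', add_comm, mul_comm, ← div_eq_mul_inv]
    gcongr
  rw [norm_mul, norm_mul, norm_mul, norm_mul, norm_inv, Complex.norm_real, Real.norm_eq_abs]
  calc _ = (|z.1|⁻¹ * ‖(Set.Iio (0 : ℝ)).indicator (fun ξ => (ξ : ℂ)) (ζ - z).1‖) *
        (‖spaceTimeFourier w z‖ * ‖spaceTimeFourier u (ζ - z)‖) := by ring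
    _ ≤ _ := by
        refine mul_le_mul_of_nonneg_right (le_trans ?_ h3) (by positivity)
        gcongr

lemma xNorm_sq_add_zNorm_sq_bilinearHat_le (hη : IsCutoff η) {κ : ℝ → ℂ} (hκm : Measurable κ)
    (hκi : Integrable κ) (hκ : ∀ x, 𝓕 κ x = negBump η x) {s : ℝ} (hs : 0 ≤ s) (w u : L2xt)
    (hint : ∀ ζ, Integrable (convIntegrand (dxInvHat w) (negDxHat u) ζ)) :
    xNorm s (-1 / 2) (bilinearHat η w u) ^ 2 + zNorm s (-1) (bilinearHat η w u) ^ 2 ≤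
      ((1 + totalConst κ s) * xNorm s (1 / 2) (spaceTimeFourier w) *
        (eLpNorm u 2 volume + eLpNorm u 4 volume + xNorm (-1) 1 (spaceTimeFourier u))) ^ 2 := by
  set K := totalConst κ s
  set W := xNorm s (1 / 2) (spaceTimeFourier w) with hW
  set U := xNorm (-1) 1 (spaceTimeFourier u)
  calc _ = outNorm Set.univ (fun ζ => bracketPow ζ.1 s * ‖bilinearHat η w u ζ‖ₑ) :=
        xNorm_sq_add_zNorm_sq (hη.measurable_bilinearHat w u) s
    _ ≤ outNorm (Set.Ici 1) (fun ζ => bracketPow ζ.1 s * (ENNReal.ofReal ζ.1 *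
          ‖∫ z, convIntegrand (dxInvHat w) (negDxHat u) ζ z‖ₑ)) := by
        refine outNorm_univ_le measurableSet_Ici fun ζ => ?_
        rw [Set.indicator_const_mul]
        gcongr
        exact hη.enorm_bilinearHat_le w u ζ
    _ ≤ K * mass (spaceTimeFourier w) s * (eLpNorm u 4 volume ^ 2 + ∫⁻ z, negWeighted u z ^ 2) :=
        outNorm_interaction_le hη hκm hκi hκ hs w u hint
    _ ≤ (1 + K) ^ 2 * W ^ 2 * (eLpNorm u 2 volume + eLpNorm u 4 volume + U) ^ 2 := by
        rw [hW, xNorm_half_sq]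
        gcongr ?_ * _ * ?_
        -- Replacing K by (1 + K)² makes the right-hand side a perfect square, so the final constant
        -- needs no square root.
        · calc K ≤ 1 + K := le_add_self
            _ ≤ (1 + K) ^ 2 := le_self_pow le_self_add two_ne_zero
        · calc _ ≤ eLpNorm u 4 volume ^ 2 + U ^ 2 := by
                gcongr; exact lintegral_negWeighted_sq_le u
            _ ≤ (eLpNorm u 4 volume + U) ^ 2 := by
                rw [add_sq]
                gcongr
                exact le_self_add
            _ ≤ _ := by
                gcongr
                exact le_add_self
    _ = _ := by ring

end BenjaminOno

theorem proposition3p2 (η : ℝ → ℝ) (hη : BenjaminOno.IsCutoff η) (s : ℝ) (hs : 0 ≤ s) :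
    ∃ C : ℝ≥0, ∀ (w u : BenjaminOno.L2xt) (δ : ℝ), 0 < δ →
      -- the spatial frequencies of `w` stay away from `0`
      (∀ᵐ ζ : ℝ × ℝ, |ζ.1| < δ → BenjaminOno.spaceTimeFourier w ζ = 0) →
      -- `w ∈ X^{s,1/2}` and `u ∈ L² ∩ L⁴ ∩ X^{-1,1}`
      BenjaminOno.xNorm s (1 / 2) (BenjaminOno.spaceTimeFourier w) < ∞ →
      MemLp u 4 volume →
      BenjaminOno.xNorm (-1) 1 (BenjaminOno.spaceTimeFourier u) < ∞ →
      -- the product `∂_x⁻¹ w · P_- ∂_x u` is well defined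
      (∀ ζ : ℝ × ℝ, Integrable
        (BenjaminOno.convIntegrand (BenjaminOno.dxInvHat w) (BenjaminOno.negDxHat u) ζ)) ∧
      BenjaminOno.xNorm s (-1 / 2) (BenjaminOno.bilinearHat η w u) ≤
        C * BenjaminOno.xNorm s (1 / 2) (BenjaminOno.spaceTimeFourier w) *
          (eLpNorm u 2 volume + eLpNorm u 4 volume +
            BenjaminOno.xNorm (-1) 1 (BenjaminOno.spaceTimeFourier u)) ∧
      BenjaminOno.zTildeNorm η s (-1) (BenjaminOno.bilinearHat η w u) ≤
        C * BenjaminOno.xNorm s (1 / 2) (BenjaminOno.spaceTimeFourier w) *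
          (eLpNorm u 2 volume + eLpNorm u 4 volume +
            BenjaminOno.xNorm (-1) 1 (BenjaminOno.spaceTimeFourier u)) := by
  obtain ⟨κ, hκ⟩ := hη.exists_fourier_eq_negBump
  have htop : 3 * (1 + BenjaminOno.totalConst κ s) ≠ ∞ := by
    have := BenjaminOno.totalConst_ne_top κ.integrable s
    finiteness
  -- The factor 3 is the loss from Z to Z̃. The constant depends on s and, through the kernel κ, on
  -- η.
  refine ⟨(3 * (1 + BenjaminOno.totalConst κ s)).toNNReal, fun w u δ hδ hw _ _ _ => ?_⟩
  rw [ENNReal.coe_toNNReal htop]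
  have hint := BenjaminOno.integrable_convIntegrand_dxInvHat_negDxHat w u hδ hw
  have key := BenjaminOno.xNorm_sq_add_zNorm_sq_bilinearHat_le hη κ.continuous.measurable
    κ.integrable hκ hs w u hint
  have hX := (ENNReal.pow_le_pow_left_iff two_ne_zero).mp (le_self_add.trans key)
  have hZ := (ENNReal.pow_le_pow_left_iff two_ne_zero).mp (le_add_self.trans key)
  refine ⟨hint, hX.trans ?_, ?_⟩
  · gcongr
    exact le_mul_of_one_le_left zero_le (by norm_num)
  · refine (hη.zTildeNorm_le s (-1) (hη.measurable_bilinearHat w u)).trans ?_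
    rw [mul_assoc 3, mul_assoc 3]
    gcongr
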